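/- Let $G$ be one of the following groups of unitary operators on a complex Hilbert space $H$: the unitary group $U(H)$ with $H$ finite dimensional (for example $U(n)$); the diagonal torus $\mathbb T^n\subset U(n)$ acting on $H=\mathbb C^n$; or, for $H$ infinite dimensional and separable and real $p\ge 1$, the Banach Lie group $U_p(H)$ of all unitary operators $g$ such that $g-1$ lies in the Schatten ideal $\mathcal L_p(H)$, with the manifold structure it has as a submanifold of $1+\mathcal L_p(H)$. Let $U_0(1)=U(1)\setminus\{1\}$, and for $z_1,z_2\in U_0(1)$ write $z_1>z_2$ if the argument of $z_1$ in $(0,2\pi)$ is larger than that of $z_2$. Put $$Y=\{(z,g)\in U(1)\times G : z\notin \mathrm{spec}(g)\cup\{1\}\},\qquad \pi\colon Y\to G,\quad \pi(z,g)=g,$$ and let $Y^{[p]}$ be the $p$-fold fibre product, whose points are written $(z_1,\dots,z_p,g)$. Let $E_{(z_1,z_2,g)}\subset H$ be the sum of the eigenspaces of $g$ for the eigenvalues $\lambda$ with $z_1>\lambda>z_2$. Call $(z_1,z_2,g)\in Y^{[2]}$ positive if $z_1>z_2$ and there are eigenvalues of $g$ strictly between $z_2$ and $z_1$, negative if $(z_2,z_1,g)$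 is positive, and null otherwise. Let $$L_{(z_1,z_2,g)}=\det E_{(z_1,z_2,g)},\qquad \mathbb C,\qquad (\det E_{(z_2,z_1,g)})^*$$ if $(z_1,z_2,g)$ is positive, null, negative respectively, with the hermitian inner product induced by that of $H$. The local frames of $L$ that define its smooth structure are the wedge products of smooth local frames of $E$ over the positive part, their duals over the negative part, and the constant $1$ over the null part. Then: 1. $Y$ is open in $U(1)\times G$; the positive, null and negative parts of $Y^{[2]}$ are open; every $E_{(z_1,z_2,g)}$ is finite dimensional; and the orthogonal projection $P(z_1,z_2,g)$ onto $E_{(z_1,z_2,g)}$ is a smooth map $Y^{[2]}\to B(H)$. For every positive point there are a neighbourhood in $Y^{[2]}$ and a fixed circle $C$ which is disjoint from $\mathrm{spec}(g)$ for all $(z_1,z_2,g)$ in the neighbourhood and satisfies there $$P(z_1,z_2,g)=\frac1{2\pi i}\oint_C(\xi-g)^{-1}\,d\xi .$$ 2. $L$ is a smooth and locally trivial hermitian line bundle on $Y^{[2]}$. 3. The map $\pi$ is a surjective submersion, and there are smooth hermitian isomorphisms $$L_{(z_1,z_2,g)}\otimes L_{(z_2,z_3,g)}\to L_{(z_1,z_3,g)}\qquad\text{on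 } Y^{[3]},$$ which are given by the wedge product (scalar multiplication where a factor is $\mathbb C$) if $z_1\ge z_2\ge z_3$, which are antisymmetric, meaning that $u'\cdot(u\cdot w)=\langle u,u'\rangle w$ and $(u\cdot w)\cdot w'=\langle w,w'\rangle u$ for $u\in L_{(z_1,z_2,g)}$, $u'\in L_{(z_2,z_1,g)}$, $w\in L_{(z_2,z_3,g)}$, $w'\in L_{(z_3,z_2,g)}$, where $\langle\cdot,\cdot\rangle$ is the canonical duality pairing between $L_{(z_i,z_j,g)}$ and $L_{(z_j,z_i,g)}$, and which are associative on $Y^{[4]}$. With this multiplication, $(L,Y)$ is a hermitian bundle gerbe on $G$. -/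

import Mathlib

open scoped InnerProductSpace ENNReal ContDiff

universe u v

noncomputable section

namespace BasicGerbe

/-! ## Smooth maps on embedded submanifolds

All manifolds here are submanifolds of real normed (Banach) spaces.  Such a manifold is a type `X`
together with its inclusion `emb : X → 𝓔`; it carries the induced topology, and a map out of it is
smooth if it is locally the restriction of a smooth map on an open subset of `𝓔`. -/

section Smooth

variable {X : Type*} {𝓔 : Type*} [NormedAddCommGroup 𝓔] [NormedSpace ℝ 𝓔]
  {F : Type*} [NormedAddCommGroup F] [NormedSpace ℝ F]

/-- `U` is open in the topology that `X` inherits from the ambient space. -/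
def IsOpenAlong (emb : X → 𝓔) (U : Set X) : Prop :=
  ∃ W : Set 𝓔, IsOpen W ∧ U = emb ⁻¹' W

/-- `f` is smooth (`C^∞`) on the subset `U` of the embedded manifold `emb : X → 𝓔`. -/
def SmoothAlong (emb : X → 𝓔) (U : Set X) (f : X → F) : Prop :=
  ∀ x ∈ U, ∃ W : Set 𝓔, IsOpen W ∧ emb x ∈ W ∧
    ∃ f' : 𝓔 → F, ContDiffOn ℝ ∞ f' W ∧ ∀ y ∈ U, emb y ∈ W → f y = f' (emb y)

/-- `π : Y → M` is a surjective submersion: it is smooth, onto, and there is a smooth local section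
of `π` through every point of `Y`. -/
structure IsSurjectiveSubmersion {Y M 𝓨 𝓜 : Type*}
    [NormedAddCommGroup 𝓨] [NormedSpace ℝ 𝓨] [NormedAddCommGroup 𝓜] [NormedSpace ℝ 𝓜]
    (embY : Y → 𝓨) (embM : M → 𝓜) (π : Y → M) : Prop where
  smooth : SmoothAlong embY Set.univ (fun y => embM (π y))
  surjective : Function.Surjective π
  exists_section : ∀ y : Y, ∃ U : Set M, IsOpenAlong embM U ∧ π y ∈ U ∧
    ∃ σ : M → Y, SmoothAlong embM U (fun m => embY (σ m)) ∧ (∀ m ∈ U, π (σ m) = m) ∧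
      σ (π y) = y

end Smooth

/-! ## Hermitian line bundles and hermitian bundle gerbes -/

/-- A family `L` of complex vector spaces over the embedded manifold `emb : X → 𝓔`, with a form `h`
on each fibre and a class `frame` of local frames (`frame U f` means that `f` is one of the chosen
frames over `U`; values of `f` outside `U` play no role), is a smooth, locally trivial hermitian line
bundle: the fibres are one-dimensional, the frames have open domains which cover `X`, they do not
vanish, any two of them differ by a smooth function, and `h` is a smooth hermitian inner product
(conjugate linear in the first variable). -/
structure IsHermitianLineBundle {X : Type*} {𝓔 : Type*} [NormedAddCommGroup 𝓔] [NormedSpace ℝ 𝓔]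
    (emb : X → 𝓔) (L : X → Type u) [∀ x, AddCommGroup (L x)] [∀ x, Module ℂ (L x)]
    (h : ∀ x, L x → L x → ℂ) (frame : Set X → (∀ x, L x) → Prop) : Prop where
  rank_one : ∀ x, Module.finrank ℂ (L x) = 1
  isOpen_of_frame : ∀ U f, frame U f → IsOpenAlong emb U
  locally_trivial : ∀ x, ∃ U f, frame U f ∧ x ∈ U
  frame_ne_zero : ∀ U f, frame U f → ∀ x ∈ U, f x ≠ 0
  smooth_transition : ∀ U f V f', frame U f → frame V f' →
    ∃ c : X → ℂ, SmoothAlong emb (U ∩ V) c ∧ ∀ x ∈ U ∩ V, f' x = c x • f x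
  add_right : ∀ x (a b c : L x), h x a (b + c) = h x a b + h x a c
  smul_right : ∀ x (r : ℂ) (a b : L x), h x a (r • b) = r * h x a b
  conj_symm : ∀ x (a b : L x), (starRingEnd ℂ) (h x a b) = h x b a
  re_pos : ∀ x (a : L x), a ≠ 0 → 0 < (h x a a).re
  smooth_metric : ∀ U f, frame U f → SmoothAlong emb U (fun x => h x (f x) (f x))

section Gerbe

variable {Y M : Type*} (π : Y → M)

/-- The fibre product `Y^{[2]}`. -/
abbrev FibreSq : Type _ := {y : Y × Y // π y.1 = π y.2}

/-- The fibre product `Y^{[3]}`. -/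
abbrev FibreCube : Type _ := {y : Y × Y × Y // π y.1 = π y.2.1 ∧ π y.2.1 = π y.2.2}

variable {π}

/-- The inclusion of `Y^{[2]}` in the square of the ambient space of `Y`. -/
def embSq {𝓨 : Type*} (embY : Y → 𝓨) (y : FibreSq π) : 𝓨 × 𝓨 := (embY y.1.1, embY y.1.2)

/-- The inclusion of `Y^{[3]}` in the cube of the ambient space of `Y`. -/
def embCube {𝓨 : Type*} (embY : Y → 𝓨) (y : FibreCube π) : 𝓨 × 𝓨 × 𝓨 :=
  (embY y.1.1, embY y.1.2.1, embY y.1.2.2)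

/-- `(y₁, y₂, y₃) ↦ (y₁, y₂)`. -/
def face12 (y : FibreCube π) : FibreSq π := ⟨(y.1.1, y.1.2.1), y.2.1⟩

/-- `(y₁, y₂, y₃) ↦ (y₂, y₃)`. -/
def face23 (y : FibreCube π) : FibreSq π := ⟨(y.1.2.1, y.1.2.2), y.2.2⟩

/-- `(y₁, y₂, y₃) ↦ (y₁, y₃)`. -/
def face13 (y : FibreCube π) : FibreSq π := ⟨(y.1.1, y.1.2.2), y.2.1.trans y.2.2⟩

/-- A multiplication `L_{(y₁,y₂)} ⊗ L_{(y₂,y₃)} → L_{(y₁,y₃)}` on a line bundle over `Y^{[2]}`, as a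
bilinear map for each `(y₁, y₂, y₃) ∈ Y^{[3]}`. -/
abbrev GerbeMul (L : FibreSq π → Type u) [∀ y, AddCommGroup (L y)] [∀ y, Module ℂ (L y)] :
    Type _ :=
  ∀ (a b c : Y) (hab : π a = π b) (hbc : π b = π c),
    L ⟨(a, b), hab⟩ →ₗ[ℂ] L ⟨(b, c), hbc⟩ →ₗ[ℂ] L ⟨(a, c), hab.trans hbc⟩

/-- `(L, Y)`, with the multiplication `mul`, is a hermitian bundle gerbe on `M`: `π : Y → M` is a
surjective submersion, `L → Y^{[2]}` is a smooth hermitian line bundle, and `mul` is smooth,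
isometric on `L_{(y₁,y₂)} ⊗ L_{(y₂,y₃)}` (hence a hermitian isomorphism onto `L_{(y₁,y₃)}`) and
associative over `Y^{[4]}`. -/
structure IsHermitianBundleGerbe {𝓨 𝓜 : Type*}
    [NormedAddCommGroup 𝓨] [NormedSpace ℝ 𝓨] [NormedAddCommGroup 𝓜] [NormedSpace ℝ 𝓜]
    (embY : Y → 𝓨) (embM : M → 𝓜) (π : Y → M)
    (L : FibreSq π → Type u) [∀ y, AddCommGroup (L y)] [∀ y, Module ℂ (L y)]
    (h : ∀ y, L y → L y → ℂ) (frame : Set (FibreSq π) → (∀ y, L y) → Prop)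
    (mul : GerbeMul L) : Prop where
  submersion : IsSurjectiveSubmersion embY embM π
  lineBundle : IsHermitianLineBundle (embSq embY) L h frame
  smooth_mul : ∀ U₁ f₁ U₂ f₂ U₃ f₃, frame U₁ f₁ → frame U₂ f₂ → frame U₃ f₃ →
    ∃ c : FibreCube π → ℂ,
      SmoothAlong (embCube embY) (face12 ⁻¹' U₁ ∩ face23 ⁻¹' U₂ ∩ face13 ⁻¹' U₃) c ∧
      ∀ y ∈ face12 ⁻¹' U₁ ∩ face23 ⁻¹' U₂ ∩ face13 ⁻¹' U₃,
        mul y.1.1 y.1.2.1 y.1.2.2 y.2.1 y.2.2 (f₁ (face12 y)) (f₂ (face23 y))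
          = c y • f₃ (face13 y)
  isometric : ∀ (a b c : Y) (hab : π a = π b) (hbc : π b = π c)
    (u u' : L ⟨(a, b), hab⟩) (w w' : L ⟨(b, c), hbc⟩),
    h _ (mul a b c hab hbc u w) (mul a b c hab hbc u' w') = h _ u u' * h _ w w'
  assoc : ∀ (a b c d : Y) (hab : π a = π b) (hbc : π b = π c) (hcd : π c = π d)
    (u : L ⟨(a, b), hab⟩) (w : L ⟨(b, c), hbc⟩) (t : L ⟨(c, d), hcd⟩),
    mul a c d (hab.trans hbc) hcd (mul a b c hab hbc u w) t
      = mul a b d hab (hbc.trans hcd) u (mul b c d hbc hcd w t)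

end Gerbe

/-! ## Determinant lines -/

section Det

variable (V : Type u) [NormedAddCommGroup V] [InnerProductSpace ℂ V]

/-- The top exterior power of a (finite-dimensional) vector space. -/
abbrev Det : Type u := ⋀[ℂ]^(Module.finrank ℂ V) V

open Classical in
/-- The linear form on `det V` which is `1` on the wedge product of an orthonormal basis. -/
def detCoord : Det V →ₗ[ℂ] ℂ :=
  if _h : FiniteDimensional ℂ V then
    exteriorPower.alternatingMapLinearEquiv (stdOrthonormalBasis ℂ V).toBasis.det
  else 0

open Classical in
/-- The wedge product of an orthonormal basis of `V`. -/
def detUnit : Det V :=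
  if _h : FiniteDimensional ℂ V then
    exteriorPower.ιMulti ℂ (Module.finrank ℂ V) (stdOrthonormalBasis ℂ V)
  else 0

variable {V}

/-- The form `conj (detCoord a) * detCoord b` is the usual inner product on the exterior power. -/
theorem conj_detCoord_mul_detCoord [FiniteDimensional ℂ V]
    (x y : Fin (Module.finrank ℂ V) → V) :
    (starRingEnd ℂ) (detCoord V (exteriorPower.ιMulti ℂ _ x)) *
        detCoord V (exteriorPower.ιMulti ℂ _ y)
      = Matrix.det (Matrix.of fun i k => ⟪x i, y k⟫_ℂ) := by
  have hx : ∀ x : Fin (Module.finrank ℂ V) → V, detCoord V (exteriorPower.ιMulti ℂ _ x)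
      = Matrix.det ((stdOrthonormalBasis ℂ V).toBasis.toMatrix x) := by
    intro x
    rw [detCoord, dif_pos ‹FiniteDimensional ℂ V›, exteriorPower.alternatingMapLinearEquiv_apply_ιMulti,
      Module.Basis.det_apply]
  rw [hx, hx, starRingEnd_apply, ← Matrix.det_conjTranspose, ← Matrix.det_mul]
  congr 1
  ext i k
  rw [Matrix.mul_apply, Matrix.of_apply, ← (stdOrthonormalBasis ℂ V).sum_inner_mul_inner (x i) (y k)]
  refine Finset.sum_congr rfl fun l _ => ?_
  simp [Module.Basis.toMatrix_apply, OrthonormalBasis.repr_apply_apply]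

end Det

section DetPow

variable {H : Type u} [NormedAddCommGroup H] [InnerProductSpace ℂ H]

/-- `det V`, the trivial line `ℂ`, or `(det W)^*`, according to a sign. -/
def DetPow (s : SignType) (V W : Submodule ℂ H) : Type u :=
  match s with
  | .pos => Det V
  | .zero => ULift.{u} ℂ
  | .neg => Module.Dual ℂ (Det W)

instance (s : SignType) (V W : Submodule ℂ H) : AddCommGroup (DetPow s V W) :=
  match s with
  | .pos => inferInstanceAs (AddCommGroup (Det V))
  | .zero => inferInstanceAs (AddCommGroup (ULift.{u} ℂ))
  | .neg => inferInstanceAs (AddCommGroup (Module.Dual ℂ (Det W)))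

instance (s : SignType) (V W : Submodule ℂ H) : Module ℂ (DetPow s V W) :=
  match s with
  | .pos => inferInstanceAs (Module ℂ (Det V))
  | .zero => inferInstanceAs (Module ℂ (ULift.{u} ℂ))
  | .neg => inferInstanceAs (Module ℂ (Module.Dual ℂ (Det W)))

/-- A unitary coordinate on `DetPow s V W`. -/
def DetPow.coord : (s : SignType) → (V W : Submodule ℂ H) → DetPow s V W → ℂ
  | .pos, V, _, a => detCoord V a
  | .zero, _, _, a => ULift.down a
  | .neg, _, W, φ => DFunLike.coe (F := Module.Dual ℂ (Det W)) φ (detUnit W)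

/-- The hermitian inner product on `DetPow s V W`: the inner product
`⟨x₁ ∧ ⋯ ∧ xₖ, y₁ ∧ ⋯ ∧ yₖ⟩ = det ⟨xᵢ, yⱼ⟩` on `det V`, the standard one on `ℂ`, and the dual one
on `(det W)^*`. -/
def DetPow.herm (s : SignType) (V W : Submodule ℂ H) (a b : DetPow s V W) : ℂ :=
  (starRingEnd ℂ) (DetPow.coord s V W a) * DetPow.coord s V W b

/-- `a` is the element of `DetPow s V W` determined by a basis `e` of `V` (if `s = 1`) or a basis
`e'` of `W` (if `s = -1`): the wedge product of `e`, the number `1`, or the dual of the wedge product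
of `e'`, respectively. -/
def DetPow.IsWedge : (s : SignType) → (V W : Submodule ℂ H) → (e : ℕ → V) → (e' : ℕ → W) →
    DetPow s V W → Prop
  | .pos, V, _, e, _, a =>
      LinearIndependent ℂ (fun i : Fin (Module.finrank ℂ V) => e i) ∧
        a = exteriorPower.ιMulti ℂ (Module.finrank ℂ V) (fun i => e i)
  | .zero, _, _, _, _, a => ULift.down a = (1 : ℂ)
  | .neg, _, W, _, e', φ =>
      LinearIndependent ℂ (fun i : Fin (Module.finrank ℂ W) => e' i) ∧
        DFunLike.coe (F := Module.Dual ℂ (Det W)) φ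
          (exteriorPower.ιMulti ℂ (Module.finrank ℂ W) (fun i => e' i)) = (1 : ℂ)

/-- The image of an element of `det V` or of `ℂ` in the exterior algebra of `H`.  Only used for
non-negative signs. -/
def DetPow.toExterior : (s : SignType) → (V W : Submodule ℂ H) → DetPow s V W → ExteriorAlgebra ℂ H
  | .pos, V, _, a => ExteriorAlgebra.map V.subtype (a : Det V).1
  | .zero, _, _, a => algebraMap ℂ (ExteriorAlgebra ℂ H) (ULift.down a)
  | .neg, _, _, _ => 0

/-- The canonical pairing of `DetPow s V W` with `DetPow (-s) W V`, i.e. of `det V` with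
`(det V)^*`, of `ℂ` with `ℂ`, and of `(det W)^*` with `det W`.  Only used for opposite signs. -/
def DetPow.pairing : (s t : SignType) → (V W : Submodule ℂ H) → DetPow s V W → DetPow t W V → ℂ
  | .pos, .neg, V, _, a, φ => DFunLike.coe (F := Module.Dual ℂ (Det V)) φ a
  | .neg, .pos, _, W, φ, a => DFunLike.coe (F := Module.Dual ℂ (Det W)) φ a
  | .zero, .zero, _, _, a, b => (ULift.down a : ℂ) * (ULift.down b : ℂ)
  | _, _, _, _, _, _ => 0

end DetPow

/-! ## The basic bundle gerbe of a group of unitary operators -/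

/-- The angle of a point `z ≠ 1` of the circle, in `(0, 2π)`.  On the circle without `1`, a point `z`
is larger than `w` (that is, `w` can be rotated positively into `z` without passing through `1`) if
and only if `angle w < angle z`. -/
def angle (z : Circle) : ℝ := Complex.arg (-(z : ℂ)) + Real.pi

theorem exp_angle (z : Circle) : Circle.exp (angle z) = z := by
  have hz : -(z : ℂ) = Complex.exp (Complex.arg (-(z : ℂ)) * Complex.I) := by
    have h := Complex.norm_mul_exp_arg_mul_I (-(z : ℂ))
    rw [norm_neg, Circle.norm_coe] at h
    simpa using h.symm
  ext
  rw [Circle.coe_exp, angle, Complex.ofReal_add, add_mul, Complex.exp_add, ← hz,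
    Complex.exp_pi_mul_I]
  ring

theorem angle_mem_Ioo (z : Circle) (hz : z ≠ 1) : angle z ∈ Set.Ioo 0 (2 * Real.pi) := by
  have h1 := Complex.neg_pi_lt_arg (-(z : ℂ))
  have h2 := Complex.arg_le_pi (-(z : ℂ))
  refine ⟨by unfold angle; linarith, ?_⟩
  rcases lt_or_eq_of_le h2 with h | h
  · unfold angle; linarith
  · exfalso
    apply hz
    rw [← exp_angle z, angle, h, ← two_mul, Circle.exp_two_pi]

section Basic

variable {H : Type u} [NormedAddCommGroup H] [InnerProductSpace ℂ H] [CompleteSpace H]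
  (G : Subgroup (unitary (H →L[ℂ] H)))

/-- An element of `G` as an operator on `H`. -/
def op {G : Subgroup (unitary (H →L[ℂ] H))} (g : G) : H →L[ℂ] H := ((g : unitary (H →L[ℂ] H)) : _)

/-- `Y = {(z, g) : z ∉ spec g ∪ {1}}`. -/
abbrev Y : Type u :=
  {y : Circle × G // y.1 ≠ 1 ∧ (y.1 : ℂ) ∉ spectrum ℂ (op y.2)}

/-- The projection `Y → G`. -/
def proj (y : Y G) : G := y.1.2

/-- If `G` is embedded in `𝓘`, then `Y` is embedded in `ℂ × 𝓘`. -/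
def embY {𝓘 : Type v} (j : G → 𝓘) (y : Y G) : ℂ × 𝓘 := ((y.1.1 : ℂ), j y.1.2)

variable {G}

/-- For `a = (z₁, g)` and `b = (z₂, g)`: the sum of the eigenspaces of `g` for the eigenvalues `λ` with
`z₁ > λ > z₂`.  It is zero if `z₁ ≤ z₂`. -/
def eigenSum (a b : Y G) : Submodule ℂ H :=
  ⨆ (l : Circle) (_ : angle b.1.1 < angle l ∧ angle l < angle a.1.1),
    Module.End.eigenspace ((op a.1.2 : H →L[ℂ] H) : H →ₗ[ℂ] H) (l : ℂ)

/-- `(z₁, z₂, g)` is positive: `z₁ > z₂` and there are eigenvalues of `g` between them. -/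
def IsPositive (a b : Y G) : Prop :=
  ∃ l : Circle, (angle b.1.1 < angle l ∧ angle l < angle a.1.1) ∧
    Module.End.HasEigenvalue ((op a.1.2 : H →L[ℂ] H) : H →ₗ[ℂ] H) (l : ℂ)

open Classical in
/-- The type (positive, null or negative) of `(z₁, z₂, g)`. -/
def sgn (a b : Y G) : SignType :=
  if IsPositive a b then .pos else if IsPositive b a then .neg else .zero

variable (G)

/-- The points of `Y^{[2]}` of a given type. -/
def stratum (s : SignType) : Set (FibreSq (proj G)) := {y | sgn y.1.1 y.1.2 = s}

/-- The line bundle: `L_{(z₁,z₂,g)}` is `det E_{(z₁,z₂,g)}`, `ℂ` or `(det E_{(z₂,z₁,g)})^*` for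
`(z₁, z₂, g)` positive, null or negative. -/
abbrev L (y : FibreSq (proj G)) : Type u :=
  DetPow (sgn y.1.1 y.1.2) (eigenSum y.1.1 y.1.2) (eigenSum y.1.2 y.1.1)

/-- The hermitian structure of `L`. -/
def herm (y : FibreSq (proj G)) : L G y → L G y → ℂ := DetPow.herm _ _ _

/-- The local frames of `L` which define its smooth structure: wedge products of smooth local frames
of the bundle `E` of eigenspaces over the positive part, their duals over the negative part, the
constant `1` over the null part. -/
def frame {𝓘 : Type v} [NormedAddCommGroup 𝓘] [NormedSpace ℝ 𝓘] (j : G → 𝓘)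
    (U : Set (FibreSq (proj G))) (f : ∀ y, L G y) : Prop :=
  IsOpenAlong (embSq (embY G j)) U ∧
  ∃ (e : ℕ → ∀ y : FibreSq (proj G), eigenSum y.1.1 y.1.2)
    (e' : ℕ → ∀ y : FibreSq (proj G), eigenSum y.1.2 y.1.1),
    (∀ i, SmoothAlong (embSq (embY G j)) U (fun y => (e i y : H))) ∧
    (∀ i, SmoothAlong (embSq (embY G j)) U (fun y => (e' i y : H))) ∧
    ∀ y ∈ U, DetPow.IsWedge _ _ _ (fun i => e i y) (fun i => e' i y) (f y)

/-- For `z₁ ≥ z₂ ≥ z₃` the multiplication is the wedge product. -/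
def IsWedgeProduct (mul : GerbeMul (L G)) : Prop :=
  ∀ (a b c : Y G) (hab : proj G a = proj G b) (hbc : proj G b = proj G c)
    (u : L G ⟨(a, b), hab⟩) (w : L G ⟨(b, c), hbc⟩),
    angle c.1.1 ≤ angle b.1.1 → angle b.1.1 ≤ angle a.1.1 →
    DetPow.toExterior _ _ _ (mul a b c hab hbc u w)
      = DetPow.toExterior _ _ _ u * DetPow.toExterior _ _ _ w

/-- The multiplication, seen as a section `s` of `δ(L)`, is antisymmetric.  In terms of the pairing of
`L_{(y₁,y₂)}` and `L_{(y₂,y₁)} = L_{(y₁,y₂)}^*` this says, for the two transpositions which generate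
the symmetric group, that `u' · (u · w) = ⟨u, u'⟩ w` and `(u · w) · w' = ⟨w, w'⟩ u`. -/
def IsAntisymmetric (mul : GerbeMul (L G)) : Prop :=
  ∀ (a b c : Y G) (hab : proj G a = proj G b) (hbc : proj G b = proj G c)
    (u : L G ⟨(a, b), hab⟩) (w : L G ⟨(b, c), hbc⟩),
    (∀ u' : L G ⟨(b, a), hab.symm⟩,
      mul b a c hab.symm (hab.trans hbc) u' (mul a b c hab hbc u w)
        = DetPow.pairing _ _ _ _ u u' • w) ∧
    (∀ w' : L G ⟨(c, b), hbc.symm⟩,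
      mul a c b (hab.trans hbc) hbc.symm (mul a b c hab hbc u w) w'
        = DetPow.pairing _ _ _ _ w w' • u)

/-- The construction of the basic bundle gerbe works for the group `G`, whose manifold structure is
given by the embedding `j : G → 𝓘`. -/
structure HasBasicBundleGerbe {𝓘 : Type v} [NormedAddCommGroup 𝓘] [NormedSpace ℝ 𝓘]
    (j : G → 𝓘) : Prop where
  /-- `Y` is open in `U(1) × G`. -/
  isOpen_Y : IsOpenAlong (fun p : Circle × G => ((p.1 : ℂ), j p.2))
    {p | p.1 ≠ 1 ∧ (p.1 : ℂ) ∉ spectrum ℂ (op p.2)}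
  /-- The positive, null and negative parts of `Y^{[2]}` are open. -/
  isOpen_stratum : ∀ s, IsOpenAlong (embSq (embY G j)) (stratum G s)
  /-- The spaces `E` are finite-dimensional. -/
  finiteDimensional : ∀ y : FibreSq (proj G), FiniteDimensional ℂ (eigenSum y.1.1 y.1.2)
  /-- The orthogonal projection `P` onto `E` is smooth, and near every positive point it is given by
  a contour integral of the resolvent over a fixed contour. -/
  smooth_projection : ∃ P : FibreSq (proj G) → H →L[ℂ] H,
    (∀ y, IsStarProjection (P y) ∧ (P y).range = eigenSum y.1.1 y.1.2) ∧
    SmoothAlong (embSq (embY G j)) Set.univ P ∧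
    ∀ y₀ ∈ stratum G .pos, ∃ (U : Set (FibreSq (proj G))) (c : ℂ) (r : ℝ),
      IsOpenAlong (embSq (embY G j)) U ∧ y₀ ∈ U ∧ 0 < r ∧
      ∀ y ∈ U, Disjoint (Metric.sphere c r) (spectrum ℂ (op (proj G y.1.1))) ∧
        P y = (2 * Real.pi * Complex.I : ℂ)⁻¹ •
          ∮ ξ in C(c, r), resolvent (op (proj G y.1.1)) ξ
  /-- `L` is a smooth and locally trivial hermitian line bundle on `Y^{[2]}`. -/
  lineBundle : IsHermitianLineBundle (embSq (embY G j)) (L G) (herm G) (frame G j)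
  /-- Wedge product, extended by antisymmetry, makes `(L, Y)` a hermitian bundle gerbe on `G`. -/
  bundleGerbe : ∃ mul : GerbeMul (L G), IsWedgeProduct G mul ∧ IsAntisymmetric G mul ∧
    IsHermitianBundleGerbe (embY G j) j (proj G) (L G) (herm G) (frame G j) mul

end Basic

/-! ## The diagonal torus -/

/-- The diagonal torus `𝕋^n` in `U(n)`. -/
def torus (n : ℕ) : Subgroup (unitary (EuclideanSpace ℂ (Fin n) →L[ℂ] EuclideanSpace ℂ (Fin n))) where
  carrier := {g | ∃ d : Fin n → Circle, ∀ x i,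
    (g : EuclideanSpace ℂ (Fin n) →L[ℂ] EuclideanSpace ℂ (Fin n)) x i = (d i : ℂ) * x i}
  one_mem' := ⟨1, fun x i => by simp⟩
  mul_mem' := by
    rintro g h ⟨d, hd⟩ ⟨d', hd'⟩
    exact ⟨d * d', fun x i => by simp [hd, hd', mul_assoc]⟩
  inv_mem' := by
    rintro g ⟨d, hd⟩
    refine ⟨d⁻¹, fun x i => ?_⟩
    have h1 : (g : EuclideanSpace ℂ (Fin n) →L[ℂ] EuclideanSpace ℂ (Fin n))
        (((g⁻¹ : unitary _) : EuclideanSpace ℂ (Fin n) →L[ℂ] EuclideanSpace ℂ (Fin n)) x) = x := by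
      rw [← mul_apply_eq_comp, ← Submonoid.coe_mul, mul_inv_cancel]
      simp
    have h2 := hd (((g⁻¹ : unitary _) : EuclideanSpace ℂ (Fin n) →L[ℂ] _) x) i
    rw [h1] at h2
    rw [h2, ← mul_assoc, ← Circle.coe_mul]
    simp

/-! ## Schatten ideals and the groups `U_p(H)` -/

section Schatten

variable {H : Type u} [NormedAddCommGroup H] [InnerProductSpace ℂ H]

/-- The Schatten `p`-norm `(tr |A|^p)^{1/p}` (`p ≥ 1`) of an operator, in its variational form: the
supremum of `(∑ |⟨fᵢ, A eᵢ⟩|^p)^{1/p}` over all finite orthonormal systems `e`, `f` of the same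
length. -/
def schattenENorm (p : ℝ) (A : H →L[ℂ] H) : ℝ≥0∞ :=
  ⨆ (n : ℕ) (e : {e : Fin n → H // Orthonormal ℂ e}) (f : {f : Fin n → H // Orthonormal ℂ f}),
    (∑ i, ‖⟪f.1 i, A (e.1 i)⟫_ℂ‖ₑ ^ p) ^ (1 / p)

theorem le_schattenENorm (p : ℝ) (A : H →L[ℂ] H) {n : ℕ} {e f : Fin n → H}
    (he : Orthonormal ℂ e) (hf : Orthonormal ℂ f) :
    (∑ i, ‖⟪f i, A (e i)⟫_ℂ‖ₑ ^ p) ^ (1 / p) ≤ schattenENorm p A :=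
  le_iSup_of_le n (le_iSup_of_le ⟨e, he⟩ (le_iSup_of_le ⟨f, hf⟩ le_rfl))

theorem schattenENorm_le {p : ℝ} {A : H →L[ℂ] H} {C : ℝ≥0∞}
    (h : ∀ (n : ℕ) (e f : Fin n → H), Orthonormal ℂ e → Orthonormal ℂ f →
      (∑ i, ‖⟪f i, A (e i)⟫_ℂ‖ₑ ^ p) ^ (1 / p) ≤ C) : schattenENorm p A ≤ C :=
  iSup_le fun n => iSup_le fun e => iSup_le fun f => h n e.1 f.1 e.2 f.2

theorem schattenENorm_add_le {p : ℝ} (hp : 1 ≤ p) (A B : H →L[ℂ] H) :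
    schattenENorm p (A + B) ≤ schattenENorm p A + schattenENorm p B := by
  refine schattenENorm_le fun n e f he hf => ?_
  calc (∑ i, ‖⟪f i, (A + B) (e i)⟫_ℂ‖ₑ ^ p) ^ (1 / p)
      ≤ (∑ i, (‖⟪f i, A (e i)⟫_ℂ‖ₑ + ‖⟪f i, B (e i)⟫_ℂ‖ₑ) ^ p) ^ (1 / p) := by
        gcongr with i
        rw [add_apply, inner_add_right]
        exact enorm_add_le _ _
    _ ≤ _ := ENNReal.Lp_add_le _ _ _ hp
    _ ≤ _ := add_le_add (le_schattenENorm p A he hf) (le_schattenENorm p B he hf)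

theorem schattenENorm_smul_le {p : ℝ} (hp : 1 ≤ p) (c : ℂ) (A : H →L[ℂ] H) :
    schattenENorm p (c • A) ≤ ‖c‖ₑ * schattenENorm p A := by
  have hp0 : 0 < p := by linarith
  refine schattenENorm_le fun n e f he hf => ?_
  calc (∑ i, ‖⟪f i, (c • A) (e i)⟫_ℂ‖ₑ ^ p) ^ (1 / p)
      = ‖c‖ₑ * (∑ i, ‖⟪f i, A (e i)⟫_ℂ‖ₑ ^ p) ^ (1 / p) := by
        have : ∀ i, ‖⟪f i, (c • A) (e i)⟫_ℂ‖ₑ ^ p = ‖c‖ₑ ^ p * ‖⟪f i, A (e i)⟫_ℂ‖ₑ ^ p := by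
          intro i
          rw [smul_apply, inner_smul_right, enorm_mul,
            ENNReal.mul_rpow_of_nonneg _ _ hp0.le]
        simp_rw [this]
        rw [← Finset.mul_sum, ENNReal.mul_rpow_of_nonneg _ _ (by positivity), ← ENNReal.rpow_mul,
          mul_one_div_cancel hp0.ne', ENNReal.rpow_one]
    _ ≤ _ := by gcongr; exact le_schattenENorm p A he hf

theorem schattenENorm_zero {p : ℝ} (hp : 1 ≤ p) : schattenENorm p (0 : H →L[ℂ] H) = 0 := by
  have h := schattenENorm_smul_le hp 0 (0 : H →L[ℂ] H)
  simpa using h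

theorem enorm_inner_le_schattenENorm {p : ℝ} (hp : 1 ≤ p) (A : H →L[ℂ] H) {x y : H}
    (hx : ‖x‖ = 1) (hy : ‖y‖ = 1) : ‖⟪y, A x⟫_ℂ‖ₑ ≤ schattenENorm p A := by
  have hp0 : 0 < p := by linarith
  have hon : ∀ z : H, ‖z‖ = 1 → Orthonormal ℂ (fun _ : Fin 1 => z) := fun z hz =>
    ⟨fun _ => hz, fun i k hik => absurd (Subsingleton.elim i k) hik⟩
  have h := le_schattenENorm p A (hon x hx) (hon y hy)
  rwa [Fin.sum_univ_one, ← ENNReal.rpow_mul, mul_one_div_cancel hp0.ne', ENNReal.rpow_one] at h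

theorem eq_zero_of_schattenENorm_eq_zero {p : ℝ} (hp : 1 ≤ p) {A : H →L[ℂ] H}
    (h : schattenENorm p A = 0) : A = 0 := by
  ext x
  by_contra hAx
  have hAx' : A x ≠ 0 := hAx
  have hx : x ≠ 0 := fun h0 => hAx' (by rw [h0, map_zero])
  have h1 := enorm_inner_le_schattenENorm hp A (x := ((‖x‖⁻¹ : ℝ) : ℂ) • x)
    (y := ((‖A x‖⁻¹ : ℝ) : ℂ) • A x)
    (by rw [norm_smul]; simp [hx]) (by rw [norm_smul]; simp [hAx'])
  rw [h, nonpos_iff_eq_zero, enorm_eq_zero, map_smul, inner_smul_left, inner_smul_right] at h1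
  simp [hx, hAx'] at h1

variable (H) in
/-- The Schatten ideal `𝓛_p(H)`: compact operators with finite Schatten `p`-norm. -/
def schattenIdeal (p : ℝ) [hp : Fact (1 ≤ p)] : Submodule ℂ (H →L[ℂ] H) where
  carrier := {A | IsCompactOperator A ∧ schattenENorm p A < ⊤}
  zero_mem' := ⟨isCompactOperator_zero, by rw [schattenENorm_zero hp.out]; exact ENNReal.zero_lt_top⟩
  add_mem' hA hB := ⟨hA.1.add hB.1,
    (schattenENorm_add_le hp.out _ _).trans_lt (ENNReal.add_lt_top.2 ⟨hA.2, hB.2⟩)⟩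
  smul_mem' c _ hA := ⟨hA.1.smul c,
    (schattenENorm_smul_le hp.out c _).trans_lt (ENNReal.mul_lt_top enorm_lt_top hA.2)⟩

theorem mem_schattenIdeal {p : ℝ} [Fact (1 ≤ p)] {A : H →L[ℂ] H} :
    A ∈ schattenIdeal H p ↔ IsCompactOperator A ∧ schattenENorm p A < ⊤ := Iff.rfl

variable (H) in
/-- The Schatten ideal `𝓛_p(H)` as a space with the Schatten norm. -/
def SchattenClass (p : ℝ) [Fact (1 ≤ p)] : Type u := schattenIdeal H p

namespace SchattenClass

variable (p : ℝ) [hp : Fact (1 ≤ p)]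

instance : AddCommGroup (SchattenClass H p) := inferInstanceAs (AddCommGroup (schattenIdeal H p))

instance : Module ℂ (SchattenClass H p) := inferInstanceAs (Module ℂ (schattenIdeal H p))

instance : Norm (SchattenClass H p) := ⟨fun A => (schattenENorm p A.1).toReal⟩

theorem schattenENorm_ne_top {p : ℝ} [Fact (1 ≤ p)] (A : SchattenClass H p) :
    schattenENorm p A.1 ≠ ⊤ :=
  (mem_schattenIdeal.1 A.2).2.ne

theorem normedSpaceCore : NormedSpace.Core ℂ (SchattenClass H p) where
  norm_nonneg _ := ENNReal.toReal_nonneg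
  norm_smul c A := by
    change (schattenENorm p (c • A.1)).toReal = ‖c‖ * (schattenENorm p A.1).toReal
    have h1 : schattenENorm p (c • A.1) = ‖c‖ₑ * schattenENorm p A.1 := by
      refine le_antisymm (schattenENorm_smul_le hp.out c A.1) ?_
      rcases eq_or_ne c 0 with rfl | hc
      · simp
      have h := schattenENorm_smul_le hp.out c⁻¹ (c • A.1)
      rw [smul_smul, inv_mul_cancel₀ hc, one_smul, enorm_inv hc] at h
      calc ‖c‖ₑ * schattenENorm p A.1 ≤ ‖c‖ₑ * (‖c‖ₑ⁻¹ * schattenENorm p (c • A.1)) := by gcongr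
        _ = schattenENorm p (c • A.1) := by
          rw [← mul_assoc, ENNReal.mul_inv_cancel (by simpa using hc) enorm_ne_top, one_mul]
    rw [h1, ENNReal.toReal_mul, toReal_enorm]
  norm_triangle A B := by
    change (schattenENorm p (A.1 + B.1)).toReal
      ≤ (schattenENorm p A.1).toReal + (schattenENorm p B.1).toReal
    rw [← ENNReal.toReal_add A.schattenENorm_ne_top B.schattenENorm_ne_top]
    exact ENNReal.toReal_mono (ENNReal.add_ne_top.2 ⟨A.schattenENorm_ne_top, B.schattenENorm_ne_top⟩)
      (schattenENorm_add_le hp.out _ _)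
  norm_eq_zero_iff A := by
    change (schattenENorm p A.1).toReal = 0 ↔ A = 0
    constructor
    · intro h
      rw [ENNReal.toReal_eq_zero_iff] at h
      exact Subtype.ext (eq_zero_of_schattenENorm_eq_zero hp.out (h.resolve_right A.schattenENorm_ne_top))
    · rintro rfl
      change (schattenENorm p (0 : H →L[ℂ] H)).toReal = 0
      rw [schattenENorm_zero hp.out, ENNReal.toReal_zero]

instance : NormedAddCommGroup (SchattenClass H p) := NormedAddCommGroup.ofCore (normedSpaceCore p)

instance : NormedSpace ℂ (SchattenClass H p) := NormedSpace.ofCore (normedSpaceCore p)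

end SchattenClass

/-- Unitary operators preserve the Schatten norm. -/
theorem schattenENorm_unitary_le [CompleteSpace H] (p : ℝ) (A : H →L[ℂ] H)
    (g : unitary (H →L[ℂ] H)) : schattenENorm p (A * (g : H →L[ℂ] H)) ≤ schattenENorm p A := by
  refine schattenENorm_le fun n e f he hf => ?_
  have hg : Orthonormal ℂ (fun i => (g : H →L[ℂ] H) (e i)) := by
    rw [orthonormal_iff_ite] at he ⊢
    intro i k
    rw [← he i k, ← ContinuousLinearMap.adjoint_inner_right, ← ContinuousLinearMap.star_eq_adjoint,
      ← mul_apply_eq_comp, Unitary.coe_star_mul_self, one_apply_eq_self]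
  exact le_schattenENorm p A hg hf

variable (H) in
/-- `U_p(H)`: the unitary operators which differ from the identity by an element of `𝓛_p(H)`. -/
def schattenUnitary [CompleteSpace H] (p : ℝ) [hp : Fact (1 ≤ p)] :
    Subgroup (unitary (H →L[ℂ] H)) where
  carrier := {g | (g : H →L[ℂ] H) - 1 ∈ schattenIdeal H p}
  one_mem' := by
    change ((1 : unitary (H →L[ℂ] H)) : H →L[ℂ] H) - 1 ∈ schattenIdeal H p
    rw [OneMemClass.coe_one, sub_self]
    exact zero_mem _
  mul_mem' := by
    intro g h hg hh
    change ((g * h : unitary (H →L[ℂ] H)) : H →L[ℂ] H) - 1 ∈ schattenIdeal H p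
    have h1 : ((g * h : unitary (H →L[ℂ] H)) : H →L[ℂ] H) - 1
        = ((g : H →L[ℂ] H) - 1) * (h : H →L[ℂ] H) + ((h : H →L[ℂ] H) - 1) := by
      rw [Submonoid.coe_mul]; noncomm_ring
    rw [h1]
    have hg' := mem_schattenIdeal.1 hg
    exact add_mem (mem_schattenIdeal.2
      ⟨hg'.1.comp_clm (h : H →L[ℂ] H), (schattenENorm_unitary_le p _ h).trans_lt hg'.2⟩) hh
  inv_mem' := by
    intro g hg
    change ((g⁻¹ : unitary (H →L[ℂ] H)) : H →L[ℂ] H) - 1 ∈ schattenIdeal H p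
    have h0 : (g : H →L[ℂ] H) * ((g⁻¹ : unitary (H →L[ℂ] H)) : H →L[ℂ] H) = 1 := by
      rw [← Submonoid.coe_mul, mul_inv_cancel, OneMemClass.coe_one]
    have h1 : ((g⁻¹ : unitary (H →L[ℂ] H)) : H →L[ℂ] H) - 1
        = -(((g : H →L[ℂ] H) - 1) * ((g⁻¹ : unitary (H →L[ℂ] H)) : H →L[ℂ] H)) := by
      rw [sub_mul, h0, one_mul, neg_sub]
    rw [h1]
    have hg' := mem_schattenIdeal.1 hg
    exact neg_mem (mem_schattenIdeal.2
      ⟨hg'.1.comp_clm _, (schattenENorm_unitary_le p _ g⁻¹).trans_lt hg'.2⟩)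

/-- The embedding `g ↦ g - 1` of `U_p(H)` in the Banach space `𝓛_p(H)`. -/
def schattenEmb [CompleteSpace H] (p : ℝ) [Fact (1 ≤ p)] (g : schattenUnitary H p) :
    SchattenClass H p := ⟨(g.1 : H →L[ℂ] H) - 1, g.2⟩

end Schatten

end BasicGerbe

end

/-!
All the groups of the theorem consist of unitary operators `g` with `g - 1` compact, and they are
embedded in a normed space in such a way that the operator `g` depends smoothly on the point of the
ambient space (`IsCompactPerturbation`, `IsSmoothEmbedding`).  These are the only properties that
the construction needs (`hasBasicBundleGerbe`).

*The projections.*  By the Fredholm alternative the spectrum of `g` away from `1` consists of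
eigenvalues; since `g - 1` is compact and bounded below on the sum of the eigenspaces for
eigenvalues at distance at least `ε` from `1`, that sum is finite dimensional.  For `z₁ > z₂` the circle through
`z₁` and `z₂` centred at the midpoint of the arc between them meets the unit circle only in `z₁` and
`z₂`, and `1` lies outside.  The contour integral of the resolvent over it is the orthogonal
projection onto `E_{(z₁,z₂,g)}`: it is the identity on the eigenspaces by Cauchy's formula, and it
vanishes on their orthogonal complement, because `g` may be replaced there by an operator without
spectrum in the disc (`rieszIntegral_eq_starProjection`).  As `z₁` and `z₂` move without meeting
`spec g`, the sum `E` does not change, so that near a given point the circle can be kept fixed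
(`exists_contour`).  The integral is a smooth function of `g`, since it is the inversion in the
Banach algebra of continuous functions on the circle, followed by a continuous linear map
(`contDiffAt_rieszIntegral`).  Projections which are close in norm have the same rank, which makes
the type of a point locally constant, and smooth local frames of `E` are obtained by projecting a
basis of one fibre.

*The multiplication.*  Unit vectors `ω(a,b)` of the determinant lines give unitary coordinates on
all fibres of `L`.  Write `a ≽ b` if `(b, a)` is not positive; this is a total preorder on each
fibre of `Y`.  If `a ≽ b ≽ c`, then `E(a,c)` is the orthogonal sum of `E(a,b)` and `E(b,c)`, hence
`ω(a,b) ∧ ω(b,c) = k(a,b,c) ω(a,c)` with `|k(a,b,c)| = 1`.  Antisymmetry requires that the structure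
constants are inverted by transpositions of adjacent arguments, which determines an extension of
`k` to all triples (`antisymExt`).  The equation between structure constants that expresses
associativity is invariant under adjacent transpositions, so that it suffices to check it if
`a ≽ b ≽ c ≽ d`, where it is the associativity of the wedge product
(`IsSortedCocycle.antisymExt_cocycle`).

*Smoothness.*  The chosen unit vectors `ω` are not continuous, but the product `conj φ * ψ` of the
coordinates of two wedge products of smooth sections of `E` is a Gram determinant, hence smooth
(`det_gram_eq`).  The transition functions, the metric and the coefficients of the multiplication on
sorted triples are quotients of such products; the remaining cases follow by exchanging arguments,
which inverts the functions in question (`smoothNear_mulCoeff`).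
-/

noncomputable section

namespace BasicGerbe

open Filter Topology Module.End

/-! ### Contour integrals of the resolvent -/

section Contour

variable {B : Type*} [NormedRing B] [NormedAlgebra ℂ B]

/-- The contour integral `(2πi)⁻¹ ∮ (ξ - A)⁻¹ dξ` over the circle with centre `c` and radius `r`. -/
def rieszIntegral (c : ℂ) (r : ℝ) (A : B) : B :=
  (2 * Real.pi * Complex.I : ℂ)⁻¹ • ∮ ξ in C(c, r), resolvent A ξ

/-- `A ↦ (θ ↦ circleMap c r θ - A)`, with values in the Banach algebra of continuous functions on
`[0, 2π]`. -/
def circlePencil (c : ℂ) (r : ℝ) (A : B) : C(Set.Icc 0 (2 * Real.pi), B) where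
  toFun θ := algebraMap ℂ B (circleMap c r θ) - A
  continuous_toFun := by
    have : Continuous fun θ : Set.Icc 0 (2 * Real.pi) => circleMap c r θ :=
      (continuous_circleMap c r).comp continuous_subtype_val
    exact ((algebraMapCLM ℂ B).continuous.comp this).sub continuous_const

theorem contDiff_circlePencil (c : ℂ) (r : ℝ) :
    ContDiff ℂ ∞ (circlePencil c r : B → C(Set.Icc 0 (2 * Real.pi), B)) := by
  let T : B →L[ℂ] C(Set.Icc 0 (2 * Real.pi), B) := LinearMap.mkContinuous
    { toFun := fun A => ContinuousMap.const _ A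
      map_add' := fun _ _ => rfl
      map_smul' := fun _ _ => rfl } 1 (fun A => by
        rw [one_mul]
        exact (ContinuousMap.norm_le _ (norm_nonneg A)).2 fun _ => le_rfl)
  have : (circlePencil c r : B → C(Set.Icc 0 (2 * Real.pi), B))
      = fun A => circlePencil c r 0 - T A := by
    funext A
    ext θ
    change algebraMap ℂ B (circleMap c r θ) - A = (algebraMap ℂ B (circleMap c r θ) - 0) - A
    rw [sub_zero]
  rw [this]
  exact contDiff_const.sub T.contDiff

/-- Integration along the parametrized circle, as a continuous linear functional on the Banach
algebra of continuous functions on `[0, 2π]`. -/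
def circleFunctional (c : ℂ) (r : ℝ) : C(Set.Icc 0 (2 * Real.pi), B) →L[ℂ] B :=
  have h0 : (0 : ℝ) ≤ 2 * Real.pi := by positivity
  have hc : ∀ f : C(Set.Icc 0 (2 * Real.pi), B), Continuous fun θ : ℝ =>
      deriv (circleMap c r) θ • f (Set.projIcc 0 (2 * Real.pi) h0 θ) := fun f => by
    simp only [deriv_circleMap]
    have := continuous_circleMap 0 r
    have h2 := f.continuous.comp (continuous_projIcc (h := h0))
    exact (this.mul continuous_const).smul h2
  LinearMap.mkContinuous
    { toFun := fun f => ∫ θ in (0 : ℝ)..(2 * Real.pi),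
        deriv (circleMap c r) θ • f (Set.projIcc 0 (2 * Real.pi) h0 θ)
      map_add' := fun f g => by
        rw [← intervalIntegral.integral_add ((hc f).intervalIntegrable _ _)
          ((hc g).intervalIntegrable _ _)]
        simp only [ContinuousMap.add_apply, smul_add]
      map_smul' := fun a f => by
        rw [RingHom.id_apply, ← intervalIntegral.integral_smul]
        simp only [ContinuousMap.smul_apply, smul_comm a] }
    (|r| * (2 * Real.pi)) (fun f => by
      have := intervalIntegral.norm_integral_le_of_norm_le_const (a := 0) (b := 2 * Real.pi)
        (f := fun θ : ℝ => deriv (circleMap c r) θ • f (Set.projIcc 0 (2 * Real.pi) h0 θ))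
        (C := |r| * ‖f‖) (fun θ _ => by
          rw [norm_smul, deriv_circleMap, norm_mul, norm_circleMap_zero, Complex.norm_I, mul_one]
          gcongr
          exact f.norm_coe_le_norm _)
      rw [sub_zero, abs_of_nonneg h0] at this
      refine this.trans (le_of_eq (by ring)))

theorem ring_inverse_apply {B X : Type*} [NormedRing B] [TopologicalSpace X] {f : C(X, B)}
    (hf : IsUnit f) (x : X) :
    Ring.inverse f x = Ring.inverse (f x) := by
  have h1 : f x * Ring.inverse f x = 1 := by
    rw [← ContinuousMap.mul_apply, Ring.mul_inverse_cancel _ hf, ContinuousMap.one_apply]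
  have h2 : Ring.inverse f x * f x = 1 := by
    rw [← ContinuousMap.mul_apply, Ring.inverse_mul_cancel _ hf, ContinuousMap.one_apply]
  exact (Ring.inverse_unit (⟨f x, Ring.inverse f x, h1, h2⟩ : Bˣ)).symm

theorem rieszIntegral_eq {c : ℂ} {r : ℝ} {A : B} (hA : IsUnit (circlePencil c r A)) :
    rieszIntegral c r A = (2 * Real.pi * Complex.I : ℂ)⁻¹ •
      circleFunctional c r (Ring.inverse (circlePencil c r A)) := by
  rw [rieszIntegral]
  congr 1
  change _ = ∫ θ in (0 : ℝ)..(2 * Real.pi), deriv (circleMap c r) θ •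
    Ring.inverse (circlePencil c r A) (Set.projIcc 0 (2 * Real.pi) _ θ)
  rw [circleIntegral]
  refine intervalIntegral.integral_congr fun θ hθ => ?_
  rw [Set.uIcc_of_le (by positivity)] at hθ
  rw [ring_inverse_apply hA, Set.projIcc_of_mem _ hθ]
  rfl

variable [CompleteSpace B]

theorem isUnit_circlePencil_iff {c : ℂ} {r : ℝ} (hr : 0 ≤ r) (A : B) :
    IsUnit (circlePencil c r A) ↔ Disjoint (Metric.sphere c r) (spectrum ℂ A) := by
  rw [ContinuousMap.isUnit_iff_forall_isUnit, Set.disjoint_left]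
  constructor
  · intro h ξ hξ hs
    rw [← abs_of_nonneg hr, ← image_circleMap_Ioc c r] at hξ
    obtain ⟨θ, hθ, rfl⟩ := hξ
    exact hs (h ⟨θ, hθ.1.le, hθ.2⟩)
  · intro h θ
    have := h (circleMap_mem_sphere c hr θ)
    rwa [spectrum.notMem_iff] at this

theorem eventually_disjoint_sphere_spectrum {c : ℂ} {r : ℝ} (hr : 0 ≤ r) {A : B}
    (hA : Disjoint (Metric.sphere c r) (spectrum ℂ A)) :
    ∀ᶠ A' in 𝓝 A, Disjoint (Metric.sphere c r) (spectrum ℂ A') := by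
  rw [← isUnit_circlePencil_iff hr] at hA
  have := (contDiff_circlePencil c r (B := B)).continuous.continuousAt.eventually
    (Units.isOpen.mem_nhds hA)
  exact this.mono fun A' h => (isUnit_circlePencil_iff hr A').1 h

/-- The contour integral of the resolvent is inversion in the Banach algebra of continuous functions
on the contour, followed by a continuous linear map; so it depends smoothly on the operator. -/
theorem contDiffAt_rieszIntegral {c : ℂ} {r : ℝ} (hr : 0 ≤ r) {A : B}
    (hA : Disjoint (Metric.sphere c r) (spectrum ℂ A)) :
    ContDiffAt ℂ ∞ (rieszIntegral c r) A := by
  have hu := (isUnit_circlePencil_iff hr A).2 hA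
  have h1 : ContDiffAt ℂ ∞ (fun A => (2 * Real.pi * Complex.I : ℂ)⁻¹ •
      circleFunctional c r (Ring.inverse (circlePencil c r A))) A := by
    have h2 : ContDiffAt ℂ ∞ Ring.inverse (circlePencil c r A) := by
      have := contDiffAt_ringInverse (n := ∞) ℂ hu.unit
      rwa [hu.unit_spec] at this
    exact ((2 * Real.pi * Complex.I : ℂ)⁻¹ •
      circleFunctional (B := B) c r).contDiff.contDiffAt.comp A
        (h2.comp A (contDiff_circlePencil c r).contDiffAt)
  refine h1.congr_of_eventuallyEq ?_
  filter_upwards [eventually_disjoint_sphere_spectrum hr hA] with A' hA'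
  exact rieszIntegral_eq ((isUnit_circlePencil_iff hr A').2 hA')

end Contour

/-! ### Spectral subspaces of unitary operators -/

section Spectral

variable {H : Type u} [NormedAddCommGroup H] [InnerProductSpace ℂ H]

/-- The sum of the eigenspaces of `A` for the eigenvalues in a subset `S` of the unit circle. -/
def circleEigenSum (A : H →L[ℂ] H) (S : Set Circle) : Submodule ℂ H :=
  ⨆ (l : Circle) (_ : l ∈ S), eigenspace (A : H →ₗ[ℂ] H) (l : ℂ)

theorem eigenspace_le_circleEigenSum {A : H →L[ℂ] H} {S : Set Circle} {l : Circle} (hl : l ∈ S) :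
    eigenspace (A : H →ₗ[ℂ] H) (l : ℂ) ≤ circleEigenSum A S :=
  le_iSup₂_of_le l hl le_rfl

theorem circleEigenSum_induction {A : H →L[ℂ] H} {S : Set Circle} {p : H → Prop} (zero : p 0)
    (eig : ∀ l ∈ S, ∀ x, A x = (l : ℂ) • x → p x) (add : ∀ x y, p x → p y → p (x + y)) {x : H}
    (hx : x ∈ circleEigenSum A S) : p x := by
  rw [circleEigenSum, iSup_subtype'] at hx
  induction hx using Submodule.iSup_induction' with
  | mem l x hx => exact eig l.1 l.2 x (by simpa [mem_eigenspace_iff] using hx)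
  | zero => exact zero
  | add x y _ _ hx hy => exact add x y hx hy

theorem circleEigenSum_mono_of_hasEigenvalue {A : H →L[ℂ] H} {S S' : Set Circle}
    (h : ∀ l ∈ S, HasEigenvalue (A : H →ₗ[ℂ] H) (l : ℂ) → l ∈ S') :
    circleEigenSum A S ≤ circleEigenSum A S' := by
  refine iSup₂_le fun l hl => ?_
  by_cases he : HasEigenvalue (A : H →ₗ[ℂ] H) (l : ℂ)
  · exact eigenspace_le_circleEigenSum (h l hl he)
  · rw [hasEigenvalue_iff, not_not] at he
    rw [he]
    exact bot_le

theorem map_mem_circleEigenSum {A : H →L[ℂ] H} {S : Set Circle} {x : H}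
    (hx : x ∈ circleEigenSum A S) : A x ∈ circleEigenSum A S := by
  refine circleEigenSum_induction (p := fun x => A x ∈ circleEigenSum A S) (by simp)
    (fun l hl x hx => ?_) (fun x y hx hy => ?_) hx
  · rw [hx]
    exact Submodule.smul_mem _ _ (eigenspace_le_circleEigenSum hl (by
      simpa [mem_eigenspace_iff] using hx))
  · rw [map_add]
    exact add_mem hx hy

theorem circleEigenSum_eq_bot_iff {A : H →L[ℂ] H} {S : Set Circle} :
    circleEigenSum A S = ⊥ ↔ ∀ l ∈ S, ¬ HasEigenvalue (A : H →ₗ[ℂ] H) (l : ℂ) := by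
  simp only [circleEigenSum, iSup_eq_bot, hasEigenvalue_iff, not_not]

variable [CompleteSpace H]

theorem inner_map_map_of_mem_unitary {A : H →L[ℂ] H} (hA : A ∈ unitary (H →L[ℂ] H)) (x y : H) :
    ⟪A x, A y⟫_ℂ = ⟪x, y⟫_ℂ := by
  rw [← ContinuousLinearMap.adjoint_inner_right, ← ContinuousLinearMap.star_eq_adjoint,
    ← mul_apply_eq_comp, Unitary.star_mul_self_of_mem hA, one_apply_eq_self]

theorem norm_map_of_mem_unitary {A : H →L[ℂ] H} (hA : A ∈ unitary (H →L[ℂ] H)) (x : H) :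
    ‖A x‖ = ‖x‖ := by
  rw [@norm_eq_sqrt_re_inner ℂ, @norm_eq_sqrt_re_inner ℂ, inner_map_map_of_mem_unitary hA]

theorem norm_eq_one_of_eigenvector {A : H →L[ℂ] H} (hA : A ∈ unitary (H →L[ℂ] H)) {l : ℂ} {x : H}
    (hx : x ≠ 0) (h : A x = l • x) : ‖l‖ = 1 := by
  have := norm_map_of_mem_unitary hA x
  rw [h, norm_smul] at this
  exact (mul_eq_right₀ (norm_ne_zero_iff.2 hx)).1 this

theorem inner_eigenvector_map {A : H →L[ℂ] H} (hA : A ∈ unitary (H →L[ℂ] H)) {l : Circle} {x y : H}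
    (h : A x = (l : ℂ) • x) : ⟪x, A y⟫_ℂ = (l : ℂ) * ⟪x, y⟫_ℂ := by
  rw [← inner_map_map_of_mem_unitary hA x y, h, inner_smul_left, ← mul_assoc, Complex.mul_conj,
    Complex.normSq_eq_norm_sq, Circle.norm_coe]
  simp

theorem inner_eq_zero_of_eigenvectors {A : H →L[ℂ] H} (hA : A ∈ unitary (H →L[ℂ] H))
    {l m : Circle} (hlm : l ≠ m) {x y : H} (hx : A x = (l : ℂ) • x) (hy : A y = (m : ℂ) • y) :
    ⟪x, y⟫_ℂ = 0 := by
  have h := inner_eigenvector_map hA (y := y) hx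
  rw [hy, inner_smul_right] at h
  by_contra h0
  exact hlm (Circle.ext (mul_right_cancel₀ h0 h).symm)

theorem circleEigenSum_inner_eq_zero {A : H →L[ℂ] H} (hA : A ∈ unitary (H →L[ℂ] H))
    {S S' : Set Circle} (hS : Disjoint S S') {x y : H} (hx : x ∈ circleEigenSum A S)
    (hy : y ∈ circleEigenSum A S') : ⟪x, y⟫_ℂ = 0 := by
  refine circleEigenSum_induction (p := fun x => ⟪x, y⟫_ℂ = 0) (by simp) (fun l hl x hx => ?_)
    (fun x x' h h' => by rw [inner_add_left, h, h', add_zero]) hx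
  refine circleEigenSum_induction (p := fun y => ⟪x, y⟫_ℂ = 0) (by simp) (fun m hm y hy => ?_)
    (fun x x' h h' => by rw [inner_add_right, h, h', add_zero]) hy
  exact inner_eq_zero_of_eigenvectors hA (fun h => Set.disjoint_left.1 hS hl (by rwa [h])) hx hy

theorem map_mem_circleEigenSum_orthogonal {A : H →L[ℂ] H} (hA : A ∈ unitary (H →L[ℂ] H))
    {S : Set Circle} {y : H} (hy : y ∈ (circleEigenSum A S)ᗮ) : A y ∈ (circleEigenSum A S)ᗮ := by
  rw [Submodule.mem_orthogonal] at hy ⊢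
  intro x hx
  refine circleEigenSum_induction (p := fun x => ⟪x, A y⟫_ℂ = 0) (by simp) (fun l hl x hx => ?_)
    (fun x x' h h' => by rw [inner_add_left, h, h', add_zero]) hx
  rw [inner_eigenvector_map hA hx, hy x (eigenspace_le_circleEigenSum hl (by
      simpa [mem_eigenspace_iff] using hx)), mul_zero]

/-- Since the eigenspaces are orthogonal, a lower bound for `A - 1` on the eigenvectors is one on
their span. -/
theorem le_norm_sub_one_circleEigenSum {A : H →L[ℂ] H} (hA : A ∈ unitary (H →L[ℂ] H))
    {S : Set Circle} {ε : ℝ} (hε : 0 ≤ ε) (hS : ∀ l ∈ S, ε ≤ ‖(l : ℂ) - 1‖) {x : H}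
    (hx : x ∈ circleEigenSum A S) : ε * ‖x‖ ≤ ‖(A - 1) x‖ := by
  rw [circleEigenSum, iSup_subtype', Submodule.mem_iSup_iff_exists_finsupp] at hx
  obtain ⟨f, hf, rfl⟩ := hx
  have hf' : ∀ l, A (f l) = ((l : Circle) : ℂ) • f l := fun l => by
    simpa [mem_eigenspace_iff] using hf l
  have key : ∀ a : S → ℂ, ‖∑ l ∈ f.support, a l • f l‖ ^ 2
      = ∑ l ∈ f.support, (‖a l‖ * ‖f l‖) ^ 2 := by
    intro a
    rw [← @inner_self_eq_norm_sq ℂ, sum_inner, map_sum]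
    refine Finset.sum_congr rfl fun l hl => ?_
    rw [inner_sum, Finset.sum_eq_single_of_mem l hl, inner_self_eq_norm_sq, norm_smul]
    intro m _ hml
    rw [inner_smul_left, inner_smul_right, inner_eq_zero_of_eigenvectors hA
      (fun h => hml (Subtype.ext h.symm)) (hf' l) (hf' m), mul_zero, mul_zero]
  refine le_of_sq_le_sq ?_ (norm_nonneg _)
  have h1 : (f.sum fun _ xi => xi) = ∑ l ∈ f.support, (1 : S → ℂ) l • f l := by
    simp [Finsupp.sum]
  have h2 : (A - 1) (f.sum fun _ xi => xi) = ∑ l ∈ f.support, (((l : Circle) : ℂ) - 1) • f l := by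
    simp [Finsupp.sum, map_sum, hf', sub_smul]
  rw [h2, key (fun l => ((l : Circle) : ℂ) - 1), h1, mul_pow, key, Finset.mul_sum]
  refine Finset.sum_le_sum fun l _ => ?_
  rw [← mul_pow]
  simp only [Pi.one_apply, norm_one, one_mul]
  gcongr
  exact hS l l.2

/-- If `A - 1` is compact, the eigenvalues of the unitary operator `A` away from `1` have finite
total multiplicity: `A - 1` is bounded below on the sum of the eigenspaces, so that the unit ball
of that sum is compact. -/
theorem finiteDimensional_circleEigenSum {A : H →L[ℂ] H} (hA : A ∈ unitary (H →L[ℂ] H))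
    (hc : IsCompactOperator (A - 1 : H →L[ℂ] H)) {S : Set Circle} {ε : ℝ} (hε : 0 < ε)
    (hS : ∀ l ∈ S, ε ≤ ‖(l : ℂ) - 1‖) : FiniteDimensional ℂ (circleEigenSum A S) := by
  -- The closure is taken in order that `A - 1` is a closed embedding.
  set E := (circleEigenSum A S).topologicalClosure with hE
  have hE' : ∀ x ∈ E, ε * ‖x‖ ≤ ‖(A - 1) x‖ := by
    intro x hx
    have hcl : IsClosed {x : H | ε * ‖x‖ ≤ ‖(A - 1) x‖} :=
      isClosed_le (continuous_const.mul continuous_norm) (A - 1).continuous.norm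
    exact closure_minimal (fun x hx => le_norm_sub_one_circleEigenSum hA hε.le hS hx) hcl hx
  let T : E →L[ℂ] H := (A - 1).comp E.subtypeL
  have hanti : AntilipschitzWith (Real.toNNReal ε⁻¹) T := by
    refine AddMonoidHomClass.antilipschitz_of_bound T fun x => ?_
    rw [Real.coe_toNNReal _ (by positivity), inv_mul_eq_div, le_div_iff₀ hε, mul_comm]
    exact hE' x x.2
  have : CompleteSpace E := (Submodule.isClosed_topologicalClosure _).completeSpace_coe
  have hemb : IsClosedEmbedding T := hanti.isClosedEmbedding T.uniformContinuous
  have hcomp : IsCompact (Metric.closedBall (0 : E) 1) := by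
    have hTc : IsCompactOperator T := hc.comp_clm E.subtypeL
    obtain ⟨K, hK, hsub⟩ := hTc.image_closedBall_subset_compact 1
    exact (hemb.isCompact_preimage hK).of_isClosed_subset Metric.isClosed_closedBall
      (Set.image_subset_iff.1 hsub)
  have : FiniteDimensional ℂ E := FiniteDimensional.of_isCompact_closedBall ℂ one_pos hcomp
  exact Submodule.finiteDimensional_of_le (Submodule.le_topologicalClosure (circleEigenSum A S))

end Spectral

theorem angle_exp {t : ℝ} (h0 : 0 < t) (h1 : t ≤ 2 * Real.pi) : angle (Circle.exp t) = t := by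
  have h : -((Circle.exp t : Circle) : ℂ) = Complex.exp ((t - Real.pi : ℝ) * Complex.I) := by
    rw [Circle.coe_exp, Complex.ofReal_sub, sub_mul, Complex.exp_sub, Complex.exp_pi_mul_I, div_neg,
      div_one]
  rw [angle, h, Complex.arg_exp_mul_I, (toIocMod_eq_self _).2 ⟨by linarith, by linarith⟩]
  ring

section Riesz

variable {H : Type u} [NormedAddCommGroup H] [InnerProductSpace ℂ H]

theorem mem_spectrum_of_hasEigenvalue {A : H →L[ℂ] H} {l : ℂ}
    (h : HasEigenvalue (A : H →ₗ[ℂ] H) l) : l ∈ spectrum ℂ A := by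
  obtain ⟨x, hx⟩ := h.exists_hasEigenvector
  intro hu
  rw [spectrum.mem_resolventSet_iff] at hu
  refine hx.2 ?_
  have h1 : (algebraMap ℂ (H →L[ℂ] H) l - A) x = 0 := by
    have := hx.apply_eq_smul
    simp only [ContinuousLinearMap.coe_coe] at this
    simp [this, Algebra.algebraMap_eq_smul_one]
  have h2 := congrArg (fun B : H →L[ℂ] H => B x) (Ring.inverse_mul_cancel _ hu)
  simpa [h1] using h2.symm

theorem sub_resolvent_apply {A : H →L[ℂ] H} {ξ : ℂ} (hξ : ξ ∉ spectrum ℂ A) (y : H) :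
    ξ • resolvent A ξ y - A (resolvent A ξ y) = y := by
  rw [spectrum.notMem_iff] at hξ
  have h2 := congrArg (fun B : H →L[ℂ] H => B y) (Ring.mul_inverse_cancel _ hξ)
  simpa [resolvent, Algebra.algebraMap_eq_smul_one] using h2

theorem resolvent_apply_eq {A : H →L[ℂ] H} {ξ : ℂ} (hξ : ξ ∉ spectrum ℂ A) {x y : H}
    (h : ξ • x - A x = y) : resolvent A ξ y = x := by
  rw [spectrum.notMem_iff] at hξ
  have h2 := congrArg (fun B : H →L[ℂ] H => B x) (Ring.inverse_mul_cancel _ hξ)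
  rw [← h]
  simpa [resolvent, Algebra.algebraMap_eq_smul_one] using h2

variable [CompleteSpace H]

/-- The Fredholm alternative for compact perturbations of the identity. -/
theorem hasEigenvalue_of_mem_spectrum {A : H →L[ℂ] H} (hc : IsCompactOperator (A - 1 : H →L[ℂ] H))
    {l : ℂ} (hl : l ≠ 1) (h : l ∈ spectrum ℂ A) : HasEigenvalue (A : H →ₗ[ℂ] H) l := by
  rcases hc.hasEigenvalue_or_mem_resolventSet (sub_ne_zero.2 hl) with h1 | h1
  · obtain ⟨x, hx⟩ := h1.exists_hasEigenvector
    refine hasEigenvalue_of_hasEigenvector (x := x) ⟨?_, hx.2⟩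
    have := hx.apply_eq_smul
    rw [mem_eigenspace_iff]
    simpa [sub_smul] using this
  · exfalso
    refine h ?_
    rw [spectrum.mem_resolventSet_iff] at h1 ⊢
    convert h1 using 1
    rw [map_sub, map_one]
    abel

theorem continuousOn_resolvent (A : H →L[ℂ] H) {s : Set ℂ} (hs : Disjoint s (spectrum ℂ A)) :
    ContinuousOn (resolvent A) s := fun ξ hξ => by
  have h : ξ ∈ resolventSet ℂ A := by
    have := Set.disjoint_left.1 hs hξ
    rwa [spectrum, Set.notMem_compl_iff] at this
  exact (spectrum.hasDerivAt_resolvent_const_left h).continuousAt.continuousWithinAt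

theorem rieszIntegral_apply {A : H →L[ℂ] H} {c : ℂ} {r : ℝ} (hr : 0 ≤ r)
    (hs : Disjoint (Metric.sphere c r) (spectrum ℂ A)) (x : H) :
    rieszIntegral c r A x
      = (2 * Real.pi * Complex.I : ℂ)⁻¹ • ∮ ξ in C(c, r), resolvent A ξ x := by
  rw [rieszIntegral, smul_apply]
  congr 1
  have hci : CircleIntegrable (resolvent A) c r := (continuousOn_resolvent A hs).circleIntegrable hr
  exact ContinuousLinearMap.intervalIntegral_apply hci.out x

theorem rieszIntegral_apply_eigenvector {A : H →L[ℂ] H} {c : ℂ} {r : ℝ} (hr : 0 ≤ r)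
    (hs : Disjoint (Metric.sphere c r) (spectrum ℂ A)) {l : ℂ} (hl : l ∈ Metric.ball c r) {x : H}
    (hx : A x = l • x) : rieszIntegral c r A x = x := by
  rw [rieszIntegral_apply hr hs]
  have h1 : (∮ ξ in C(c, r), resolvent A ξ x) = ∮ ξ in C(c, r), (ξ - l)⁻¹ • x := by
    refine circleIntegral.integral_congr hr fun ξ hξ => ?_
    have hne : ξ - l ≠ 0 := fun h => by
      rw [sub_eq_zero] at h
      rw [← h, Metric.mem_ball] at hl
      rw [Metric.mem_sphere] at hξ
      exact hl.ne hξ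
    refine resolvent_apply_eq (Set.disjoint_left.1 hs hξ) ?_
    rw [map_smul, hx, smul_comm _ l, ← sub_smul, smul_smul, mul_inv_cancel₀ hne, one_smul]
  rw [h1, circleIntegral.integral_smul_const, circleIntegral.integral_sub_inv_of_mem_ball hl,
    smul_smul, inv_mul_cancel₀ (by simp [Real.pi_ne_zero]), one_smul]

/-- On the orthogonal complement of the eigenspaces inside the contour, the resolvent has no
singularity inside the contour.  This is seen by replacing the unitary operator by `1` on the sum
of these eigenspaces: the new operator differs from `1` by a compact operator, so that it has no
spectrum in the closed disc by the Fredholm alternative. -/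
theorem rieszIntegral_apply_orthogonal {A : H →L[ℂ] H} (hA : A ∈ unitary (H →L[ℂ] H))
    (hc : IsCompactOperator (A - 1 : H →L[ℂ] H)) {c : ℂ} {r : ℝ} (hr : 0 ≤ r)
    (hs : Disjoint (Metric.sphere c r) (spectrum ℂ A)) (h1 : (1 : ℂ) ∉ Metric.closedBall c r)
    [FiniteDimensional ℂ (circleEigenSum A {l | (l : ℂ) ∈ Metric.ball c r})] {y : H}
    (hy : y ∈ (circleEigenSum A {l | (l : ℂ) ∈ Metric.ball c r})ᗮ) :
    rieszIntegral c r A y = 0 := by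
  set F := circleEigenSum A {l | (l : ℂ) ∈ Metric.ball c r} with hF
  set Q := F.starProjection with hQ
  have hQA : ∀ x, Q (A x) = A (Q x) := by
    intro x
    have h2 : A x = A (Q x) + A (x - Q x) := by rw [← map_add]; congr 1; abel
    conv_lhs => rw [h2]
    rw [map_add, Submodule.starProjection_eq_self_iff.2
      (map_mem_circleEigenSum (F.starProjection_apply_mem x)),
      F.starProjection_apply_eq_zero_iff.2
        (map_mem_circleEigenSum_orthogonal hA (F.sub_starProjection_mem_orthogonal x)), add_zero]
  have hQQ : ∀ x, Q (Q x) = Q x := fun x =>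
    Submodule.starProjection_eq_self_iff.2 (F.starProjection_apply_mem x)
  -- `A'` is `1` on `F` and agrees with `A` on the orthogonal complement of `F`.
  set A' : H →L[ℂ] H := A * (1 - Q) + Q with hA'
  have hA'x : ∀ x, A' x = A (x - Q x) + Q x := fun x => by simp [hA']
  have hQA' : ∀ x, Q (A' x) = Q x := fun x => by
    rw [hA'x, map_add, hQA, map_sub, hQQ, sub_self, map_zero, zero_add]
  have hc' : IsCompactOperator (A' - 1 : H →L[ℂ] H) := by
    have h2 : A' - 1 = (A - 1) * (1 - Q) := by rw [hA']; noncomm_ring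
    rw [h2]
    exact hc.comp_clm (1 - Q)
  -- An eigenvector for an eigenvalue `l ≠ 1` is orthogonal to `F`, so it is an eigenvector of `A`;
  -- if `l` is in the disc, then it belongs to `F` as well.
  have hspec : Disjoint (Metric.closedBall c r) (spectrum ℂ A') := by
    rw [Set.disjoint_left]
    intro l hl hls
    have hl1 : l ≠ 1 := fun h => h1 (h ▸ hl)
    obtain ⟨x, hx⟩ := (hasEigenvalue_of_mem_spectrum hc' hl1 hls).exists_hasEigenvector
    have hx1 : A' x = l • x := hx.apply_eq_smul
    have hQx : Q x = 0 := by
      have h2 := hQA' x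
      rw [hx1, map_smul] at h2
      have h3 : (l - 1) • Q x = 0 := by rw [sub_smul, h2, one_smul, sub_self]
      exact (smul_eq_zero.1 h3).resolve_left (sub_ne_zero.2 hl1)
    have hAx : A x = l • x := by
      rw [hA'x, hQx, sub_zero, add_zero] at hx1
      exact hx1
    have hln := norm_eq_one_of_eigenvector hA hx.2 hAx
    have hev : HasEigenvalue (A : H →ₗ[ℂ] H) l :=
      hasEigenvalue_of_hasEigenvector (x := x) ⟨by rw [mem_eigenspace_iff]; exact hAx, hx.2⟩
    have hlb : l ∈ Metric.ball c r := by
      rcases (Metric.mem_closedBall.1 hl).lt_or_eq with h | h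
      · exact h
      · exact absurd (mem_spectrum_of_hasEigenvalue hev) (Set.disjoint_left.1 hs h)
    have hxF : x ∈ F := eigenspace_le_circleEigenSum
      (l := (⟨l, mem_sphere_zero_iff_norm.2 hln⟩ : Circle)) hlb
        (by rw [mem_eigenspace_iff]; exact hAx)
    exact hx.2 (by rw [← hQx, Submodule.starProjection_eq_self_iff.2 hxF])
  have hres : ∀ ξ ∈ Metric.sphere c r, resolvent A ξ y = resolvent A' ξ y := by
    intro ξ hξ
    have hξ' : ξ ∉ spectrum ℂ A' :=
      Set.disjoint_left.1 hspec (Metric.sphere_subset_closedBall hξ)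
    have hξ1 : ξ ≠ 1 := fun h => h1 (h ▸ Metric.sphere_subset_closedBall hξ)
    refine resolvent_apply_eq (Set.disjoint_left.1 hs hξ) ?_
    have h2 := sub_resolvent_apply hξ' y
    have hQw : Q (resolvent A' ξ y) = 0 := by
      have h3 := congrArg Q h2
      rw [map_sub, map_smul, hQA', F.starProjection_apply_eq_zero_iff.2 hy] at h3
      have h4 : (ξ - 1) • Q (resolvent A' ξ y) = 0 := by rw [sub_smul, one_smul, h3]
      exact (smul_eq_zero.1 h4).resolve_left (sub_ne_zero.2 hξ1)
    rwa [hA'x, hQw, sub_zero, add_zero] at h2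
  rw [rieszIntegral_apply hr hs, circleIntegral.integral_congr hr hres,
    Complex.circleIntegral_eq_zero_of_differentiable_on_off_countable hr Set.countable_empty,
    smul_zero]
  · exact fun ξ hξ => ((continuousOn_resolvent A' hspec) ξ hξ).clm_apply continuousWithinAt_const
  · intro ξ hξ
    have h : ξ ∈ resolventSet ℂ A' := by
      have := Set.disjoint_left.1 hspec (Metric.ball_subset_closedBall hξ.1)
      rwa [spectrum, Set.notMem_compl_iff] at this
    exact (spectrum.hasDerivAt_resolvent_const_left h).differentiableAt.clm_apply
      (differentiableAt_const y)

/-- The contour integral of the resolvent of a unitary operator `A`, with `A - 1` compact, is the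
orthogonal projection onto the eigenspaces inside the contour. -/
theorem rieszIntegral_eq_starProjection {A : H →L[ℂ] H} (hA : A ∈ unitary (H →L[ℂ] H))
    (hc : IsCompactOperator (A - 1 : H →L[ℂ] H)) {c : ℂ} {r : ℝ} (hr : 0 ≤ r)
    (hs : Disjoint (Metric.sphere c r) (spectrum ℂ A)) (h1 : (1 : ℂ) ∉ Metric.closedBall c r)
    [FiniteDimensional ℂ (circleEigenSum A {l | (l : ℂ) ∈ Metric.ball c r})] :
    rieszIntegral c r A
      = (circleEigenSum A {l | (l : ℂ) ∈ Metric.ball c r}).starProjection := by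
  ext x
  set F := circleEigenSum A {l | (l : ℂ) ∈ Metric.ball c r} with hF
  have h2 : x = F.starProjection x + (x - F.starProjection x) := by abel
  conv_lhs => rw [h2]
  rw [map_add, rieszIntegral_apply_orthogonal hA hc hr hs h1
    (F.sub_starProjection_mem_orthogonal x), add_zero]
  refine circleEigenSum_induction (p := fun x => rieszIntegral c r A x = x) (map_zero _)
    (fun l hl x hx => rieszIntegral_apply_eigenvector hr hs hl hx)
    (fun x y hx hy => by rw [map_add, hx, hy]) (F.starProjection_apply_mem x)

theorem finiteDimensional_circleEigenSum_ball {A : H →L[ℂ] H} (hA : A ∈ unitary (H →L[ℂ] H))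
    (hc : IsCompactOperator (A - 1 : H →L[ℂ] H)) {c : ℂ} {r : ℝ}
    (h1 : (1 : ℂ) ∉ Metric.closedBall c r) :
    FiniteDimensional ℂ (circleEigenSum A {l | (l : ℂ) ∈ Metric.ball c r}) := by
  rw [Metric.mem_closedBall, not_le, dist_comm] at h1
  refine finiteDimensional_circleEigenSum hA hc (sub_pos.2 h1) fun l hl => ?_
  have hl : dist (l : ℂ) c < r := hl
  have := dist_triangle c (l : ℂ) 1
  rw [dist_comm c (l : ℂ), dist_eq_norm (l : ℂ) 1] at this
  linarith

/-- A unitary operator `A` with `A - 1` compact has a point of the circle other than `1` in its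
resolvent set.  Otherwise all points of the circle near `-1` would be eigenvalues, although their
total multiplicity is finite. -/
theorem exists_notMem_spectrum {A : H →L[ℂ] H} (hA : A ∈ unitary (H →L[ℂ] H))
    (hc : IsCompactOperator (A - 1 : H →L[ℂ] H)) :
    ∃ z : Circle, z ≠ 1 ∧ (z : ℂ) ∉ spectrum ℂ A := by
  by_contra! hall
  have h1 : (1 : ℂ) ∉ Metric.closedBall (-1 : ℂ) 1 := by
    rw [Metric.mem_closedBall, dist_eq_norm]
    norm_num
  have hfd := finiteDimensional_circleEigenSum_ball hA hc h1
  set S : Set Circle := {l | (l : ℂ) ∈ Metric.ball (-1 : ℂ) 1}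
  have hS1 : ∀ l ∈ S, l ≠ 1 := fun l hl h =>
    h1 (Metric.ball_subset_closedBall (by simpa [S, h] using hl))
  have hev : ∀ l : S, HasEigenvalue (A : H →ₗ[ℂ] H) ((l : Circle) : ℂ) := fun l =>
    hasEigenvalue_of_mem_spectrum hc (by
      intro h; exact hS1 l l.2 (Circle.ext h)) (hall l (hS1 l l.2))
  choose x hx using fun l => (hev l).exists_hasEigenvector
  have hli : LinearIndependent ℂ x := by
    refine eigenvectors_linearIndependent' (A : H →ₗ[ℂ] H) (fun l : S => ((l : Circle) : ℂ))
      (fun l m h => Subtype.ext (Circle.ext h)) x hx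
  have hli' : LinearIndependent ℂ (fun l : S =>
      (⟨x l, eigenspace_le_circleEigenSum l.2 (hx l).1⟩ : circleEigenSum A S)) :=
    LinearIndependent.of_comp (circleEigenSum A S).subtype hli
  have hfin : Finite S := hli'.finite
  have hopen : IsOpen (Set.Ioo 0 (2 * Real.pi) ∩
      (fun t => (Circle.exp t : ℂ)) ⁻¹' Metric.ball (-1) 1) :=
    isOpen_Ioo.inter (Metric.isOpen_ball.preimage (by fun_prop))
  have hpi : Real.pi ∈ Set.Ioo 0 (2 * Real.pi) ∩
      (fun t => (Circle.exp t : ℂ)) ⁻¹' Metric.ball (-1) 1 := by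
    have := Real.pi_pos
    exact ⟨⟨this, by linarith⟩, by simp⟩
  refine (infinite_of_mem_nhds Real.pi (hopen.mem_nhds hpi)) ?_
  refine Set.Finite.of_finite_image ((Set.toFinite S).subset ?_) (f := Circle.exp) ?_
  · rintro _ ⟨t, ht, rfl⟩
    exact ht.2
  · intro t ht t' ht' h
    rw [← angle_exp ht.1.1 ht.1.2.le, ← angle_exp ht'.1.1 ht'.1.2.le, h]

end Riesz

/-! ### Germs of smooth maps on embedded submanifolds -/

section Germs

variable {X X' 𝓔 𝓔' F F' : Type*} [NormedAddCommGroup 𝓔] [NormedAddCommGroup 𝓔']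

/-- The filter of neighbourhoods of `x` for the topology that `X` inherits from the ambient
space. -/
def nhdsAlong (emb : X → 𝓔) (x : X) : Filter X := comap emb (𝓝 (emb x))

theorem self_of_nhdsAlong {emb : X → 𝓔} {x : X} {p : X → Prop}
    (h : ∀ᶠ y in nhdsAlong emb x, p y) : p x := by
  rw [nhdsAlong, eventually_comap] at h
  exact h.self_of_nhds x rfl

theorem isOpenAlong_iff {emb : X → 𝓔} {U : Set X} :
    IsOpenAlong emb U ↔ ∀ x ∈ U, ∀ᶠ y in nhdsAlong emb x, y ∈ U := by
  constructor
  · rintro ⟨W, hW, rfl⟩ x hx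
    exact preimage_mem_comap (hW.mem_nhds hx)
  · intro h
    refine ⟨interior {e | ∀ y, emb y = e → y ∈ U}, isOpen_interior, Set.ext fun x => ⟨fun hx => ?_,
      fun hx => interior_subset (s := {e | ∀ y, emb y = e → y ∈ U}) hx x rfl⟩⟩
    have := h x hx
    rw [nhdsAlong, eventually_comap] at this
    exact mem_interior_iff_mem_nhds.2 this

theorem exists_isOpenAlong {emb : X → 𝓔} {x : X} {p : X → Prop}
    (h : ∀ᶠ y in nhdsAlong emb x, p y) : ∃ U, IsOpenAlong emb U ∧ x ∈ U ∧ ∀ y ∈ U, p y := by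
  rw [nhdsAlong, eventually_comap] at h
  obtain ⟨W, hW, hWo, hxW⟩ := eventually_nhds_iff.1 h
  exact ⟨emb ⁻¹' W, ⟨W, hWo, rfl⟩, hxW, fun y hy => hW _ hy y rfl⟩

theorem tendsto_nhdsAlong {emb : X → 𝓔} {emb' : X' → 𝓔'} {τ : X → X'} {S : 𝓔 → 𝓔'} {x : X}
    (hS : ContinuousAt S (emb x)) (h : ∀ y, emb' (τ y) = S (emb y)) :
    Tendsto τ (nhdsAlong emb x) (nhdsAlong emb' (τ x)) := by
  rw [nhdsAlong, nhdsAlong, tendsto_comap_iff, h]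
  have : emb' ∘ τ = S ∘ emb := funext h
  rw [this]
  exact hS.tendsto.comp tendsto_comap

variable [NormedSpace ℝ 𝓔] [NormedSpace ℝ 𝓔'] [NormedAddCommGroup F] [NormedSpace ℝ F]
  [NormedAddCommGroup F'] [NormedSpace ℝ F']

/-- `f` is smooth near `x`: on a neighbourhood of `x` it is the restriction of a smooth map on an
open subset of the ambient space. -/
def SmoothNear (emb : X → 𝓔) (f : X → F) (x : X) : Prop :=
  ∃ f' : 𝓔 → F, (∀ᶠ z in 𝓝 (emb x), ContDiffAt ℝ ∞ f' z) ∧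
    ∀ᶠ y in nhdsAlong emb x, f y = f' (emb y)

theorem smoothAlong_of_smoothNear {emb : X → 𝓔} {U : Set X} {f : X → F}
    (h : ∀ x ∈ U, SmoothNear emb f x) : SmoothAlong emb U f := by
  intro x hx
  obtain ⟨f', hf', hf⟩ := h x hx
  rw [nhdsAlong, eventually_comap] at hf
  obtain ⟨W, hW, hWo, hxW⟩ := eventually_nhds_iff.1 (hf'.and hf)
  exact ⟨W, hWo, hxW, f', fun z hz => (hW z hz).1.contDiffWithinAt,
    fun y _ hy => (hW _ hy).2 y rfl⟩

theorem SmoothAlong.smoothNear {emb : X → 𝓔} {U : Set X} {f : X → F} (h : SmoothAlong emb U f)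
    (hU : IsOpenAlong emb U) {x : X} (hx : x ∈ U) : SmoothNear emb f x := by
  obtain ⟨W, hW, hxW, f', hf', hf⟩ := h x hx
  refine ⟨f', ?_, ?_⟩
  · filter_upwards [hW.mem_nhds hxW] with z hz
    exact hf'.contDiffAt (hW.mem_nhds hz)
  · have h1 : ∀ᶠ y in nhdsAlong emb x, emb y ∈ W := preimage_mem_comap (hW.mem_nhds hxW)
    filter_upwards [h1, isOpenAlong_iff.1 hU x hx] with y hy hyU using hf y hyU hy

theorem SmoothNear.congr {emb : X → 𝓔} {f g : X → F} {x : X} (hf : SmoothNear emb f x)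
    (h : ∀ᶠ y in nhdsAlong emb x, g y = f y) : SmoothNear emb g x := by
  obtain ⟨f', hf', hff'⟩ := hf
  exact ⟨f', hf', by filter_upwards [h, hff'] with y h1 h2 using h1.trans h2⟩

theorem smoothNear_ambient {emb : X → 𝓔} {f' : 𝓔 → F} (hf' : ContDiff ℝ ∞ f') (x : X) :
    SmoothNear emb (fun y => f' (emb y)) x :=
  ⟨f', Eventually.of_forall fun _ => hf'.contDiffAt, Eventually.of_forall fun _ => rfl⟩

theorem smoothNear_const {emb : X → 𝓔} (a : F) (x : X) : SmoothNear emb (fun _ => a) x :=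
  smoothNear_ambient (f' := fun _ => a) contDiff_const x

theorem SmoothNear.tendsto {emb : X → 𝓔} {f : X → F} {x : X} (hf : SmoothNear emb f x) :
    Tendsto f (nhdsAlong emb x) (𝓝 (f x)) := by
  obtain ⟨f', hf', hff'⟩ := hf
  rw [self_of_nhdsAlong hff']
  exact (tendsto_congr' hff').2 (hf'.self_of_nhds.continuousAt.tendsto.comp tendsto_comap)

theorem SmoothNear.comp' {emb : X → 𝓔} {f : X → F} {x : X} (hf : SmoothNear emb f x) {Φ : F → F'}
    (hΦ : ∀ᶠ z in 𝓝 (f x), ContDiffAt ℝ ∞ Φ z) : SmoothNear emb (fun y => Φ (f y)) x := by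
  obtain ⟨f', hf', hff'⟩ := hf
  rw [self_of_nhdsAlong hff'] at hΦ
  refine ⟨fun z => Φ (f' z), ?_, hff'.mono fun y hy => congrArg Φ hy⟩
  filter_upwards [hf', hf'.self_of_nhds.continuousAt.eventually hΦ] with z h1 h2
  exact h2.comp z h1

theorem SmoothNear.comp {emb : X → 𝓔} {f : X → F} {x : X} (hf : SmoothNear emb f x) {Φ : F → F'}
    (hΦ : ContDiff ℝ ∞ Φ) : SmoothNear emb (fun y => Φ (f y)) x :=
  hf.comp' (Eventually.of_forall fun _ => hΦ.contDiffAt)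

theorem SmoothNear.precomp {emb : X → 𝓔} {emb' : X' → 𝓔'} {τ : X → X'} {S : 𝓔 → 𝓔'} {x : X}
    {f : X' → F} (hf : SmoothNear emb' f (τ x)) (hS : ContDiff ℝ ∞ S)
    (h : ∀ y, emb' (τ y) = S (emb y)) : SmoothNear emb (fun y => f (τ y)) x := by
  obtain ⟨f', hf', hff'⟩ := hf
  refine ⟨fun z => f' (S z), ?_, ?_⟩
  · rw [h] at hf'
    filter_upwards [hS.continuous.continuousAt.eventually hf'] with z hz
    exact hz.comp z hS.contDiffAt
  · filter_upwards [(tendsto_nhdsAlong hS.continuous.continuousAt h).eventually hff'] with y hy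
    rw [hy, h]

theorem SmoothNear.prodMk {emb : X → 𝓔} {f : X → F} {g : X → F'} {x : X}
    (hf : SmoothNear emb f x) (hg : SmoothNear emb g x) :
    SmoothNear emb (fun y => (f y, g y)) x := by
  obtain ⟨f', hf', hff'⟩ := hf
  obtain ⟨g', hg', hgg'⟩ := hg
  refine ⟨fun z => (f' z, g' z), ?_, ?_⟩
  · filter_upwards [hf', hg'] with z h1 h2 using h1.prodMk h2
  · filter_upwards [hff', hgg'] with y h1 h2
    rw [h1, h2]

theorem smoothNear_pi {ι : Type*} [Fintype ι] {emb : X → 𝓔} {f : X → ι → F} {x : X}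
    (hf : ∀ i, SmoothNear emb (fun y => f y i) x) : SmoothNear emb f x := by
  choose f' hf' hff' using hf
  refine ⟨fun z i => f' i z, ?_, ?_⟩
  · filter_upwards [eventually_all.2 hf'] with z hz using contDiffAt_pi.2 hz
  · filter_upwards [eventually_all.2 hff'] with y hy using funext hy

theorem SmoothNear.mul {emb : X → 𝓔} {f g : X → ℂ} {x : X} (hf : SmoothNear emb f x)
    (hg : SmoothNear emb g x) : SmoothNear emb (fun y => f y * g y) x :=
  (hf.prodMk hg).comp (Φ := fun p : ℂ × ℂ => p.1 * p.2) (by fun_prop)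

theorem SmoothNear.inv {emb : X → 𝓔} {f : X → ℂ} {x : X} (hf : SmoothNear emb f x)
    (h0 : f x ≠ 0) : SmoothNear emb (fun y => (f y)⁻¹) x := by
  refine hf.comp' (Φ := fun z => z⁻¹) ?_
  filter_upwards [isOpen_ne.mem_nhds h0] with z hz
  exact (contDiffAt_inv ℂ hz).restrict_scalars ℝ

theorem SmoothNear.div {emb : X → 𝓔} {f g : X → ℂ} {x : X} (hf : SmoothNear emb f x)
    (hg : SmoothNear emb g x) (h0 : g x ≠ 0) : SmoothNear emb (fun y => f y / g y) x := by
  simpa only [div_eq_mul_inv] using hf.mul (hg.inv h0)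

theorem SmoothNear.inner {H : Type*} [NormedAddCommGroup H] [InnerProductSpace ℂ H] {emb : X → 𝓔}
    {f g : X → H} {x : X} (hf : SmoothNear emb f x) (hg : SmoothNear emb g x) :
    SmoothNear emb (fun y => ⟪f y, g y⟫_ℂ) x :=
  (hf.prodMk hg).comp (Φ := fun p : H × H => ⟪p.1, p.2⟫_ℂ) (contDiff_inner)

theorem SmoothNear.det {n : ℕ} {emb : X → 𝓔} {f : X → Fin n → Fin n → ℂ} {x : X}
    (hf : ∀ i k, SmoothNear emb (fun y => f y i k) x) :
    SmoothNear emb (fun y => Matrix.det (Matrix.of (f y))) x := by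
  refine (smoothNear_pi fun i => smoothNear_pi fun k => hf i k).comp
    (Φ := fun M : Fin n → Fin n → ℂ => Matrix.det (Matrix.of M)) ?_
  simp only [Matrix.det_apply, Matrix.of_apply, zsmul_eq_mul, Units.smul_def]
  fun_prop

end Germs

/-! ### Arcs of the unit circle -/

theorem norm_exp_sub_exp (s t : ℝ) :
    ‖(Circle.exp s : ℂ) - Circle.exp t‖ = 2 * |Real.sin ((s - t) / 2)| := by
  have h : (Circle.exp s : ℂ) - Circle.exp t
      = Circle.exp t * (Complex.exp (Complex.I * (s - t : ℝ)) - 1) := by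
    rw [Circle.coe_exp, Circle.coe_exp, mul_sub, mul_one, ← Complex.exp_add]
    push_cast
    congr 2
    ring
  rw [h, norm_mul, Circle.norm_coe, one_mul, Complex.norm_exp_I_mul_ofReal_sub_one, norm_mul,
    Real.norm_eq_abs, Real.norm_eq_abs, abs_two]

theorem angle_pos (z : Circle) : 0 < angle z := by
  have := Complex.neg_pi_lt_arg (-(z : ℂ))
  unfold angle
  linarith

theorem angle_le_two_pi (z : Circle) : angle z ≤ 2 * Real.pi := by
  have := Complex.arg_le_pi (-(z : ℂ))
  unfold angle
  linarith

theorem angle_one : angle 1 = 2 * Real.pi := by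
  simp [angle, two_mul]

theorem angle_injective : Function.Injective angle := fun z w h => by
  rw [← exp_angle z, h, exp_angle]

/-- The circle around the midpoint of an arc that passes through the ends of the arc separates the
arc from the rest of the unit circle. -/
theorem dist_arc_midpoint {s t : ℝ} (hs : 0 < s) (hst : s < t) (ht : t < 2 * Real.pi) (l : Circle) :
    (dist (l : ℂ) (Circle.exp ((t + s) / 2)) < 2 * Real.sin ((t - s) / 4) ↔
      s < angle l ∧ angle l < t) ∧
    (dist (l : ℂ) (Circle.exp ((t + s) / 2)) = 2 * Real.sin ((t - s) / 4) →
      angle l = s ∨ angle l = t) := by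
  have h0 := angle_pos l
  have h1 := angle_le_two_pi l
  have hd : dist (l : ℂ) (Circle.exp ((t + s) / 2))
      = 2 * Real.sin (|angle l - (t + s) / 2| / 2) := by
    conv_lhs => rw [← exp_angle l]
    rw [dist_eq_norm, norm_exp_sub_exp]
    congr 1
    have hx : |angle l - (t + s) / 2| < 2 * Real.pi := by
      rw [abs_lt]
      constructor <;> linarith
    rcases abs_cases (angle l - (t + s) / 2) with ⟨h, h'⟩ | ⟨h, h'⟩
    · rw [h] at hx ⊢
      exact abs_of_nonneg (Real.sin_nonneg_of_nonneg_of_le_pi (by linarith) (by linarith))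
    · rw [h] at hx ⊢
      rw [neg_div, Real.sin_neg]
      exact abs_of_nonpos (Real.sin_nonpos_of_nonpos_of_neg_pi_le (by linarith) (by linarith))
  -- Since `y + (t - s) / 4 < π`, the sines of `y` and `(t - s) / 4` compare like these numbers
  -- themselves, by the formula for the difference of two sines.
  set y := |angle l - (t + s) / 2| / 2 with hy
  have hy0 : 0 ≤ y := by positivity
  have hy1 : y < Real.pi - (t - s) / 4 := by
    rw [hy, div_lt_iff₀ two_pos, abs_lt]
    constructor <;> linarith
  have hsub := Real.sin_sub_sin y ((t - s) / 4)
  have hcos : 0 < Real.cos ((y + (t - s) / 4) / 2) :=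
    Real.cos_pos_of_mem_Ioo ⟨by linarith, by linarith⟩
  have hylt : y < (t - s) / 4 ↔ s < angle l ∧ angle l < t := by
    rw [hy, div_lt_iff₀ two_pos, abs_lt]
    constructor
    · rintro ⟨h, h'⟩
      constructor <;> linarith
    · rintro ⟨h, h'⟩
      constructor <;> linarith
  rw [hd, ← hylt]
  rcases lt_trichotomy y ((t - s) / 4) with h | h | h
  · have : Real.sin ((y - (t - s) / 4) / 2) < 0 :=
      Real.sin_neg_of_neg_of_neg_pi_lt (by linarith) (by linarith)
    have : Real.sin y - Real.sin ((t - s) / 4) < 0 := by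
      rw [hsub]; exact mul_neg_of_neg_of_pos (by linarith) hcos
    exact ⟨⟨fun _ => h, fun _ => by linarith⟩, fun h' => by linarith⟩
  · refine ⟨⟨fun h' => by rw [h] at h'; exact absurd h' (lt_irrefl _),
      fun h' => absurd h' (by rw [h]; exact lt_irrefl _)⟩, fun _ => ?_⟩
    rw [hy] at h
    rcases abs_cases (angle l - (t + s) / 2) with ⟨h2, _⟩ | ⟨h2, _⟩
    · right; linarith
    · left; linarith
  · have : 0 < Real.sin ((y - (t - s) / 4) / 2) :=
      Real.sin_pos_of_pos_of_lt_pi (by linarith) (by linarith)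
    have : 0 < Real.sin y - Real.sin ((t - s) / 4) := by
      rw [hsub]; exact mul_pos (by linarith) hcos
    exact ⟨⟨fun _ => by linarith, fun h' => absurd h' (not_lt.2 h.le)⟩, fun h' => by linarith⟩

/-! ### The bundle of eigenspaces -/

section Bundle

variable {H : Type u} [NormedAddCommGroup H] [InnerProductSpace ℂ H]

/-- Orthogonal projections at distance less than `1` are injective on each other's ranges. -/
theorem starProjection_injOn {V W : Submodule ℂ H} [V.HasOrthogonalProjection]
    [W.HasOrthogonalProjection] (h : ‖V.starProjection - W.starProjection‖ < 1) :
    Function.Injective (V.starProjection.toLinearMap ∘ₗ W.subtype) := by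
  rw [← LinearMap.ker_eq_bot, LinearMap.ker_eq_bot']
  intro x hx
  have hx' : V.starProjection (x : H) = 0 := hx
  by_contra h0
  have h1 : ‖(x : H)‖ ≤ ‖V.starProjection - W.starProjection‖ * ‖(x : H)‖ := by
    have h2 : ‖(V.starProjection - W.starProjection) (x : H)‖ = ‖(x : H)‖ := by
      rw [sub_apply, hx', Submodule.starProjection_eq_self_iff.2 x.2, zero_sub, norm_neg]
    exact h2.symm.le.trans ((V.starProjection - W.starProjection).le_opNorm _)
  have h3 : 0 < ‖(x : H)‖ := norm_pos_iff.2 (by simpa using h0)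
  nlinarith

theorem finrank_le_of_norm_lt {V W : Submodule ℂ H} [V.HasOrthogonalProjection]
    [W.HasOrthogonalProjection] [FiniteDimensional ℂ V] [FiniteDimensional ℂ W]
    (h : ‖V.starProjection - W.starProjection‖ < 1) :
    Module.finrank ℂ W ≤ Module.finrank ℂ V := by
  have h1 := starProjection_injOn h
  refine LinearMap.finrank_le_finrank_of_injective
    (f := (V.starProjection.toLinearMap ∘ₗ W.subtype).codRestrict V
      fun x => V.starProjection_apply_mem _) ?_
  intro x y hxy
  exact h1 (congrArg Subtype.val hxy)

variable [CompleteSpace H]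

/-- All elements of `G` are compact perturbations of the identity. -/
class IsCompactPerturbation (G : Subgroup (unitary (H →L[ℂ] H))) : Prop where
  isCompactOperator : ∀ g : G, IsCompactOperator (op g - 1 : H →L[ℂ] H)

/-- Along the embedding `j` of `G`, the operator `g` depends smoothly on `j g`. -/
def IsSmoothEmbedding {G : Subgroup (unitary (H →L[ℂ] H))} {𝓘 : Type v} [NormedAddCommGroup 𝓘]
    [NormedSpace ℝ 𝓘] (j : G → 𝓘) : Prop :=
  ∃ T : 𝓘 → H →L[ℂ] H, ContDiff ℝ ∞ T ∧ ∀ g, T (j g) = op g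

variable {G : Subgroup (unitary (H →L[ℂ] H))}

theorem op_mem_unitary (g : G) : (op g : H →L[ℂ] H) ∈ unitary (H →L[ℂ] H) := g.1.2

theorem op_eq_of_proj_eq {a b : Y G} (h : proj G a = proj G b) :
    (op a.1.2 : H →L[ℂ] H) = op b.1.2 :=
  congrArg op h

theorem eigenSum_eq_circleEigenSum (a b : Y G) : eigenSum a b
    = circleEigenSum (op a.1.2) {l | angle b.1.1 < angle l ∧ angle l < angle a.1.1} := rfl

theorem isPositive_iff (a b : Y G) : IsPositive a b ↔ eigenSum a b ≠ ⊥ := by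
  rw [eigenSum_eq_circleEigenSum, Ne, circleEigenSum_eq_bot_iff]
  simp only [IsPositive, not_forall, not_not, exists_prop]
  rfl

theorem angle_lt_of_isPositive {a b : Y G} (h : IsPositive a b) : angle b.1.1 < angle a.1.1 := by
  obtain ⟨l, hl, -⟩ := h
  exact hl.1.trans hl.2

theorem eigenSum_eq_bot_of_angle_le {a b : Y G} (h : angle a.1.1 ≤ angle b.1.1) :
    eigenSum a b = ⊥ := by
  by_contra h'
  exact absurd (angle_lt_of_isPositive ((isPositive_iff a b).2 h')) (not_lt.2 h)

theorem angle_ne_of_hasEigenvalue {a : Y G} {l : Circle}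
    (hl : HasEigenvalue ((op a.1.2 : H →L[ℂ] H) : H →ₗ[ℂ] H) (l : ℂ)) : angle l ≠ angle a.1.1 :=
  fun h => a.2.2 (angle_injective h ▸ mem_spectrum_of_hasEigenvalue hl)

/-- The circle through `exp (i s)` and `exp (i t)` with centre `exp (i (s + t) / 2)` cuts the
arc between them out of the unit circle. -/
theorem setOf_mem_ball_eq {s t : ℝ} (hs : 0 < s) (hst : s < t) (ht : t < 2 * Real.pi) :
    {l : Circle | (l : ℂ) ∈ Metric.ball (Circle.exp ((t + s) / 2) : ℂ) (2 * Real.sin ((t - s) / 4))}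
      = {l | s < angle l ∧ angle l < t} :=
  Set.ext fun l => (dist_arc_midpoint hs hst ht l).1

theorem one_notMem_closedBall {s t : ℝ} (hs : 0 < s) (hst : s < t) (ht : t < 2 * Real.pi) :
    (1 : ℂ) ∉ Metric.closedBall (Circle.exp ((t + s) / 2) : ℂ) (2 * Real.sin ((t - s) / 4)) := by
  intro h
  have h1 := dist_arc_midpoint hs hst ht 1
  rw [angle_one, Circle.coe_one] at h1
  rcases (Metric.mem_closedBall.1 h).lt_or_eq with h2 | h2
  · linarith [(h1.1.1 h2).2]
  · rcases h1.2 h2 with h3 | h3 <;> linarith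

theorem radius_pos {s t : ℝ} (hs : 0 < s) (hst : s < t) (ht : t < 2 * Real.pi) :
    0 < 2 * Real.sin ((t - s) / 4) := by
  have := Real.sin_pos_of_pos_of_lt_pi (x := (t - s) / 4) (by linarith) (by linarith)
  linarith

/-- The exchange of the two factors of `Y^{[2]}`. -/
def swapSq (y : FibreSq (proj G)) : FibreSq (proj G) := ⟨(y.1.2, y.1.1), y.2.symm⟩

variable {𝓘 : Type v} [NormedAddCommGroup 𝓘] {j : G → 𝓘}

theorem tendsto_angle (a₀ : Y G) :
    Tendsto (fun a : Y G => angle a.1.1) (nhdsAlong (embY G j) a₀) (𝓝 (angle a₀.1.1)) := by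
  have h1 : ContinuousAt (fun ζ : ℂ × 𝓘 => Complex.arg (-ζ.1) + Real.pi) (embY G j a₀) := by
    have h2 : -(embY G j a₀).1 ∈ Complex.slitPlane := by
      rw [Complex.mem_slitPlane_iff_arg]
      refine ⟨fun h => ?_, by simp [embY]⟩
      have := (angle_mem_Ioo a₀.1.1 a₀.2.1).2
      have h3 : angle a₀.1.1 = Real.pi + Real.pi := congrArg (· + Real.pi) h
      linarith
    exact ((Complex.continuousAt_arg h2).comp (f := fun ζ : ℂ × 𝓘 => -ζ.1)
      continuous_fst.neg.continuousAt).add continuousAt_const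
  exact h1.tendsto.comp tendsto_comap

theorem tendsto_fst_nhdsAlong (y₀ : FibreSq (proj G)) :
    Tendsto (fun y : FibreSq (proj G) => y.1.1) (nhdsAlong (embSq (embY G j)) y₀)
      (nhdsAlong (embY G j) y₀.1.1) :=
  tendsto_nhdsAlong (S := Prod.fst) continuous_fst.continuousAt fun _ => rfl

theorem tendsto_snd_nhdsAlong (y₀ : FibreSq (proj G)) :
    Tendsto (fun y : FibreSq (proj G) => y.1.2) (nhdsAlong (embSq (embY G j)) y₀)
      (nhdsAlong (embY G j) y₀.1.2) :=
  tendsto_nhdsAlong (S := Prod.snd) continuous_snd.continuousAt fun _ => rfl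

theorem tendsto_swapSq (y₀ : FibreSq (proj G)) :
    Tendsto swapSq (nhdsAlong (embSq (embY G j)) y₀) (nhdsAlong (embSq (embY G j)) (swapSq y₀)) :=
  tendsto_nhdsAlong (S := Prod.swap) continuous_swap.continuousAt fun _ => rfl

variable [NormedSpace ℝ 𝓘]

theorem smoothNear_swapSq {F : Type*} [NormedAddCommGroup F] [NormedSpace ℝ F]
    {f : FibreSq (proj G) → F} {y₀ : FibreSq (proj G)}
    (hf : SmoothNear (embSq (embY G j)) f (swapSq y₀)) :
    SmoothNear (embSq (embY G j)) (fun y => f (swapSq y)) y₀ :=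
  hf.precomp (S := Prod.swap) (contDiff_snd.prodMk contDiff_fst) fun _ => rfl

/-- The point `z` of `(z, g)` does not cross the spectrum of `g` under small perturbations. -/
theorem eventually_angle_lt_iff (hj : IsSmoothEmbedding j) (a₀ : Y G) :
    ∀ᶠ a in nhdsAlong (embY G j) a₀, ∀ l : Circle,
      HasEigenvalue ((op a.1.2 : H →L[ℂ] H) : H →ₗ[ℂ] H) (l : ℂ) →
      (angle l < angle a.1.1 ↔ angle l < angle a₀.1.1) ∧
      (angle a.1.1 < angle l ↔ angle a₀.1.1 < angle l) := by
  obtain ⟨T, hT, hTj⟩ := hj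
  have hcont : Continuous fun p : ℝ × 𝓘 =>
      algebraMap ℂ (H →L[ℂ] H) (Circle.exp p.1) - T p.2 := by
    have h1 : Continuous fun p : ℝ × 𝓘 => ((Circle.exp p.1 : Circle) : ℂ) := by fun_prop
    exact ((algebraMapCLM ℂ (H →L[ℂ] H)).continuous.comp h1).sub
      (hT.continuous.comp continuous_snd)
  have h0 : IsUnit (algebraMap ℂ (H →L[ℂ] H) (Circle.exp (angle a₀.1.1)) - T (j a₀.1.2)) := by
    rw [exp_angle, hTj]
    exact spectrum.notMem_iff.1 a₀.2.2
  have h1 : ∀ᶠ p in 𝓝 (angle a₀.1.1, j a₀.1.2),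
      IsUnit (algebraMap ℂ (H →L[ℂ] H) (Circle.exp (p : ℝ × 𝓘).1) - T p.2) :=
    hcont.continuousAt.eventually (Units.isOpen.mem_nhds h0)
  rw [nhds_prod_eq, eventually_prod_iff] at h1
  obtain ⟨p, hp, q, hq, hpq⟩ := h1
  obtain ⟨δ, hδ, hδp⟩ := Metric.eventually_nhds_iff.1 hp
  have h2 : Tendsto (fun a : Y G => j a.1.2) (nhdsAlong (embY G j) a₀) (𝓝 (j a₀.1.2)) :=
    (continuous_snd.tendsto (embY G j a₀)).comp tendsto_comap
  filter_upwards [h2.eventually hq, (tendsto_angle a₀).eventually (Metric.ball_mem_nhds _ hδ)]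
    with a ha hda l hl
  rw [Real.dist_eq, abs_lt] at hda
  have hl' : ¬ |angle l - angle a₀.1.1| < δ := by
    intro hlt
    have h3 := hpq (hδp hlt) ha
    dsimp only at h3
    rw [exp_angle, hTj] at h3
    exact spectrum.notMem_iff.2 h3 (mem_spectrum_of_hasEigenvalue hl)
  rw [not_lt, le_abs] at hl'
  rcases hl' with h3 | h3
  · exact ⟨⟨fun _ => by linarith, fun _ => by linarith⟩,
      ⟨fun _ => by linarith, fun _ => by linarith⟩⟩
  · exact ⟨⟨fun _ => by linarith, fun _ => by linarith⟩,
      ⟨fun _ => by linarith, fun _ => by linarith⟩⟩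

/-- Near `y₀`, the endpoints of the arc may be kept fixed in the definition of `E`. -/
theorem eventually_eigenSum_eq (hj : IsSmoothEmbedding j) (y₀ : FibreSq (proj G)) :
    ∀ᶠ y in nhdsAlong (embSq (embY G j)) y₀, eigenSum y.1.1 y.1.2
      = circleEigenSum (op y.1.1.1.2)
        {l | angle y₀.1.2.1.1 < angle l ∧ angle l < angle y₀.1.1.1.1} := by
  filter_upwards [(tendsto_fst_nhdsAlong y₀).eventually (eventually_angle_lt_iff hj y₀.1.1),
    (tendsto_snd_nhdsAlong y₀).eventually (eventually_angle_lt_iff hj y₀.1.2)] with y h1 h2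
  rw [← op_eq_of_proj_eq y.2] at h2
  rw [eigenSum_eq_circleEigenSum]
  apply le_antisymm
  · exact circleEigenSum_mono_of_hasEigenvalue fun l hl hev =>
      ⟨(h2 l hev).2.1 hl.1, (h1 l hev).1.1 hl.2⟩
  · exact circleEigenSum_mono_of_hasEigenvalue fun l hl hev =>
      ⟨(h2 l hev).2.2 hl.1, (h1 l hev).1.2 hl.2⟩

variable [hG : IsCompactPerturbation G]

instance finiteDimensional_eigenSum (a b : Y G) : FiniteDimensional ℂ (eigenSum a b) := by
  rcases lt_or_ge (angle b.1.1) (angle a.1.1) with h | h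
  · have ha := (angle_mem_Ioo a.1.1 a.2.1).2
    have hb := (angle_mem_Ioo b.1.1 b.2.1).1
    rw [eigenSum_eq_circleEigenSum, ← setOf_mem_ball_eq hb h ha]
    exact finiteDimensional_circleEigenSum_ball (op_mem_unitary _) (hG.isCompactOperator _)
      (one_notMem_closedBall hb h ha)
  · rw [eigenSum_eq_bot_of_angle_le h]
    infer_instance

/-- The orthogonal projection onto `E_{(z₁,z₂,g)}`. -/
def eigenProj (y : FibreSq (proj G)) : H →L[ℂ] H := (eigenSum y.1.1 y.1.2).starProjection

/-- Near a point with `z₁ > z₂`, the projection onto `E` is a contour integral over a fixed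
circle. -/
theorem exists_contour (hj : IsSmoothEmbedding j) {y₀ : FibreSq (proj G)}
    (h : angle y₀.1.2.1.1 < angle y₀.1.1.1.1) : ∃ (c : ℂ) (r : ℝ), 0 < r ∧
      ∀ᶠ y in nhdsAlong (embSq (embY G j)) y₀,
        Disjoint (Metric.sphere c r) (spectrum ℂ (op (proj G y.1.1))) ∧
        eigenProj y = rieszIntegral c r (op (proj G y.1.1)) := by
  have ht := (angle_mem_Ioo y₀.1.1.1.1 y₀.1.1.2.1).2
  have hs := (angle_mem_Ioo y₀.1.2.1.1 y₀.1.2.2.1).1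
  set t := angle y₀.1.1.1.1 with ht_def
  set s := angle y₀.1.2.1.1 with hs_def
  have hr := radius_pos hs h ht
  have h1 := one_notMem_closedBall hs h ht
  refine ⟨(Circle.exp ((t + s) / 2) : ℂ), 2 * Real.sin ((t - s) / 4), hr, ?_⟩
  have hd : Disjoint (Metric.sphere (Circle.exp ((t + s) / 2) : ℂ) (2 * Real.sin ((t - s) / 4)))
      (spectrum ℂ (op (proj G y₀.1.1))) := by
    rw [Set.disjoint_left]
    intro l hl hls
    have hl1 : l ≠ 1 := fun h => h1 (h ▸ Metric.sphere_subset_closedBall hl)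
    obtain ⟨x, hx⟩ := (hasEigenvalue_of_mem_spectrum (hG.isCompactOperator _) hl1
      hls).exists_hasEigenvector
    have hln := norm_eq_one_of_eigenvector (op_mem_unitary _) hx.2 hx.apply_eq_smul
    rcases (dist_arc_midpoint hs h ht ⟨l, mem_sphere_zero_iff_norm.2 hln⟩).2 hl with h2 | h2
    · rw [hs_def] at h2
      have h3 := congrArg (fun z : Circle => (z : ℂ)) (angle_injective h2)
      exact y₀.1.2.2.2 (by rw [← h3, ← op_eq_of_proj_eq y₀.2]; exact hls)
    · rw [ht_def] at h2
      have h3 := congrArg (fun z : Circle => (z : ℂ)) (angle_injective h2)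
      exact y₀.1.1.2.2 (by rw [← h3]; exact hls)
  obtain ⟨T, hT, hTj⟩ := id hj
  have hnear : ∀ᶠ y in nhdsAlong (embSq (embY G j)) y₀,
      Disjoint (Metric.sphere (Circle.exp ((t + s) / 2) : ℂ) (2 * Real.sin ((t - s) / 4)))
        (spectrum ℂ (op (proj G y.1.1))) := by
    have h2 : Tendsto (fun y : FibreSq (proj G) => (op (proj G y.1.1) : H →L[ℂ] H))
        (nhdsAlong (embSq (embY G j)) y₀) (𝓝 (op (proj G y₀.1.1))) := by
      have h3 : Continuous fun e : (ℂ × 𝓘) × (ℂ × 𝓘) => T e.1.2 :=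
        hT.continuous.comp (continuous_snd.comp continuous_fst)
      have h4 : Tendsto (fun y : FibreSq (proj G) => T (j y.1.1.1.2))
          (nhdsAlong (embSq (embY G j)) y₀) (𝓝 (T (j y₀.1.1.1.2))) :=
        (h3.tendsto (embSq (embY G j) y₀)).comp tendsto_comap
      simp only [hTj] at h4
      exact h4
    exact h2.eventually (eventually_disjoint_sphere_spectrum hr.le hd)
  filter_upwards [hnear, eventually_eigenSum_eq hj y₀] with y hy hE
  refine ⟨hy, ?_⟩
  rw [← setOf_mem_ball_eq hs h ht] at hE
  have := finiteDimensional_circleEigenSum_ball (op_mem_unitary y.1.1.1.2)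
    (hG.isCompactOperator _) h1
  have h5 := rieszIntegral_eq_starProjection (op_mem_unitary y.1.1.1.2)
    (hG.isCompactOperator _) hr.le hy h1
  simp only [eigenProj, hE]
  exact h5.symm

/-- The projection is a contour integral where `z₁ > z₂`; near the other points it vanishes. -/
theorem smoothNear_eigenProj (hj : IsSmoothEmbedding j) (y₀ : FibreSq (proj G)) :
    SmoothNear (embSq (embY G j)) eigenProj y₀ := by
  rcases lt_or_ge (angle y₀.1.2.1.1) (angle y₀.1.1.1.1) with h | h
  · obtain ⟨c, r, hr, hev⟩ := exists_contour hj h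
    obtain ⟨T, hT, hTj⟩ := hj
    have h1 : SmoothNear (embSq (embY G j)) (fun y => T (embSq (embY G j) y).1.2) y₀ :=
      smoothNear_ambient (f' := fun e : (ℂ × 𝓘) × (ℂ × 𝓘) => T e.1.2)
        (hT.comp (contDiff_snd.comp contDiff_fst)) y₀
    have hd := (self_of_nhdsAlong hev).1
    refine (h1.comp' (Φ := rieszIntegral c r) ?_).congr ?_
    · have h2 : T (embSq (embY G j) y₀).1.2 = op (proj G y₀.1.1) := hTj _
      rw [h2]
      filter_upwards [eventually_disjoint_sphere_spectrum hr.le hd] with A hA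
      exact (contDiffAt_rieszIntegral hr.le hA).restrict_scalars ℝ
    · filter_upwards [hev] with y hy
      have h2 : T (embSq (embY G j) y).1.2 = op (proj G y.1.1) := hTj _
      rw [h2, hy.2]
  · refine (smoothNear_const 0 y₀).congr ?_
    filter_upwards [eventually_eigenSum_eq hj y₀] with y hy
    have h1 : {l : Circle | angle y₀.1.2.1.1 < angle l ∧ angle l < angle y₀.1.1.1.1} = ∅ := by
      ext l
      simp only [Set.mem_ofPred_eq, Set.mem_empty_iff_false, iff_false, not_and]
      intro h2 h3
      linarith
    have h2 : eigenSum y.1.1 y.1.2 = ⊥ := by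
      rw [hy, h1]
      simp [circleEigenSum]
    simp only [eigenProj, h2, Submodule.starProjection_bot]

theorem eventually_norm_eigenProj_sub_lt (hj : IsSmoothEmbedding j) (y₀ : FibreSq (proj G)) :
    ∀ᶠ y in nhdsAlong (embSq (embY G j)) y₀, ‖eigenProj y - eigenProj y₀‖ < 1 := by
  have := (smoothNear_eigenProj hj y₀).tendsto.eventually (Metric.ball_mem_nhds _ one_pos)
  simpa only [Metric.mem_ball, dist_eq_norm] using this

theorem eventually_finrank_eq (hj : IsSmoothEmbedding j) (y₀ : FibreSq (proj G)) :
    ∀ᶠ y in nhdsAlong (embSq (embY G j)) y₀, Module.finrank ℂ (eigenSum y.1.1 y.1.2)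
      = Module.finrank ℂ (eigenSum y₀.1.1 y₀.1.2) := by
  filter_upwards [eventually_norm_eigenProj_sub_lt hj y₀] with y hy
  refine le_antisymm (finrank_le_of_norm_lt ?_) (finrank_le_of_norm_lt hy)
  rw [← norm_neg, neg_sub]
  exact hy

theorem eventually_isPositive_iff (hj : IsSmoothEmbedding j) (y₀ : FibreSq (proj G)) :
    ∀ᶠ y in nhdsAlong (embSq (embY G j)) y₀,
      (IsPositive y.1.1 y.1.2 ↔ IsPositive y₀.1.1 y₀.1.2) := by
  filter_upwards [eventually_finrank_eq hj y₀] with y hy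
  rw [isPositive_iff, isPositive_iff, Ne, Ne, ← Submodule.finrank_eq_zero,
    ← Submodule.finrank_eq_zero (S := eigenSum y₀.1.1 y₀.1.2), hy]

theorem eventually_sgn_eq (hj : IsSmoothEmbedding j) (y₀ : FibreSq (proj G)) :
    ∀ᶠ y in nhdsAlong (embSq (embY G j)) y₀, sgn y.1.1 y.1.2 = sgn y₀.1.1 y₀.1.2 := by
  filter_upwards [eventually_isPositive_iff hj y₀,
    (tendsto_swapSq y₀).eventually (eventually_isPositive_iff hj (swapSq y₀))] with y h1 h2
  have h3 : IsPositive y.1.2 y.1.1 ↔ IsPositive y₀.1.2 y₀.1.1 := h2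
  unfold sgn
  split_ifs <;> first | rfl | (exfalso; tauto)

theorem isOpenAlong_stratum (hj : IsSmoothEmbedding j) (s : SignType) :
    IsOpenAlong (embSq (embY G j)) (stratum G s) := by
  rw [isOpenAlong_iff]
  intro y₀ hy₀
  filter_upwards [eventually_sgn_eq hj y₀] with y hy
  exact hy.trans hy₀

end Bundle

/-! ### Determinant lines in the exterior algebra -/

section Exterior

variable {H : Type u} [NormedAddCommGroup H] [InnerProductSpace ℂ H]

/-- The linear form on the exterior algebra that sends `y₁ ∧ ⋯ ∧ yₙ` to `det ⟨xᵢ, yₖ⟩` and vanishes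
in degrees other than `n`. -/
def gramForm {n : ℕ} (x : Fin n → H) : ExteriorAlgebra ℂ H →ₗ[ℂ] ℂ :=
  ExteriorAlgebra.liftAlternating (Pi.single n (Matrix.detRowAlternating.compLinearMap
    (LinearMap.pi fun i => (innerSL ℂ (x i) : H →ₗ[ℂ] ℂ))))

theorem gramForm_ιMulti {n : ℕ} (x y : Fin n → H) :
    gramForm x (ExteriorAlgebra.ιMulti ℂ n y) = Matrix.det (Matrix.of fun i k => ⟪x i, y k⟫_ℂ) := by
  rw [gramForm, ExteriorAlgebra.liftAlternating_apply_ιMulti, Pi.single_eq_same,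
    AlternatingMap.compLinearMap_apply, ← Matrix.det_transpose]
  rfl

theorem ιMulti_eq_one_of_eq_bot {V : Submodule ℂ H} (h : V = ⊥)
    (x : Fin (Module.finrank ℂ V) → H) :
    ExteriorAlgebra.ιMulti ℂ (Module.finrank ℂ V) x = 1 := by
  subst h
  have : ∀ (n : ℕ) (_ : n = 0) (x : Fin n → H), ExteriorAlgebra.ιMulti ℂ n x = 1 := by
    rintro n rfl x
    simp [ExteriorAlgebra.ιMulti_apply]
  exact this _ (finrank_bot ℂ H) _

/-- The wedge product of the standard orthonormal basis of `V`, in the exterior algebra of `H`. -/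
def unitWedge (V : Submodule ℂ H) : ExteriorAlgebra ℂ H :=
  ExteriorAlgebra.map V.subtype (detUnit V).1

variable {V : Submodule ℂ H} [FiniteDimensional ℂ V]

theorem unitWedge_eq : unitWedge V = ExteriorAlgebra.ιMulti ℂ (Module.finrank ℂ V)
    (fun i => (stdOrthonormalBasis ℂ V i : H)) := by
  rw [unitWedge, detUnit, dif_pos ‹FiniteDimensional ℂ V›, exteriorPower.ιMulti_apply_coe,
    ExteriorAlgebra.map_apply_ιMulti]
  rfl

theorem unitWedge_ne_zero : unitWedge V ≠ 0 := by
  intro h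
  have h1 := gramForm_ιMulti (fun i => (stdOrthonormalBasis ℂ V i : H))
    (fun i => (stdOrthonormalBasis ℂ V i : H))
  rw [← unitWedge_eq, h, map_zero] at h1
  have h2 : (Matrix.of fun i k => ⟪(stdOrthonormalBasis ℂ V i : H),
      (stdOrthonormalBasis ℂ V k : H)⟫_ℂ) = 1 := by
    ext i k
    rw [Matrix.of_apply, ← Submodule.coe_inner,
      orthonormal_iff_ite.1 (stdOrthonormalBasis ℂ V).orthonormal, Matrix.one_apply]
  rw [h2, Matrix.det_one] at h1
  exact zero_ne_one h1

theorem unitWedge_eq_one (h : V = ⊥) : unitWedge V = 1 := by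
  rw [unitWedge_eq, ιMulti_eq_one_of_eq_bot h]

theorem detCoord_detUnit : detCoord V (detUnit V) = 1 := by
  rw [detCoord, detUnit, dif_pos ‹FiniteDimensional ℂ V›, dif_pos ‹FiniteDimensional ℂ V›,
    exteriorPower.alternatingMapLinearEquiv_apply_ιMulti]
  exact (stdOrthonormalBasis ℂ V).toBasis.det_self ▸ by simp

theorem eq_detCoord_smul (a : Det V) : a = detCoord V a • detUnit V := by
  have h1 : Module.finrank ℂ (Det V) = 1 := by
    rw [exteriorPower.finrank_eq, Nat.choose_self]
  have h0 : detUnit V ≠ 0 := fun h => by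
    have := detCoord_detUnit (V := V)
    rw [h, map_zero] at this
    exact zero_ne_one this
  obtain ⟨c, rfl⟩ := exists_smul_eq_of_finrank_eq_one h1 h0 a
  rw [map_smul, detCoord_detUnit, smul_eq_mul, mul_one]

theorem map_subtype_det (a : Det V) :
    ExteriorAlgebra.map V.subtype a.1 = detCoord V a • unitWedge V := by
  conv_lhs => rw [eq_detCoord_smul a]
  rw [Submodule.coe_smul, map_smul, unitWedge]

theorem ιMulti_eq_detCoord_smul (x : Fin (Module.finrank ℂ V) → V) :
    ExteriorAlgebra.ιMulti ℂ _ (fun i => (x i : H))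
      = detCoord V (exteriorPower.ιMulti ℂ _ x) • unitWedge V := by
  rw [← map_subtype_det, exteriorPower.ιMulti_apply_coe, ExteriorAlgebra.map_apply_ιMulti]
  rfl

theorem detCoord_ιMulti_ne_zero {x : Fin (Module.finrank ℂ V) → V} (hx : LinearIndependent ℂ x) :
    detCoord V (exteriorPower.ιMulti ℂ _ x) ≠ 0 := by
  rw [detCoord, dif_pos ‹FiniteDimensional ℂ V›,
    exteriorPower.alternatingMapLinearEquiv_apply_ιMulti]
  exact ((Module.Basis.is_basis_iff_det _).1
    ⟨hx, hx.span_eq_top_of_card_eq_finrank' (by simp)⟩).ne_zero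

theorem exists_ιMulti_eq_smul {k : ℕ} (hk : Module.finrank ℂ V = k) {x : Fin k → H}
    (hx : ∀ i, x i ∈ V) : ∃ a : ℂ, ExteriorAlgebra.ιMulti ℂ k x = a • unitWedge V := by
  subst hk
  exact ⟨_, ιMulti_eq_detCoord_smul fun i => ⟨x i, hx i⟩⟩

/-- The Gram determinant of two families in `V` in terms of their coordinates in `det V`. -/
theorem det_gram_eq {k : ℕ} (hk : Module.finrank ℂ V = k) {x y : Fin k → H}
    (hx : ∀ i, x i ∈ V) (hy : ∀ i, y i ∈ V) {a b : ℂ}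
    (ha : ExteriorAlgebra.ιMulti ℂ k x = a • unitWedge V)
    (hb : ExteriorAlgebra.ιMulti ℂ k y = b • unitWedge V) :
    Matrix.det (Matrix.of fun i k => ⟪x i, y k⟫_ℂ) = (starRingEnd ℂ) a * b := by
  subst hk
  have hxa := ιMulti_eq_detCoord_smul fun i => (⟨x i, hx i⟩ : V)
  have hyb := ιMulti_eq_detCoord_smul fun i => (⟨y i, hy i⟩ : V)
  rw [ha] at hxa
  rw [hb] at hyb
  rw [smul_left_injective ℂ unitWedge_ne_zero hxa, smul_left_injective ℂ unitWedge_ne_zero hyb,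
    conj_detCoord_mul_detCoord]
  rfl

/-- For orthogonal subspaces the product of unit vectors of the determinant lines is a unit
vector. -/
theorem exists_unitWedge_mul {V₁ V₂ : Submodule ℂ H} [FiniteDimensional ℂ V₁]
    [FiniteDimensional ℂ V₂] (hV : V = V₁ ⊔ V₂) (h : ∀ x ∈ V₁, ∀ y ∈ V₂, ⟪x, y⟫_ℂ = 0) :
    Module.finrank ℂ V = Module.finrank ℂ V₁ + Module.finrank ℂ V₂ ∧
    ∃ c : ℂ, ‖c‖ = 1 ∧ unitWedge V₁ * unitWedge V₂ = c • unitWedge V := by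
  have hrank : Module.finrank ℂ V = Module.finrank ℂ V₁ + Module.finrank ℂ V₂ := by
    have h1 := Submodule.finrank_sup_add_finrank_inf_eq V₁ V₂
    have h2 : V₁ ⊓ V₂ = ⊥ := by
      rw [eq_bot_iff]
      rintro x ⟨hx1, hx2⟩
      exact inner_self_eq_zero.1 (h x hx1 x hx2)
    rw [h2, finrank_bot, add_zero, ← hV] at h1
    exact h1
  refine ⟨hrank, ?_⟩
  set x : Fin (Module.finrank ℂ V₁ + Module.finrank ℂ V₂) → H := Fin.append
    (fun i => (stdOrthonormalBasis ℂ V₁ i : H)) (fun i => (stdOrthonormalBasis ℂ V₂ i : H)) with hx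
  have hxV : ∀ i, x i ∈ V := by
    intro i
    rw [hV]
    refine Fin.addCases (fun i => ?_) (fun i => ?_) i
    · rw [hx, Fin.append_left]
      exact Submodule.mem_sup_left (stdOrthonormalBasis ℂ V₁ i).2
    · rw [hx, Fin.append_right]
      exact Submodule.mem_sup_right (stdOrthonormalBasis ℂ V₂ i).2
  have hmul : unitWedge V₁ * unitWedge V₂ = ExteriorAlgebra.ιMulti ℂ _ x := by
    rw [unitWedge_eq, unitWedge_eq, ExteriorAlgebra.ιMulti_mul_ιMulti]
  obtain ⟨c, hc⟩ := exists_ιMulti_eq_smul hrank hxV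
  refine ⟨c, ?_, hmul.trans hc⟩
  have h3 := det_gram_eq hrank hxV hxV hc hc
  have h4 : (Matrix.of fun i k => ⟪x i, x k⟫_ℂ) = 1 := by
    have e1 := orthonormal_iff_ite.1 (stdOrthonormalBasis ℂ V₁).orthonormal
    have e2 := orthonormal_iff_ite.1 (stdOrthonormalBasis ℂ V₂).orthonormal
    ext i k
    rw [Matrix.of_apply]
    refine Fin.addCases (fun i => ?_) (fun i => ?_) i <;>
      refine Fin.addCases (fun k => ?_) (fun k => ?_) k <;>
      simp only [hx, Fin.append_left, Fin.append_right]
    · rw [← Submodule.coe_inner, e1]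
      simp [Matrix.one_apply]
    · rw [h _ (stdOrthonormalBasis ℂ V₁ i).2 _ (stdOrthonormalBasis ℂ V₂ k).2, Matrix.one_apply_ne]
      exact Fin.ne_of_lt (Fin.lt_def.2 (by simp; omega))
    · rw [inner_eq_zero_symm.1
          (h _ (stdOrthonormalBasis ℂ V₁ k).2 _ (stdOrthonormalBasis ℂ V₂ i).2),
        Matrix.one_apply_ne]
      exact Fin.ne_of_gt (Fin.lt_def.2 (by simp; omega))
    · rw [← Submodule.coe_inner, e2]
      simp [Matrix.one_apply]
  rw [h4, Matrix.det_one, Complex.conj_mul', ← Complex.ofReal_pow] at h3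
  have h5 : ‖c‖ ^ 2 = 1 := by exact_mod_cast h3.symm
  exact (pow_eq_one_iff_of_nonneg (norm_nonneg c) two_ne_zero).1 h5

end Exterior

/-! ### Coordinates on the powers of determinant lines -/

section Coordinates

variable {H : Type u} [NormedAddCommGroup H] [InnerProductSpace ℂ H]

theorem DetPow.coord_add (s : SignType) (V W : Submodule ℂ H) (a b : DetPow s V W) :
    coord s V W (a + b) = coord s V W a + coord s V W b := by
  cases s
  · rfl
  · rfl
  · exact map_add (detCoord V) a b

theorem DetPow.coord_smul (s : SignType) (V W : Submodule ℂ H) (r : ℂ) (a : DetPow s V W) :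
    coord s V W (r • a) = r * coord s V W a := by
  cases s
  · rfl
  · rfl
  · exact map_smul (detCoord V) r a

variable (V W : Submodule ℂ H)

theorem DetPow.coord_bijective [FiniteDimensional ℂ V] [FiniteDimensional ℂ W]
    (s : SignType) : Function.Bijective (coord s V W) := by
  cases s
  · exact ⟨fun a b h => ULift.ext _ _ h, fun c => ⟨ULift.up c, rfl⟩⟩
  · constructor
    · intro φ ψ h
      refine LinearMap.ext fun x => ?_
      have hx := eq_detCoord_smul x
      rw [hx]
      exact (LinearMap.map_smul (φ : Module.Dual ℂ (Det W)) _ _).trans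
        ((congrArg _ h).trans (LinearMap.map_smul (ψ : Module.Dual ℂ (Det W)) _ _).symm)
    · intro c
      refine ⟨(c • detCoord W : Module.Dual ℂ (Det W)), ?_⟩
      change (c • detCoord W) (detUnit W) = c
      rw [LinearMap.smul_apply, detCoord_detUnit, smul_eq_mul, mul_one]
  · constructor
    · intro a b h
      exact (eq_detCoord_smul (V := V) a).trans
        ((congrArg (· • detUnit V) h).trans (eq_detCoord_smul (V := V) b).symm)
    · intro c
      refine ⟨(c • detUnit V : Det V), ?_⟩
      change detCoord V (c • detUnit V) = c
      rw [map_smul, detCoord_detUnit, smul_eq_mul, mul_one]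

/-- The unitary coordinate on `DetPow s V W`, as a linear isomorphism. -/
def DetPow.coordEquiv [FiniteDimensional ℂ V] [FiniteDimensional ℂ W] (s : SignType) :
    DetPow s V W ≃ₗ[ℂ] ℂ :=
  LinearEquiv.ofBijective
    { toFun := coord s V W
      map_add' := coord_add s V W
      map_smul' := coord_smul s V W } (coord_bijective V W s)

variable {V W}

theorem DetPow.toExterior_eq [FiniteDimensional ℂ V]
    {s : SignType} (hs : s ≠ .neg) (h0 : s = .zero → V = ⊥)
    (a : DetPow s V W) : toExterior s V W a = coord s V W a • unitWedge V := by
  cases s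
  · rw [unitWedge_eq_one (h0 rfl), ← Algebra.algebraMap_eq_smul_one]
    rfl
  · exact absurd rfl hs
  · exact map_subtype_det (V := V) a

theorem DetPow.pairing_eq [FiniteDimensional ℂ V] [FiniteDimensional ℂ W]
    {s t : SignType} (h : t = -s) (a : DetPow s V W) (b : DetPow t W V) :
    pairing s t V W a b = coord s V W a * coord t W V b := by
  subst h
  cases s
  · rfl
  · have hb := eq_detCoord_smul (V := W) b
    change (DFunLike.coe (F := Module.Dual ℂ (Det W)) a) b
      = DFunLike.coe (F := Module.Dual ℂ (Det W)) a (detUnit W) * detCoord W b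
    conv_lhs => rw [hb]
    rw [mul_comm]
    exact LinearMap.map_smul (a : Module.Dual ℂ (Det W)) _ _
  · have ha := eq_detCoord_smul (V := V) a
    change (DFunLike.coe (F := Module.Dual ℂ (Det V)) b) a
      = detCoord V a * DFunLike.coe (F := Module.Dual ℂ (Det V)) b (detUnit V)
    conv_lhs => rw [ha]
    exact LinearMap.map_smul (b : Module.Dual ℂ (Det V)) _ _

theorem DetPow.IsWedge.coord_ne_zero [FiniteDimensional ℂ V] [FiniteDimensional ℂ W]
    {s : SignType} {e : ℕ → V} {e' : ℕ → W} {a : DetPow s V W}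
    (h : IsWedge s V W e e' a) : coord s V W a ≠ 0 := by
  cases s
  · have h' : coord .zero V W a = 1 := h
    rw [h']
    exact one_ne_zero
  · intro h0
    have h1 := h.2
    have h2 : a = 0 := (coord_bijective V W .neg).1 (h0.trans rfl)
    rw [h2] at h1
    exact zero_ne_one h1
  · have h1 : a = _ := h.2
    rw [h1]
    exact detCoord_ιMulti_ne_zero h.1

theorem DetPow.IsWedge.ιMulti_left [FiniteDimensional ℂ V]
    {s : SignType} {e : ℕ → V} {e' : ℕ → W} {a : DetPow s V W}
    (h : IsWedge s V W e e' a) (hs : s ≠ .neg) (h0 : s = .zero → V = ⊥) :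
    ExteriorAlgebra.ιMulti ℂ (Module.finrank ℂ V) (fun i => (e i : H))
      = coord s V W a • unitWedge V := by
  cases s
  · have h' : coord .zero V W a = 1 := h
    rw [h', one_smul, unitWedge_eq_one (h0 rfl), ιMulti_eq_one_of_eq_bot (h0 rfl)]
  · exact absurd rfl hs
  · rw [ιMulti_eq_detCoord_smul]
    have h1 : a = _ := h.2
    rw [h1]
    rfl

theorem DetPow.IsWedge.ιMulti_right [FiniteDimensional ℂ W]
    {s : SignType} {e : ℕ → V} {e' : ℕ → W} {a : DetPow s V W}
    (h : IsWedge s V W e e' a) (hs : s ≠ .pos) (h0 : s = .zero → W = ⊥) :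
    ExteriorAlgebra.ιMulti ℂ (Module.finrank ℂ W) (fun i => (e' i : H))
      = (coord s V W a)⁻¹ • unitWedge W := by
  cases s
  · have h' : coord .zero V W a = 1 := h
    rw [h', inv_one, one_smul, unitWedge_eq_one (h0 rfl), ιMulti_eq_one_of_eq_bot (h0 rfl)]
  · rw [ιMulti_eq_detCoord_smul]
    congr 1
    have h1 := h.2
    rw [eq_detCoord_smul (V := W) (exteriorPower.ιMulti ℂ _ _)] at h1
    have h2 := (LinearMap.map_smul (a : Module.Dual ℂ (Det W)) _ _).symm.trans h1
    exact eq_inv_of_mul_eq_one_left h2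
  · exact absurd rfl hs

theorem DetPow.exists_isWedge [FiniteDimensional ℂ W]
    (s : SignType) {e : ℕ → V} {e' : ℕ → W}
    (he : LinearIndependent ℂ (fun i : Fin (Module.finrank ℂ V) => e i))
    (he' : LinearIndependent ℂ (fun i : Fin (Module.finrank ℂ W) => e' i)) :
    ∃ a, IsWedge s V W e e' a := by
  cases s
  · exact ⟨ULift.up 1, rfl⟩
  · refine ⟨((detCoord W (exteriorPower.ιMulti ℂ _ fun i => e' i))⁻¹ • detCoord W :
      Module.Dual ℂ (Det W)), he', ?_⟩
    exact inv_mul_cancel₀ (detCoord_ιMulti_ne_zero he')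
  · exact ⟨exteriorPower.ιMulti ℂ _ fun i => e i, he, rfl⟩

end Coordinates

/-! ### Antisymmetric extension of cochains on a preordered set -/

section Antisymmetric

variable {T : Type*} (r : T → T → Prop) (k : T → T → T → ℂ)

open Classical in
/-- The antisymmetric (multiplicative) extension to all triples of a function `k` defined on the
triples which are sorted with respect to a total preorder `r`: the
value at a triple is that of `k` at a sorted rearrangement, or its inverse if the rearrangement is
odd. -/
def antisymExt (a b c : T) : ℂ :=
  if r a b then if r b c then k a b c else if r a c then (k a c b)⁻¹ else k c a b
  else if r a c then (k b a c)⁻¹ else if r b c then k b c a else (k c b a)⁻¹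

variable {r k}

theorem antisymExt_of_sorted {a b c : T} (hab : r a b) (hbc : r b c) :
    antisymExt r k a b c = k a b c := by
  rw [antisymExt, if_pos hab, if_pos hbc]

theorem norm_antisymExt (hk : ∀ a b c, ‖k a b c‖ = 1) (a b c : T) :
    ‖antisymExt r k a b c‖ = 1 := by
  unfold antisymExt
  split_ifs <;> simp [hk]

/-- The hypotheses on a cochain `k` under which its antisymmetric extension is a cocycle. -/
structure IsSortedCocycle (r : T → T → Prop) (k : T → T → T → ℂ) : Prop where
  total : ∀ a b, r a b ∨ r b a
  trans : ∀ a b c, r a b → r b c → r a c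
  ne_zero : ∀ a b c, k a b c ≠ 0
  eq_one_left : ∀ a b c, r a b → r b a → r b c → k a b c = 1
  eq_one_right : ∀ a b c, r a b → r b c → r c b → k a b c = 1
  cocycle : ∀ a b c d, r a b → r b c → r c d → k a b c * k a c d = k b c d * k a b d

namespace IsSortedCocycle

theorem antisymExt_swap_left (h : IsSortedCocycle r k) (a b c : T) :
    antisymExt r k b a c * antisymExt r k a b c = 1 := by
  have := h.total; have := h.trans; have := h.ne_zero
  have := h.eq_one_left; have := h.eq_one_right
  unfold antisymExt
  split_ifs <;> grind

theorem antisymExt_swap_right (h : IsSortedCocycle r k) (a b c : T) :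
    antisymExt r k a c b * antisymExt r k a b c = 1 := by
  have := h.total; have := h.trans; have := h.ne_zero
  have := h.eq_one_left; have := h.eq_one_right
  unfold antisymExt
  split_ifs <;> grind

end IsSortedCocycle

/-- A property of triples in a totally preordered set which is invariant under the adjacent
transpositions holds for all triples if it holds for the sorted ones. -/
theorem forall_of_sorted₃ {p : T → T → T → Prop} (total : ∀ a b, r a b ∨ r b a)
    (h12 : ∀ a b c, p a b c → p b a c) (h23 : ∀ a b c, p a b c → p a c b)
    (hs : ∀ a b c, r a b → r b c → p a b c) (a b c : T) : p a b c := by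
  have key : ∀ a b c, r a b → p a b c := fun a b c hab => by
    rcases total b c with hbc | hcb
    · exact hs a b c hab hbc
    rcases total a c with hac | hca
    · exact h23 _ _ _ (hs a c b hac hcb)
    · exact h23 _ _ _ (h12 _ _ _ (hs c a b hca hab))
  rcases total a b with hab | hba
  · exact key a b c hab
  · exact h12 _ _ _ (key b a c hba)

/-- A property of quadruples in a totally preordered set which is invariant under the adjacent
transpositions holds for all quadruples if it holds for the sorted ones. -/
theorem forall_of_sorted₄ {p : T → T → T → T → Prop} (total : ∀ a b, r a b ∨ r b a)
    (h12 : ∀ a b c d, p a b c d → p b a c d) (h23 : ∀ a b c d, p a b c d → p a c b d)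
    (h34 : ∀ a b c d, p a b c d → p a b d c)
    (hs : ∀ a b c d, r a b → r b c → r c d → p a b c d) (a b c d : T) : p a b c d := by
  refine forall_of_sorted₃ (p := fun a b c => ∀ d, p a b c d) total
    (fun a b c h d => h12 _ _ _ _ (h d)) (fun a b c h d => h23 _ _ _ _ (h d)) ?_ a b c d
  intro a b c hab hbc d
  rcases total c d with hcd | hdc
  · exact hs a b c d hab hbc hcd
  rcases total b d with hbd | hdb
  · exact h34 _ _ _ _ (hs a b d c hab hbd hdc)
  rcases total a d with had | hda
  · exact h34 _ _ _ _ (h23 _ _ _ _ (hs a d b c had hdb hbc))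
  · exact h34 _ _ _ _ (h23 _ _ _ _ (h12 _ _ _ _ (hs d a b c hda hab hbc)))

/-- The cocycle identity is invariant under adjacent transpositions of `a`, `b`, `c`, `d`. -/
theorem IsSortedCocycle.antisymExt_cocycle (h : IsSortedCocycle r k) (a b c d : T) :
    antisymExt r k a b c * antisymExt r k a c d = antisymExt r k b c d * antisymExt r k a b d := by
  refine forall_of_sorted₄ (r := r) (p := fun a b c d =>
    antisymExt r k a b c * antisymExt r k a c d = antisymExt r k b c d * antisymExt r k a b d)
    h.total ?_ ?_ ?_ ?_ a b c d
  · intro a b c d e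
    have e1 := h.antisymExt_swap_left a b c
    have e2 := h.antisymExt_swap_left a b d
    grind
  · intro a b c d e
    have e1 := h.antisymExt_swap_right a b c
    have e2 := h.antisymExt_swap_left b c d
    grind
  · intro a b c d e
    have e1 := h.antisymExt_swap_right b c d
    have e2 := h.antisymExt_swap_right a c d
    grind
  · intro a b c d hab hbc hcd
    rw [antisymExt_of_sorted hab hbc, antisymExt_of_sorted (h.trans _ _ _ hab hbc) hcd,
      antisymExt_of_sorted hbc hcd, antisymExt_of_sorted hab (h.trans _ _ _ hbc hcd)]
    exact h.cocycle a b c d hab hbc hcd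

end Antisymmetric

/-! ### The multiplication -/

/-- The bilinear map on one-dimensional spaces which is `k` times the multiplication of `ℂ` in given
coordinates. -/
def coordMul {M N P : Type*} [AddCommGroup M] [Module ℂ M] [AddCommGroup N] [Module ℂ N]
    [AddCommGroup P] [Module ℂ P] (k : ℂ) (e₁ : M ≃ₗ[ℂ] ℂ) (e₂ : N ≃ₗ[ℂ] ℂ) (e₃ : P ≃ₗ[ℂ] ℂ) :
    M →ₗ[ℂ] N →ₗ[ℂ] P :=
  LinearMap.mk₂ ℂ (fun u w => e₃.symm (k * e₁ u * e₂ w))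
    (fun u u' w => by rw [← map_add, map_add]; congr 1; ring)
    (fun r u w => by rw [← map_smul, map_smul]; congr 1; simp only [smul_eq_mul]; ring)
    (fun u w w' => by rw [← map_add, map_add]; congr 1; ring)
    (fun r u w => by rw [← map_smul, map_smul]; congr 1; simp only [smul_eq_mul]; ring)

theorem apply_coordMul {M N P : Type*} [AddCommGroup M] [Module ℂ M] [AddCommGroup N] [Module ℂ N]
    [AddCommGroup P] [Module ℂ P] (k : ℂ) (e₁ : M ≃ₗ[ℂ] ℂ) (e₂ : N ≃ₗ[ℂ] ℂ) (e₃ : P ≃ₗ[ℂ] ℂ)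
    (u : M) (w : N) : e₃ (coordMul k e₁ e₂ e₃ u w) = k * e₁ u * e₂ w :=
  e₃.apply_symm_apply _

section Multiplication

variable {H : Type u} [NormedAddCommGroup H] [InnerProductSpace ℂ H] [CompleteSpace H]
  {G : Subgroup (unitary (H →L[ℂ] H))}

/-- `a ≽ b` for `a = (z₁, g)` and `b = (z₂, g)`: no eigenvalue `λ` of `g` satisfies `z₂ > λ > z₁`.
This is a total preorder on each fibre of `Y`, coarser than the order of the arguments. -/
def Dominates (a b : Y G) : Prop := ¬ IsPositive b a

theorem dominates_of_angle_le {a b : Y G} (h : angle b.1.1 ≤ angle a.1.1) : Dominates a b :=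
  fun h' => absurd (angle_lt_of_isPositive h') (not_lt.2 h)

theorem dominates_total (a b : Y G) : Dominates a b ∨ Dominates b a := by
  rcases le_total (angle a.1.1) (angle b.1.1) with h | h
  · exact Or.inr (dominates_of_angle_le h)
  · exact Or.inl (dominates_of_angle_le h)

theorem Dominates.not_hasEigenvalue {a b : Y G} (h : Dominates a b) (hab : proj G a = proj G b)
    {l : Circle} (h1 : angle a.1.1 < angle l) (h2 : angle l < angle b.1.1) :
    ¬ HasEigenvalue ((op a.1.2 : H →L[ℂ] H) : H →ₗ[ℂ] H) (l : ℂ) := fun hl =>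
  h ⟨l, ⟨h1, h2⟩, by rwa [← op_eq_of_proj_eq hab]⟩

theorem Dominates.trans {a b c : Y G} (hab : proj G a = proj G b) (hbc : proj G b = proj G c)
    (h1 : Dominates a b) (h2 : Dominates b c) : Dominates a c := by
  rintro ⟨l, ⟨hl1, hl2⟩, hl⟩
  rw [← op_eq_of_proj_eq hbc] at hl
  rcases lt_or_gt_of_ne (angle_ne_of_hasEigenvalue hl) with h | h
  · rw [← op_eq_of_proj_eq hab] at hl
    exact h1.not_hasEigenvalue hab hl1 h hl
  · exact h2.not_hasEigenvalue hbc h hl2 hl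

theorem eigenSum_eq_bot_of_dominates {a b : Y G} (h : Dominates b a) : eigenSum a b = ⊥ := by
  by_contra h'
  exact h ((isPositive_iff a b).2 h')

theorem Dominates.eigenSum_eq_sup {a b c : Y G} (hab : proj G a = proj G b)
    (hbc : proj G b = proj G c) (h1 : Dominates a b) (h2 : Dominates b c) :
    eigenSum a c = eigenSum a b ⊔ eigenSum b c := by
  simp only [eigenSum_eq_circleEigenSum]
  rw [← op_eq_of_proj_eq hab]
  apply le_antisymm
  · refine iSup₂_le fun l hl => ?_
    by_cases hev : HasEigenvalue ((op a.1.2 : H →L[ℂ] H) : H →ₗ[ℂ] H) (l : ℂ)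
    · have hne := angle_ne_of_hasEigenvalue (a := b) (l := l)
        (by rwa [← op_eq_of_proj_eq hab])
      rcases lt_or_gt_of_ne hne with h | h
      · exact le_sup_of_le_right (eigenspace_le_circleEigenSum ⟨hl.1, h⟩)
      · exact le_sup_of_le_left (eigenspace_le_circleEigenSum ⟨h, hl.2⟩)
    · rw [hasEigenvalue_iff, not_not] at hev
      rw [hev]
      exact bot_le
  · refine sup_le (circleEigenSum_mono_of_hasEigenvalue fun l hl hev => ⟨?_, hl.2⟩)
      (circleEigenSum_mono_of_hasEigenvalue fun l hl hev => ⟨hl.1, ?_⟩)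
    · by_contra hlc
      have hev' : HasEigenvalue ((op b.1.2 : H →L[ℂ] H) : H →ₗ[ℂ] H) (l : ℂ) := by
        rwa [← op_eq_of_proj_eq hab]
      have hne := angle_ne_of_hasEigenvalue (a := c) (l := l) (by rwa [← op_eq_of_proj_eq hbc])
      exact h2.not_hasEigenvalue hbc hl.1 (lt_of_le_of_ne (not_lt.1 hlc) hne) hev'
    · by_contra hla
      have hne := angle_ne_of_hasEigenvalue hev
      exact h1.not_hasEigenvalue hab (lt_of_le_of_ne (not_lt.1 hla) hne.symm) hl.2 hev

theorem inner_eigenSum_eq_zero {a b c : Y G} (hab : proj G a = proj G b) {x y : H}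
    (hx : x ∈ eigenSum a b) (hy : y ∈ eigenSum b c) : ⟪x, y⟫_ℂ = 0 := by
  rw [eigenSum_eq_circleEigenSum] at hx hy
  rw [← op_eq_of_proj_eq hab] at hy
  refine circleEigenSum_inner_eq_zero (op_mem_unitary a.1.2) ?_ hx hy
  rw [Set.disjoint_left]
  intro l hl hl'
  exact absurd hl.1 (not_lt.2 hl'.2.le)

theorem sgn_eq_pos_iff {a b : Y G} : sgn a b = .pos ↔ IsPositive a b := by
  unfold sgn
  split_ifs <;> simp [*]

theorem sgn_swap (a b : Y G) : sgn b a = -sgn a b := by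
  unfold sgn
  by_cases h1 : IsPositive a b
  · have h2 : ¬ IsPositive b a :=
      fun h => lt_asymm (angle_lt_of_isPositive h1) (angle_lt_of_isPositive h)
    rw [if_neg h2, if_pos h1, if_pos h1]
    rfl
  · by_cases h2 : IsPositive b a
    · rw [if_pos h2, if_neg h1, if_pos h2]
      rfl
    · rw [if_neg h2, if_neg h1, if_neg h1, if_neg h2]
      rfl

theorem sgn_ne_neg_iff {a b : Y G} : sgn a b ≠ .neg ↔ Dominates a b := by
  rw [Dominates, ← sgn_eq_pos_iff, sgn_swap a b]
  cases sgn a b <;> decide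

theorem eigenSum_eq_bot_of_sgn {a b : Y G} (h : sgn a b ≠ .pos) : eigenSum a b = ⊥ := by
  rw [Ne, sgn_eq_pos_iff] at h
  exact eigenSum_eq_bot_of_dominates h

open Classical in
/-- The complex number `k` of modulus one with `ω(a,b) ∧ ω(b,c) = k ω(a,c)` for the chosen unit
vectors `ω` of the determinant lines, if `a ≽ b ≽ c`.  If there is no such number, the value is
`1`. -/
def wedgeConst (a b c : Y G) : ℂ :=
  if h : ∃ k : ℂ, ‖k‖ = 1 ∧
    unitWedge (eigenSum a b) * unitWedge (eigenSum b c) = k • unitWedge (eigenSum a c)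
  then h.choose else 1

theorem norm_wedgeConst (a b c : Y G) : ‖wedgeConst a b c‖ = 1 := by
  unfold wedgeConst
  split_ifs with h
  · exact h.choose_spec.1
  · exact norm_one

/-- The structure constants of the multiplication in the unitary coordinates of `L`: those of the
wedge product, extended antisymmetrically. -/
def mulConst (a b c : Y G) : ℂ := antisymExt Dominates wedgeConst a b c

theorem norm_mulConst (a b c : Y G) : ‖mulConst a b c‖ = 1 := norm_antisymExt norm_wedgeConst a b c

theorem mulConst_of_dominates {a b c : Y G} (hab : Dominates a b) (hbc : Dominates b c) :
    mulConst a b c = wedgeConst a b c := antisymExt_of_sorted hab hbc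

variable [hG : IsCompactPerturbation G]

theorem finrank_eigenSum_add {a b c : Y G} (hab : proj G a = proj G b)
    (hbc : proj G b = proj G c) (h1 : Dominates a b) (h2 : Dominates b c) :
    Module.finrank ℂ (eigenSum a c)
      = Module.finrank ℂ (eigenSum a b) + Module.finrank ℂ (eigenSum b c) :=
  (exists_unitWedge_mul (h1.eigenSum_eq_sup hab hbc h2)
    fun _ hx _ hy => inner_eigenSum_eq_zero hab hx hy).1

theorem unitWedge_mul_unitWedge {a b c : Y G} (hab : proj G a = proj G b)
    (hbc : proj G b = proj G c) (h1 : Dominates a b) (h2 : Dominates b c) :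
    unitWedge (eigenSum a b) * unitWedge (eigenSum b c)
      = wedgeConst a b c • unitWedge (eigenSum a c) := by
  have h := (exists_unitWedge_mul (h1.eigenSum_eq_sup hab hbc h2)
    fun _ hx _ hy => inner_eigenSum_eq_zero hab hx hy).2
  rw [wedgeConst, dif_pos h]
  exact h.choose_spec.2

/-- On sorted quadruples the cocycle identity is the associativity of the wedge product. -/
theorem isSortedCocycle_wedgeConst (g : G) :
    IsSortedCocycle (fun a b : {a : Y G // proj G a = g} => Dominates a.1 b.1)
      (fun a b c => wedgeConst a.1 b.1 c.1) where
  total a b := dominates_total _ _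
  trans a b c := Dominates.trans (a.2.trans b.2.symm) (b.2.trans c.2.symm)
  ne_zero a b c h := by
    have := norm_wedgeConst a.1 b.1 c.1
    rw [h, norm_zero] at this
    exact zero_ne_one this
  eq_one_left a b c h1 h2 h3 := by
    have h := unitWedge_mul_unitWedge (a.2.trans b.2.symm) (b.2.trans c.2.symm) h1 h3
    have hs := h1.eigenSum_eq_sup (a.2.trans b.2.symm) (b.2.trans c.2.symm) h3
    rw [eigenSum_eq_bot_of_dominates h2, bot_sup_eq] at hs
    rw [eigenSum_eq_bot_of_dominates h2, unitWedge_eq_one rfl, one_mul, hs] at h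
    exact smul_left_injective ℂ unitWedge_ne_zero (h.symm.trans (one_smul ℂ _).symm)
  eq_one_right a b c h1 h2 h3 := by
    have h := unitWedge_mul_unitWedge (a.2.trans b.2.symm) (b.2.trans c.2.symm) h1 h2
    have hs := h1.eigenSum_eq_sup (a.2.trans b.2.symm) (b.2.trans c.2.symm) h2
    rw [eigenSum_eq_bot_of_dominates h3, sup_bot_eq] at hs
    rw [eigenSum_eq_bot_of_dominates h3, unitWedge_eq_one rfl, mul_one, hs] at h
    exact smul_left_injective ℂ unitWedge_ne_zero (h.symm.trans (one_smul ℂ _).symm)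
  cocycle a b c d h1 h2 h3 := by
    have hab := a.2.trans b.2.symm
    have hbc := b.2.trans c.2.symm
    have hcd := c.2.trans d.2.symm
    have e1 := unitWedge_mul_unitWedge hab hbc h1 h2
    have e2 := unitWedge_mul_unitWedge (hab.trans hbc) hcd (h1.trans hab hbc h2) h3
    have e3 := unitWedge_mul_unitWedge hbc hcd h2 h3
    have e4 := unitWedge_mul_unitWedge hab (hbc.trans hcd) h1 (h2.trans hbc hcd h3)
    have e5 := mul_assoc (unitWedge (eigenSum a.1 b.1)) (unitWedge (eigenSum b.1 c.1))
      (unitWedge (eigenSum c.1 d.1))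
    rw [e1, e3, smul_mul_assoc, mul_smul_comm, e2, e4, smul_smul, smul_smul] at e5
    exact smul_left_injective ℂ unitWedge_ne_zero e5

theorem mulConst_swap_left {a b c : Y G} (hab : proj G a = proj G b) (hbc : proj G b = proj G c) :
    mulConst b a c * mulConst a b c = 1 :=
  (isSortedCocycle_wedgeConst (proj G c)).antisymExt_swap_left ⟨a, hab.trans hbc⟩ ⟨b, hbc⟩ ⟨c, rfl⟩

theorem mulConst_swap_right {a b c : Y G} (hab : proj G a = proj G b) (hbc : proj G b = proj G c) :
    mulConst a c b * mulConst a b c = 1 :=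
  (isSortedCocycle_wedgeConst (proj G c)).antisymExt_swap_right ⟨a, hab.trans hbc⟩ ⟨b, hbc⟩ ⟨c, rfl⟩

theorem mulConst_cocycle {a b c d : Y G} (hab : proj G a = proj G b) (hbc : proj G b = proj G c)
    (hcd : proj G c = proj G d) :
    mulConst a b c * mulConst a c d = mulConst b c d * mulConst a b d :=
  (isSortedCocycle_wedgeConst (proj G d)).antisymExt_cocycle ⟨a, hab.trans (hbc.trans hcd)⟩
    ⟨b, hbc.trans hcd⟩ ⟨c, hcd⟩ ⟨d, rfl⟩

/-- The unitary coordinate on the fibres of `L`. -/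
def coordL (y : FibreSq (proj G)) : L G y ≃ₗ[ℂ] ℂ := DetPow.coordEquiv _ _ _

theorem herm_eq (y : FibreSq (proj G)) (u u' : L G y) :
    herm G y u u' = (starRingEnd ℂ) (coordL y u) * coordL y u' := rfl

variable (G) in
/-- The multiplication of the basic bundle gerbe: in the unitary coordinates of `L` it is the
multiplication of complex numbers, up to the factor `mulConst`. -/
def gerbeMul : GerbeMul (L G) := fun a b c hab hbc =>
  coordMul (mulConst a b c) (coordL ⟨(a, b), hab⟩) (coordL ⟨(b, c), hbc⟩)
    (coordL ⟨(a, c), hab.trans hbc⟩)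

theorem coordL_gerbeMul (a b c : Y G) (hab : proj G a = proj G b) (hbc : proj G b = proj G c)
    (u : L G ⟨(a, b), hab⟩) (w : L G ⟨(b, c), hbc⟩) :
    coordL ⟨(a, c), hab.trans hbc⟩ (gerbeMul G a b c hab hbc u w)
      = mulConst a b c * coordL ⟨(a, b), hab⟩ u * coordL ⟨(b, c), hbc⟩ w :=
  apply_coordMul _ _ _ _ u w

theorem toExterior_eq {a b : Y G} (hab : proj G a = proj G b) (h : Dominates a b)
    (u : L G ⟨(a, b), hab⟩) : DetPow.toExterior (sgn a b) (eigenSum a b) (eigenSum b a) u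
      = coordL ⟨(a, b), hab⟩ u • unitWedge (eigenSum a b) := by
  refine DetPow.toExterior_eq (sgn_ne_neg_iff.2 h) (fun h0 => ?_) u
  exact eigenSum_eq_bot_of_sgn (by rw [h0]; decide)

theorem isWedgeProduct_gerbeMul : IsWedgeProduct G (gerbeMul G) := by
  intro a b c hab hbc u w h1 h2
  have d1 := dominates_of_angle_le h2
  have d2 := dominates_of_angle_le h1
  have e1 := toExterior_eq hab d1 u
  have e2 := toExterior_eq hbc d2 w
  have e3 := toExterior_eq (hab.trans hbc) (d1.trans hab hbc d2) (gerbeMul G a b c hab hbc u w)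
  refine e3.trans ?_
  refine Eq.trans ?_ (congrArg₂ (· * ·) e1 e2).symm
  rw [coordL_gerbeMul, smul_mul_smul_comm, unitWedge_mul_unitWedge hab hbc d1 d2,
    mulConst_of_dominates d1 d2, smul_smul]
  congr 1
  ring

theorem pairing_eq {a b : Y G} (hab : proj G a = proj G b) (u : L G ⟨(a, b), hab⟩)
    (u' : L G ⟨(b, a), hab.symm⟩) :
    DetPow.pairing (sgn a b) (sgn b a) (eigenSum a b) (eigenSum b a) u u'
      = coordL ⟨(a, b), hab⟩ u * coordL ⟨(b, a), hab.symm⟩ u' :=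
  DetPow.pairing_eq (sgn_swap a b) u u'

theorem isAntisymmetric_gerbeMul : IsAntisymmetric G (gerbeMul G) := by
  intro a b c hab hbc u w
  constructor
  · intro u'
    apply (coordL ⟨(b, c), hbc⟩).injective
    have h := pairing_eq hab u u'
    refine (coordL_gerbeMul b a c hab.symm (hab.trans hbc) u' _).trans ?_
    rw [coordL_gerbeMul, map_smul, smul_eq_mul]
    refine Eq.trans ?_ (congrArg (· * coordL ⟨(b, c), hbc⟩ w) h).symm
    linear_combination (coordL ⟨(b, a), hab.symm⟩ u' * coordL ⟨(a, b), hab⟩ u *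
      coordL ⟨(b, c), hbc⟩ w) * mulConst_swap_left hab hbc
  · intro w'
    apply (coordL ⟨(a, b), hab⟩).injective
    have h := pairing_eq hbc w w'
    refine (coordL_gerbeMul a c b (hab.trans hbc) hbc.symm _ w').trans ?_
    rw [coordL_gerbeMul, map_smul, smul_eq_mul]
    refine Eq.trans ?_ (congrArg (· * coordL ⟨(a, b), hab⟩ u) h).symm
    linear_combination (coordL ⟨(c, b), hbc.symm⟩ w' * coordL ⟨(a, b), hab⟩ u *
      coordL ⟨(b, c), hbc⟩ w) * mulConst_swap_right hab hbc

theorem gerbeMul_isometric (a b c : Y G) (hab : proj G a = proj G b) (hbc : proj G b = proj G c)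
    (u u' : L G ⟨(a, b), hab⟩) (w w' : L G ⟨(b, c), hbc⟩) :
    herm G _ (gerbeMul G a b c hab hbc u w) (gerbeMul G a b c hab hbc u' w')
      = herm G _ u u' * herm G _ w w' := by
  have e := coordL_gerbeMul a b c hab hbc u w
  have e' := coordL_gerbeMul a b c hab hbc u' w'
  have h : (starRingEnd ℂ) (mulConst a b c) * mulConst a b c = 1 := by
    rw [Complex.conj_mul', norm_mulConst]
    simp
  have key : ∀ {k x x' y y' p p' : ℂ}, p = k * x * y → p' = k * x' * y' →
      (starRingEnd ℂ) k * k = 1 → (starRingEnd ℂ) p * p'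
        = (starRingEnd ℂ) x * x' * ((starRingEnd ℂ) y * y') :=
    fun {k x x' y y' p p'} hp hp' h => by
      rw [hp, hp', map_mul, map_mul]
      linear_combination (starRingEnd ℂ) x * (starRingEnd ℂ) y * x' * y' * h
  exact key e e' h

theorem gerbeMul_assoc (a b c d : Y G) (hab : proj G a = proj G b) (hbc : proj G b = proj G c)
    (hcd : proj G c = proj G d) (u : L G ⟨(a, b), hab⟩) (w : L G ⟨(b, c), hbc⟩)
    (t : L G ⟨(c, d), hcd⟩) :
    gerbeMul G a c d (hab.trans hbc) hcd (gerbeMul G a b c hab hbc u w) t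
      = gerbeMul G a b d hab (hbc.trans hcd) u (gerbeMul G b c d hbc hcd w t) := by
  apply (coordL ⟨(a, d), hab.trans (hbc.trans hcd)⟩).injective
  refine (coordL_gerbeMul a c d (hab.trans hbc) hcd _ t).trans ?_
  refine Eq.trans ?_ (coordL_gerbeMul a b d hab (hbc.trans hcd) u _).symm
  rw [coordL_gerbeMul, coordL_gerbeMul]
  have h := mulConst_cocycle hab hbc hcd
  have key : ∀ {k₁ k₂ k₃ k₄ x y z : ℂ}, k₁ * k₂ = k₃ * k₄ →
      k₂ * (k₁ * x * y) * z = k₄ * x * (k₃ * y * z) := fun {_ _ _ _ x y z} h => by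
    linear_combination x * y * z * h
  exact key h

end Multiplication

/-! ### Smoothness of frames, metric and multiplication -/

section BasisSeq

variable {H : Type u} [NormedAddCommGroup H] [InnerProductSpace ℂ H]

/-- An orthonormal basis of a subspace, continued by `0` to a sequence. -/
def basisSeq (V : Submodule ℂ H) [FiniteDimensional ℂ V] (i : ℕ) : V :=
  if h : i < Module.finrank ℂ V then stdOrthonormalBasis ℂ V ⟨i, h⟩ else 0

/-- The projections to `V` of a basis of `W` are linearly independent if the orthogonal projections
onto `V` and `W` are at distance less than `1`. -/
theorem linearIndependent_starProjection_basisSeq {V W : Submodule ℂ H} [FiniteDimensional ℂ V]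
    [FiniteDimensional ℂ W] (h : ‖V.starProjection - W.starProjection‖ < 1) {n : ℕ}
    (hn : n = Module.finrank ℂ W) :
    LinearIndependent ℂ (fun i : Fin n =>
      (⟨V.starProjection (basisSeq W i), V.starProjection_apply_mem _⟩ : V)) := by
  subst hn
  have h1 : LinearIndependent ℂ (fun i : Fin (Module.finrank ℂ W) => basisSeq W i) := by
    have h2 : (fun i : Fin (Module.finrank ℂ W) => basisSeq W i) = stdOrthonormalBasis ℂ W :=
      funext fun i => dif_pos i.2
    rw [h2]
    exact (stdOrthonormalBasis ℂ W).orthonormal.linearIndependent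
  have h3 := h1.map' (V.starProjection.toLinearMap ∘ₗ W.subtype)
    (LinearMap.ker_eq_bot.2 (starProjection_injOn h))
  refine LinearIndependent.of_comp V.subtype ?_
  convert h3 using 1
  · exact funext fun _ => rfl
  · rfl

end BasisSeq

section Frames

variable {H : Type u} [NormedAddCommGroup H] [InnerProductSpace ℂ H] [CompleteSpace H]
  {G : Subgroup (unitary (H →L[ℂ] H))}
  {𝓘 : Type v} [NormedAddCommGroup 𝓘] [NormedSpace ℝ 𝓘] {j : G → 𝓘}

/-- `φ` is, near `y₀`, the coordinate of a wedge product of a smooth frame of `E`. -/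
def IsWedgeCoord (j : G → 𝓘) (y₀ : FibreSq (proj G)) (φ : FibreSq (proj G) → ℂ) : Prop :=
  ∃ (k : ℕ) (e : Fin k → FibreSq (proj G) → H),
    (∀ i, SmoothNear (embSq (embY G j)) (e i) y₀) ∧
    ∀ᶠ y in nhdsAlong (embSq (embY G j)) y₀, Module.finrank ℂ (eigenSum y.1.1 y.1.2) = k ∧
      (∀ i, e i y ∈ eigenSum y.1.1 y.1.2) ∧ φ y ≠ 0 ∧
      ExteriorAlgebra.ιMulti ℂ k (fun i => e i y) = φ y • unitWedge (eigenSum y.1.1 y.1.2)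

/-- `φ` is, near `y₀`, the coordinate of a smooth frame of `L`.  Over the negative part the inverse
of `φ` is the coordinate of the dual frame. -/
def IsSmoothCoord (j : G → 𝓘) (y₀ : FibreSq (proj G)) (φ : FibreSq (proj G) → ℂ) : Prop :=
  (Dominates y₀.1.1 y₀.1.2 → IsWedgeCoord j y₀ φ) ∧
  (Dominates y₀.1.2 y₀.1.1 → IsWedgeCoord j (swapSq y₀) fun y => (φ (swapSq y))⁻¹)

theorem IsWedgeCoord.ne_zero {y₀ : FibreSq (proj G)} {φ : FibreSq (proj G) → ℂ}
    (h : IsWedgeCoord j y₀ φ) : φ y₀ ≠ 0 := by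
  obtain ⟨k, e, -, he⟩ := h
  exact (self_of_nhdsAlong he).2.2.1

theorem IsSmoothCoord.ne_zero {y₀ : FibreSq (proj G)} {φ : FibreSq (proj G) → ℂ}
    (h : IsSmoothCoord j y₀ φ) : φ y₀ ≠ 0 := by
  rcases dominates_total y₀.1.1 y₀.1.2 with hd | hd
  · exact (h.1 hd).ne_zero
  · exact fun h0 => (h.2 hd).ne_zero (inv_eq_zero.2 h0)

theorem IsSmoothCoord.swap {y₀ : FibreSq (proj G)} {φ : FibreSq (proj G) → ℂ}
    (h : IsSmoothCoord j y₀ φ) : IsSmoothCoord j (swapSq y₀) fun y => (φ (swapSq y))⁻¹ := by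
  refine ⟨h.2, fun hd => ?_⟩
  simp only [inv_inv]
  exact h.1 hd

variable [hG : IsCompactPerturbation G]

/-- Products of this form are Gram determinants. -/
theorem IsWedgeCoord.smoothNear_conj_mul {y₀ : FibreSq (proj G)} {φ ψ : FibreSq (proj G) → ℂ}
    (hφ : IsWedgeCoord j y₀ φ) (hψ : IsWedgeCoord j y₀ ψ) :
    SmoothNear (embSq (embY G j)) (fun y => (starRingEnd ℂ) (φ y) * ψ y) y₀ := by
  obtain ⟨k, e, he, hev⟩ := hφ
  obtain ⟨k', e', he', hev'⟩ := hψ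
  obtain rfl : k = k' := (self_of_nhdsAlong hev).1.symm.trans (self_of_nhdsAlong hev').1
  refine (SmoothNear.det (f := fun y i l => ⟪e i y, e' l y⟫_ℂ)
    fun i l => (he i).inner (he' l)).congr ?_
  filter_upwards [hev, hev'] with y hy hy'
  exact (det_gram_eq hy.1 hy.2.1 hy'.2.1 hy.2.2.2 hy'.2.2.2).symm

theorem conj_mul_self_ne_zero {z : ℂ} (hz : z ≠ 0) : (starRingEnd ℂ) z * z ≠ 0 :=
  mul_ne_zero ((map_ne_zero _).2 hz) hz

theorem IsWedgeCoord.smoothNear_div {y₀ : FibreSq (proj G)} {φ ψ : FibreSq (proj G) → ℂ}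
    (hφ : IsWedgeCoord j y₀ φ) (hψ : IsWedgeCoord j y₀ ψ) :
    SmoothNear (embSq (embY G j)) (fun y => ψ y / φ y) y₀ := by
  refine ((hφ.smoothNear_conj_mul hψ).div (hφ.smoothNear_conj_mul hφ)
    (conj_mul_self_ne_zero hφ.ne_zero)).congr ?_
  obtain ⟨k, e, he, hev⟩ := hφ
  filter_upwards [hev] with y hy
  rw [mul_div_mul_left _ _ ((map_ne_zero _).2 hy.2.2.1)]

theorem IsSmoothCoord.smoothNear_div {y₀ : FibreSq (proj G)} {φ ψ : FibreSq (proj G) → ℂ}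
    (hφ : IsSmoothCoord j y₀ φ) (hψ : IsSmoothCoord j y₀ ψ) :
    SmoothNear (embSq (embY G j)) (fun y => ψ y / φ y) y₀ := by
  rcases dominates_total y₀.1.1 y₀.1.2 with hd | hd
  · exact (hφ.1 hd).smoothNear_div (hψ.1 hd)
  · have h := smoothNear_swapSq ((hψ.2 hd).smoothNear_div (hφ.2 hd))
    have e : ∀ y : FibreSq (proj G), (φ (swapSq (swapSq y)))⁻¹ / (ψ (swapSq (swapSq y)))⁻¹
        = ψ y / φ y := fun y => by
      change (φ y)⁻¹ / (ψ y)⁻¹ = _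
      rw [inv_div_inv]
    simpa only [e] using h

theorem IsSmoothCoord.smoothNear_conj_mul_self {y₀ : FibreSq (proj G)}
    {φ : FibreSq (proj G) → ℂ} (hφ : IsSmoothCoord j y₀ φ) :
    SmoothNear (embSq (embY G j)) (fun y => (starRingEnd ℂ) (φ y) * φ y) y₀ := by
  rcases dominates_total y₀.1.1 y₀.1.2 with hd | hd
  · exact (hφ.1 hd).smoothNear_conj_mul (hφ.1 hd)
  · have h := (smoothNear_swapSq ((hφ.2 hd).smoothNear_conj_mul (hφ.2 hd))).inv
      (conj_mul_self_ne_zero (hφ.2 hd).ne_zero)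
    have e : ∀ y : FibreSq (proj G), ((starRingEnd ℂ) (φ (swapSq (swapSq y)))⁻¹ *
        (φ (swapSq (swapSq y)))⁻¹)⁻¹ = (starRingEnd ℂ) (φ y) * φ y := fun y => by
      change ((starRingEnd ℂ) (φ y)⁻¹ * (φ y)⁻¹)⁻¹ = _
      rw [map_inv₀, ← mul_inv, inv_inv]
    simpa only [e] using h

theorem eventually_dominates (hj : IsSmoothEmbedding j) {y₀ : FibreSq (proj G)}
    (h : Dominates y₀.1.1 y₀.1.2) :
    ∀ᶠ y in nhdsAlong (embSq (embY G j)) y₀, Dominates y.1.1 y.1.2 := by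
  filter_upwards [eventually_sgn_eq hj y₀] with y hy
  rw [← sgn_ne_neg_iff] at h ⊢
  rwa [hy]

/-- The coordinates of the frames that define the smooth structure of `L`.  Both conditions apply
near a null point, where the sums of eigenspaces vanish. -/
theorem isSmoothCoord_of_frame (hj : IsSmoothEmbedding j) {U : Set (FibreSq (proj G))}
    {f : ∀ y, L G y} (hf : frame G j U f) {y₀ : FibreSq (proj G)} (hy₀ : y₀ ∈ U) :
    IsSmoothCoord j y₀ fun y => coordL y (f y) := by
  obtain ⟨hU, e, e', he, he', hw⟩ := hf
  have hnear := isOpenAlong_iff.1 hU y₀ hy₀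
  constructor
  · intro hd
    refine ⟨Module.finrank ℂ (eigenSum y₀.1.1 y₀.1.2), fun i y => (e i y : H),
      fun i => (he i).smoothNear hU hy₀, ?_⟩
    filter_upwards [hnear, eventually_dominates hj hd, eventually_finrank_eq hj y₀]
      with y hy hyd hyk
    refine ⟨hyk, fun i => (e i y).2, (hw y hy).coord_ne_zero, ?_⟩
    rw [← hyk]
    exact (hw y hy).ιMulti_left (sgn_ne_neg_iff.2 hyd)
      fun h0 => eigenSum_eq_bot_of_sgn (by rw [h0]; decide)
  · intro hd
    have hswap : Tendsto swapSq (nhdsAlong (embSq (embY G j)) (swapSq y₀))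
      (nhdsAlong (embSq (embY G j)) y₀) := tendsto_swapSq (swapSq y₀)
    refine ⟨Module.finrank ℂ (eigenSum y₀.1.2 y₀.1.1), fun i y => (e' i (swapSq y) : H),
      fun i => smoothNear_swapSq (y₀ := swapSq y₀) ((he' i).smoothNear hU hy₀), ?_⟩
    filter_upwards [hswap.eventually hnear, eventually_dominates hj (y₀ := swapSq y₀) hd,
      eventually_finrank_eq hj (swapSq y₀)] with y hy hyd hyk
    have hyk' : Module.finrank ℂ (eigenSum y.1.1 y.1.2)
      = Module.finrank ℂ (eigenSum y₀.1.2 y₀.1.1) := hyk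
    refine ⟨hyk', fun i => (e' i (swapSq y)).2, inv_ne_zero (hw _ hy).coord_ne_zero, ?_⟩
    rw [← hyk']
    refine (hw _ hy).ιMulti_right ?_ fun h0 => eigenSum_eq_bot_of_dominates ?_
    · rw [Ne, sgn_eq_pos_iff]
      exact hyd
    · rw [← sgn_ne_neg_iff, h0]
      decide

/-- The local frame of `E` near `y₀` obtained by projecting a basis of the fibre at `y₀`. -/
def projFrame (y₀ : FibreSq (proj G)) (i : ℕ) (y : FibreSq (proj G)) : eigenSum y.1.1 y.1.2 :=
  ⟨(eigenSum y.1.1 y.1.2).starProjection (basisSeq (eigenSum y₀.1.1 y₀.1.2) i),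
    Submodule.starProjection_apply_mem _ _⟩

theorem smoothNear_projFrame (hj : IsSmoothEmbedding j) (y₀ : FibreSq (proj G)) (i : ℕ)
    (y : FibreSq (proj G)) : SmoothNear (embSq (embY G j)) (fun y => (projFrame y₀ i y : H)) y :=
  (smoothNear_eigenProj hj y).comp
    (Φ := fun P : H →L[ℂ] H => P (basisSeq (eigenSum y₀.1.1 y₀.1.2) i))
    ((ContinuousLinearMap.apply ℂ H
      (basisSeq (eigenSum y₀.1.1 y₀.1.2) i : H)).contDiff.restrict_scalars ℝ)

theorem linearIndependent_projFrame {y₀ y : FibreSq (proj G)}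
    (hy : ‖eigenProj y - eigenProj y₀‖ < 1)
    (hk : Module.finrank ℂ (eigenSum y.1.1 y.1.2) = Module.finrank ℂ (eigenSum y₀.1.1 y₀.1.2)) :
    LinearIndependent ℂ
      (fun i : Fin (Module.finrank ℂ (eigenSum y.1.1 y.1.2)) => projFrame y₀ i y) :=
  linearIndependent_starProjection_basisSeq (V := eigenSum y.1.1 y.1.2)
    (W := eigenSum y₀.1.1 y₀.1.2) hy hk

/-- The analogous local frame for the eigenvalues between `z₁` and `z₂` in the opposite order. -/
def projFrameSwap (y₀ : FibreSq (proj G)) (i : ℕ) (y : FibreSq (proj G)) :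
    eigenSum y.1.2 y.1.1 := projFrame (swapSq y₀) i (swapSq y)

theorem smoothNear_projFrameSwap (hj : IsSmoothEmbedding j) (y₀ : FibreSq (proj G)) (i : ℕ)
    (y : FibreSq (proj G)) :
    SmoothNear (embSq (embY G j)) (fun y => (projFrameSwap y₀ i y : H)) y :=
  smoothNear_swapSq (smoothNear_projFrame hj (swapSq y₀) i (swapSq y))

theorem linearIndependent_projFrameSwap {y₀ y : FibreSq (proj G)}
    (hy : ‖eigenProj (swapSq y) - eigenProj (swapSq y₀)‖ < 1)
    (hk : Module.finrank ℂ (eigenSum y.1.2 y.1.1) = Module.finrank ℂ (eigenSum y₀.1.2 y₀.1.1)) :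
    LinearIndependent ℂ
      (fun i : Fin (Module.finrank ℂ (eigenSum y.1.2 y.1.1)) => projFrameSwap y₀ i y) :=
  linearIndependent_starProjection_basisSeq (V := eigenSum y.1.2 y.1.1)
    (W := eigenSum y₀.1.2 y₀.1.1) hy hk

theorem exists_frame (hj : IsSmoothEmbedding j) (y₀ : FibreSq (proj G)) :
    ∃ U f, frame G j U f ∧ y₀ ∈ U := by
  obtain ⟨U, hU, hy₀, hUp⟩ := exists_isOpenAlong
    (((eventually_norm_eigenProj_sub_lt hj y₀).and (eventually_finrank_eq hj y₀)).and
      ((tendsto_swapSq y₀).eventually ((eventually_norm_eigenProj_sub_lt hj (swapSq y₀)).and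
        (eventually_finrank_eq hj (swapSq y₀)))))
  have hex : ∀ y : FibreSq (proj G), ∃ a : L G y, y ∈ U →
      DetPow.IsWedge (sgn y.1.1 y.1.2) (eigenSum y.1.1 y.1.2) (eigenSum y.1.2 y.1.1)
        (fun i => projFrame y₀ i y) (fun i => projFrameSwap y₀ i y) a := fun y => by
    by_cases hy : y ∈ U
    · obtain ⟨a, ha⟩ := DetPow.exists_isWedge (sgn y.1.1 y.1.2)
        (e := fun i => projFrame y₀ i y) (e' := fun i => projFrameSwap y₀ i y)
        (linearIndependent_projFrame (hUp y hy).1.1 (hUp y hy).1.2)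
        (linearIndependent_projFrameSwap (hUp y hy).2.1 (hUp y hy).2.2)
      exact ⟨a, fun _ => ha⟩
    · exact ⟨0, fun h => absurd h hy⟩
  choose f hf using hex
  exact ⟨U, f, ⟨hU, projFrame y₀, projFrameSwap y₀,
    fun i => smoothAlong_of_smoothNear fun y _ => smoothNear_projFrame hj y₀ i y,
    fun i => smoothAlong_of_smoothNear fun y _ => smoothNear_projFrameSwap hj y₀ i y, hf⟩, hy₀⟩

theorem isHermitianLineBundle (hj : IsSmoothEmbedding j) :
    IsHermitianLineBundle (embSq (embY G j)) (L G) (herm G) (frame G j) where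
  rank_one y := (coordL y).finrank_eq.trans (Module.finrank_self ℂ)
  isOpen_of_frame _ _ hf := hf.1
  locally_trivial := exists_frame hj
  frame_ne_zero U f hf y hy h0 := (isSmoothCoord_of_frame hj hf hy).ne_zero (by simp [h0])
  smooth_transition U f V f' hf hf' := by
    refine ⟨fun y => coordL y (f' y) / coordL y (f y), smoothAlong_of_smoothNear fun y hy =>
      (isSmoothCoord_of_frame hj hf hy.1).smoothNear_div (isSmoothCoord_of_frame hj hf' hy.2),
      fun y hy => (coordL y).injective ?_⟩
    rw [map_smul, smul_eq_mul, div_mul_cancel₀ _ (isSmoothCoord_of_frame hj hf hy.1).ne_zero]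
  add_right y a b c := by simp only [herm_eq, map_add, mul_add]
  smul_right y r a b := by
    rw [herm_eq, herm_eq, map_smul, smul_eq_mul]
    ring
  conj_symm y a b := by
    rw [herm_eq, herm_eq, map_mul, Complex.conj_conj, mul_comm]
  re_pos y a ha := by
    rw [herm_eq, ← Complex.normSq_eq_conj_mul_self, Complex.ofReal_re, Complex.normSq_pos]
    exact (map_ne_zero_iff _ (coordL y).injective).2 ha
  smooth_metric U f hf := smoothAlong_of_smoothNear fun y hy =>
    (isSmoothCoord_of_frame hj hf hy).smoothNear_conj_mul_self

end Frames

section SmoothMul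

variable {H : Type u} [NormedAddCommGroup H] [InnerProductSpace ℂ H] [CompleteSpace H]
  {G : Subgroup (unitary (H →L[ℂ] H))}
  {𝓘 : Type v} [NormedAddCommGroup 𝓘] {j : G → 𝓘}

theorem tendsto_face12 (y₀ : FibreCube (proj G)) :
    Tendsto face12 (nhdsAlong (embCube (embY G j)) y₀)
      (nhdsAlong (embSq (embY G j)) (face12 y₀)) :=
  tendsto_nhdsAlong (S := fun p => (p.1, p.2.1)) (by fun_prop) fun _ => rfl

theorem tendsto_face23 (y₀ : FibreCube (proj G)) :
    Tendsto face23 (nhdsAlong (embCube (embY G j)) y₀)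
      (nhdsAlong (embSq (embY G j)) (face23 y₀)) :=
  tendsto_nhdsAlong (S := fun p => (p.2.1, p.2.2)) (by fun_prop) fun _ => rfl

theorem tendsto_face13 (y₀ : FibreCube (proj G)) :
    Tendsto face13 (nhdsAlong (embCube (embY G j)) y₀)
      (nhdsAlong (embSq (embY G j)) (face13 y₀)) :=
  tendsto_nhdsAlong (S := fun p => (p.1, p.2.2)) (by fun_prop) fun _ => rfl

variable [NormedSpace ℝ 𝓘]

section Precomp

variable {F : Type*} [NormedAddCommGroup F] [NormedSpace ℝ F]

theorem smoothNear_face12 {f : FibreSq (proj G) → F} {y₀ : FibreCube (proj G)}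
    (hf : SmoothNear (embSq (embY G j)) f (face12 y₀)) :
    SmoothNear (embCube (embY G j)) (fun y => f (face12 y)) y₀ :=
  hf.precomp (S := fun p => (p.1, p.2.1)) (by fun_prop) fun _ => rfl

theorem smoothNear_face23 {f : FibreSq (proj G) → F} {y₀ : FibreCube (proj G)}
    (hf : SmoothNear (embSq (embY G j)) f (face23 y₀)) :
    SmoothNear (embCube (embY G j)) (fun y => f (face23 y)) y₀ :=
  hf.precomp (S := fun p => (p.2.1, p.2.2)) (by fun_prop) fun _ => rfl

theorem smoothNear_face13 {f : FibreSq (proj G) → F} {y₀ : FibreCube (proj G)}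
    (hf : SmoothNear (embSq (embY G j)) f (face13 y₀)) :
    SmoothNear (embCube (embY G j)) (fun y => f (face13 y)) y₀ :=
  hf.precomp (S := fun p => (p.1, p.2.2)) (by fun_prop) fun _ => rfl

/-- `(y₁, y₂, y₃) ↦ (y₂, y₁, y₃)`. -/
def swapCube12 (y : FibreCube (proj G)) : FibreCube (proj G) :=
  ⟨(y.1.2.1, y.1.1, y.1.2.2), y.2.1.symm, y.2.1.trans y.2.2⟩

/-- `(y₁, y₂, y₃) ↦ (y₁, y₃, y₂)`. -/
def swapCube23 (y : FibreCube (proj G)) : FibreCube (proj G) :=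
  ⟨(y.1.1, y.1.2.2, y.1.2.1), y.2.1.trans y.2.2, y.2.2.symm⟩

theorem smoothNear_swapCube12 {f : FibreCube (proj G) → F} {y₀ : FibreCube (proj G)}
    (hf : SmoothNear (embCube (embY G j)) f (swapCube12 y₀)) :
    SmoothNear (embCube (embY G j)) (fun y => f (swapCube12 y)) y₀ :=
  hf.precomp (S := fun p => (p.2.1, p.1, p.2.2)) (by fun_prop) fun _ => rfl

theorem smoothNear_swapCube23 {f : FibreCube (proj G) → F} {y₀ : FibreCube (proj G)}
    (hf : SmoothNear (embCube (embY G j)) f (swapCube23 y₀)) :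
    SmoothNear (embCube (embY G j)) (fun y => f (swapCube23 y)) y₀ :=
  hf.precomp (S := fun p => (p.1, p.2.2, p.2.1)) (by fun_prop) fun _ => rfl

end Precomp

/-- The coefficient of the multiplication with respect to frames with coordinates `φ₁`, `φ₂`,
`φ₃`. -/
def mulCoeff (φ₁ φ₂ φ₃ : FibreSq (proj G) → ℂ) (y : FibreCube (proj G)) : ℂ :=
  mulConst y.1.1 y.1.2.1 y.1.2.2 * φ₁ (face12 y) * φ₂ (face23 y) / φ₃ (face13 y)

theorem mulConst_ne_zero (a b c : Y G) : mulConst a b c ≠ 0 := fun h => by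
  have := norm_mulConst a b c
  rw [h, norm_zero] at this
  exact zero_ne_one this

theorem mulCoeff_ne_zero {φ₁ φ₂ φ₃ : FibreSq (proj G) → ℂ} {y : FibreCube (proj G)}
    (h₁ : φ₁ (face12 y) ≠ 0) (h₂ : φ₂ (face23 y) ≠ 0) (h₃ : φ₃ (face13 y) ≠ 0) :
    mulCoeff φ₁ φ₂ φ₃ y ≠ 0 :=
  div_ne_zero (mul_ne_zero (mul_ne_zero (mulConst_ne_zero _ _ _) h₁) h₂) h₃

theorem isOpenAlong_Y (hj : IsSmoothEmbedding j) :
    IsOpenAlong (fun p : Circle × G => ((p.1 : ℂ), j p.2))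
      {p | p.1 ≠ 1 ∧ (p.1 : ℂ) ∉ spectrum ℂ (op p.2)} := by
  obtain ⟨T, hT, hTj⟩ := hj
  refine ⟨{p : ℂ × 𝓘 | p.1 ≠ 1} ∩
    (fun p : ℂ × 𝓘 => algebraMap ℂ (H →L[ℂ] H) p.1 - T p.2) ⁻¹' {A | IsUnit A}, ?_, ?_⟩
  · refine (isOpen_ne.preimage continuous_fst).inter (Units.isOpen.preimage ?_)
    exact ((algebraMapCLM ℂ (H →L[ℂ] H)).continuous.comp continuous_fst).sub
      (hT.continuous.comp continuous_snd)
  · ext p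
    simp only [Set.mem_ofPred_eq, Set.mem_preimage, Set.mem_inter_iff, hTj, spectrum.notMem_iff]
    exact and_congr_left fun _ => not_congr ⟨fun h => by rw [h]; rfl, fun h => Circle.ext h⟩

variable [hG : IsCompactPerturbation G]

/-- On sorted triples the coefficient is a quotient of Gram determinants. -/
theorem smoothNear_mulCoeff_of_dominates (hj : IsSmoothEmbedding j) {y₀ : FibreCube (proj G)}
    (h12 : Dominates y₀.1.1 y₀.1.2.1) (h23 : Dominates y₀.1.2.1 y₀.1.2.2)
    {φ₁ φ₂ φ₃ : FibreSq (proj G) → ℂ} (h₁ : IsWedgeCoord j (face12 y₀) φ₁)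
    (h₂ : IsWedgeCoord j (face23 y₀) φ₂) (h₃ : IsWedgeCoord j (face13 y₀) φ₃) :
    SmoothNear (embCube (embY G j)) (mulCoeff φ₁ φ₂ φ₃) y₀ := by
  have hgram := smoothNear_face13 (h₃.smoothNear_conj_mul h₃)
  have hne := conj_mul_self_ne_zero h₃.ne_zero
  obtain ⟨m, e₁, he₁, hev₁⟩ := h₁
  obtain ⟨n, e₂, he₂, hev₂⟩ := h₂
  obtain ⟨p, e₃, he₃, hev₃⟩ := h₃
  have hp : p = m + n := by
    rw [← (self_of_nhdsAlong hev₁).1, ← (self_of_nhdsAlong hev₂).1, ← (self_of_nhdsAlong hev₃).1]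
    exact finrank_eigenSum_add y₀.2.1 y₀.2.2 h12 h23
  subst hp
  set x : Fin (m + n) → FibreCube (proj G) → H := fun i y =>
    Fin.append (fun i => e₁ i (face12 y)) (fun i => e₂ i (face23 y)) i with hx
  have hxs : ∀ i, SmoothNear (embCube (embY G j)) (x i) y₀ := by
    intro i
    refine Fin.addCases (fun i => ?_) (fun i => ?_) i
    · simp only [hx, Fin.append_left]
      exact smoothNear_face12 (he₁ i)
    · simp only [hx, Fin.append_right]
      exact smoothNear_face23 (he₂ i)
  refine ((SmoothNear.det (f := fun y i l => ⟪e₃ i (face13 y), x l y⟫_ℂ)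
    fun i l => (smoothNear_face13 (he₃ i)).inner (hxs l)).div hgram hne).congr ?_
  filter_upwards [(tendsto_face12 y₀).eventually hev₁, (tendsto_face23 y₀).eventually hev₂,
    (tendsto_face13 y₀).eventually hev₃,
    (tendsto_face12 y₀).eventually (eventually_dominates hj (y₀ := face12 y₀) h12),
    (tendsto_face23 y₀).eventually (eventually_dominates hj (y₀ := face23 y₀) h23)]
    with y hy₁ hy₂ hy₃ hd12 hd23
  have hd12' : Dominates y.1.1 y.1.2.1 := hd12
  have hd23' : Dominates y.1.2.1 y.1.2.2 := hd23
  have hsup := hd12'.eigenSum_eq_sup y.2.1 y.2.2 hd23'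
  have hxmem : ∀ i, x i y ∈ eigenSum (face13 y).1.1 (face13 y).1.2 := by
    intro i
    change x i y ∈ eigenSum y.1.1 y.1.2.2
    rw [hsup]
    refine Fin.addCases (fun i => ?_) (fun i => ?_) i
    · simp only [hx, Fin.append_left]
      exact Submodule.mem_sup_left (hy₁.2.1 i)
    · simp only [hx, Fin.append_right]
      exact Submodule.mem_sup_right (hy₂.2.1 i)
  have hwedge : ExteriorAlgebra.ιMulti ℂ (m + n) (fun i => x i y)
      = (φ₁ (face12 y) * φ₂ (face23 y) * mulConst y.1.1 y.1.2.1 y.1.2.2) •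
        unitWedge (eigenSum (face13 y).1.1 (face13 y).1.2) := by
    have h1 : ExteriorAlgebra.ιMulti ℂ (m + n) (fun i => x i y)
        = ExteriorAlgebra.ιMulti ℂ m (fun i => e₁ i (face12 y)) *
          ExteriorAlgebra.ιMulti ℂ n (fun i => e₂ i (face23 y)) := by
      rw [ExteriorAlgebra.ιMulti_mul_ιMulti]
    have h2 : unitWedge (eigenSum (face12 y).1.1 (face12 y).1.2) *
        unitWedge (eigenSum (face23 y).1.1 (face23 y).1.2)
          = wedgeConst y.1.1 y.1.2.1 y.1.2.2 •
            unitWedge (eigenSum (face13 y).1.1 (face13 y).1.2) :=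
      unitWedge_mul_unitWedge y.2.1 y.2.2 hd12' hd23'
    rw [h1, hy₁.2.2.2, hy₂.2.2.2, smul_mul_smul_comm, h2, smul_smul,
      mulConst_of_dominates hd12' hd23']
  rw [det_gram_eq hy₃.1 hy₃.2.1 hxmem hy₃.2.2.2 hwedge,
    mul_div_mul_left _ _ ((map_ne_zero _).2 hy₃.2.2.1), mulCoeff]
  congr 1
  ring

/-- The coefficient is smooth for all triples, by reduction to the sorted ones. -/
theorem smoothNear_mulCoeff (hj : IsSmoothEmbedding j) (y₀ : FibreCube (proj G))
    {φ₁ φ₂ φ₃ : FibreSq (proj G) → ℂ} (h₁ : IsSmoothCoord j (face12 y₀) φ₁)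
    (h₂ : IsSmoothCoord j (face23 y₀) φ₂) (h₃ : IsSmoothCoord j (face13 y₀) φ₃) :
    SmoothNear (embCube (embY G j)) (mulCoeff φ₁ φ₂ φ₃) y₀ := by
  set g := proj G y₀.1.1 with hg
  have key : ∀ a b c : {a : Y G // proj G a = g}, ∀ φ₁ φ₂ φ₃ : FibreSq (proj G) → ℂ,
      IsSmoothCoord j ⟨(a.1, b.1), a.2.trans b.2.symm⟩ φ₁ →
      IsSmoothCoord j ⟨(b.1, c.1), b.2.trans c.2.symm⟩ φ₂ →
      IsSmoothCoord j ⟨(a.1, c.1), a.2.trans c.2.symm⟩ φ₃ →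
      SmoothNear (embCube (embY G j)) (mulCoeff φ₁ φ₂ φ₃)
        ⟨(a.1, b.1, c.1), a.2.trans b.2.symm, b.2.trans c.2.symm⟩ := by
    -- A transposition of the arguments inverts the coefficient, for the corresponding dual frames.
    refine forall_of_sorted₃ (r := fun a b : {a : Y G // proj G a = g} => Dominates a.1 b.1)
      (fun a b => dominates_total _ _) ?_ ?_ ?_
    · intro a b c h φ₁ φ₂ φ₃ h₁ h₂ h₃
      have h' := h _ _ _ h₁.swap h₃ h₂
      have hs := (smoothNear_swapCube12
        (y₀ := ⟨(b.1, a.1, c.1), b.2.trans a.2.symm, a.2.trans c.2.symm⟩) h').inv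
        (mulCoeff_ne_zero h₁.swap.ne_zero h₃.ne_zero h₂.ne_zero)
      refine hs.congr (Eventually.of_forall fun y => ?_)
      have hc := mulConst_swap_left y.2.1 y.2.2
      change mulConst y.1.1 y.1.2.1 y.1.2.2 * φ₁ (face12 y) * φ₂ (face23 y) / φ₃ (face13 y)
        = (mulConst y.1.2.1 y.1.1 y.1.2.2 * (φ₁ (face12 y))⁻¹ * φ₃ (face13 y)
          / φ₂ (face23 y))⁻¹
      rw [eq_inv_of_mul_eq_one_left hc]
      simp only [mul_inv, inv_inv, div_eq_mul_inv]
      ring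
    · intro a b c h φ₁ φ₂ φ₃ h₁ h₂ h₃
      have h' := h _ _ _ h₃ h₂.swap h₁
      have hs := (smoothNear_swapCube23
        (y₀ := ⟨(a.1, c.1, b.1), a.2.trans c.2.symm, c.2.trans b.2.symm⟩) h').inv
        (mulCoeff_ne_zero h₃.ne_zero h₂.swap.ne_zero h₁.ne_zero)
      refine hs.congr (Eventually.of_forall fun y => ?_)
      have hc := mulConst_swap_right y.2.1 y.2.2
      change mulConst y.1.1 y.1.2.1 y.1.2.2 * φ₁ (face12 y) * φ₂ (face23 y) / φ₃ (face13 y)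
        = (mulConst y.1.1 y.1.2.2 y.1.2.1 * φ₃ (face13 y) * (φ₂ (face23 y))⁻¹
          / φ₁ (face12 y))⁻¹
      rw [eq_inv_of_mul_eq_one_left hc]
      simp only [mul_inv, inv_inv, div_eq_mul_inv]
      ring
    · intro a b c hab hbc φ₁ φ₂ φ₃ h₁ h₂ h₃
      exact smoothNear_mulCoeff_of_dominates hj hab hbc (h₁.1 hab) (h₂.1 hbc)
        (h₃.1 (hab.trans (a.2.trans b.2.symm) (b.2.trans c.2.symm) hbc))
  exact key ⟨y₀.1.1, rfl⟩ ⟨y₀.1.2.1, y₀.2.1.symm⟩ ⟨y₀.1.2.2, (y₀.2.1.trans y₀.2.2).symm⟩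
    φ₁ φ₂ φ₃ h₁ h₂ h₃

theorem smooth_gerbeMul (hj : IsSmoothEmbedding j) {U₁ U₂ U₃ : Set (FibreSq (proj G))}
    {f₁ f₂ f₃ : ∀ y, L G y} (h₁ : frame G j U₁ f₁) (h₂ : frame G j U₂ f₂)
    (h₃ : frame G j U₃ f₃) : ∃ c : FibreCube (proj G) → ℂ,
      SmoothAlong (embCube (embY G j)) (face12 ⁻¹' U₁ ∩ face23 ⁻¹' U₂ ∩ face13 ⁻¹' U₃) c ∧
      ∀ y ∈ face12 ⁻¹' U₁ ∩ face23 ⁻¹' U₂ ∩ face13 ⁻¹' U₃,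
        gerbeMul G y.1.1 y.1.2.1 y.1.2.2 y.2.1 y.2.2 (f₁ (face12 y)) (f₂ (face23 y))
          = c y • f₃ (face13 y) := by
  refine ⟨mulCoeff (fun y => coordL y (f₁ y)) (fun y => coordL y (f₂ y))
    (fun y => coordL y (f₃ y)), smoothAlong_of_smoothNear fun y hy => ?_, fun y hy => ?_⟩
  · exact smoothNear_mulCoeff hj y (isSmoothCoord_of_frame hj h₁ hy.1.1)
      (isSmoothCoord_of_frame hj h₂ hy.1.2) (isSmoothCoord_of_frame hj h₃ hy.2)
  · apply (coordL (face13 y)).injective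
    refine (coordL_gerbeMul _ _ _ y.2.1 y.2.2 (f₁ (face12 y)) (f₂ (face23 y))).trans ?_
    have hne : coordL (face13 y) (f₃ (face13 y)) ≠ 0 :=
      (isSmoothCoord_of_frame hj h₃ hy.2).ne_zero
    refine Eq.trans ?_ ((coordL (face13 y)).map_smul _ _).symm
    exact (div_mul_cancel₀ _ hne).symm

/-! ### The bundle gerbe of a group of compact perturbations of the identity -/

/-- Since `Y` is open in `U(1) × G`, the maps `g ↦ (z, g)` with `z` fixed are local sections. -/
theorem isSurjectiveSubmersion_proj (hj : IsSmoothEmbedding j) :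
    IsSurjectiveSubmersion (embY G j) j (proj G) where
  smooth := smoothAlong_of_smoothNear fun y _ =>
    smoothNear_ambient (f' := fun e : ℂ × 𝓘 => e.2) contDiff_snd y
  surjective g := by
    obtain ⟨z, hz, hzg⟩ := exists_notMem_spectrum (op_mem_unitary g) (hG.isCompactOperator g)
    exact ⟨⟨(z, g), hz, hzg⟩, rfl⟩
  exists_section y := by
    classical
    obtain ⟨W, hW, hWY⟩ := isOpenAlong_Y hj
    have hmem : ∀ m : G, ((y.1.1 : ℂ), j m) ∈ W →
        y.1.1 ≠ 1 ∧ ((y.1.1 : Circle) : ℂ) ∉ spectrum ℂ (op m) := fun m hm => by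
      have : (y.1.1, m) ∈ {p : Circle × G | p.1 ≠ 1 ∧ (p.1 : ℂ) ∉ spectrum ℂ (op p.2)} := by
        rw [hWY]
        exact hm
      exact this
    have hyW : ((y.1.1 : ℂ), j y.1.2) ∈ W := by
      have : (y.1.1, y.1.2) ∈ {p : Circle × G | p.1 ≠ 1 ∧ (p.1 : ℂ) ∉ spectrum ℂ (op p.2)} := y.2
      rw [hWY] at this
      exact this
    let σ : G → Y G := fun m => if hm : ((y.1.1 : ℂ), j m) ∈ W then ⟨(y.1.1, m), hmem m hm⟩ else y
    have hσ : ∀ m (hm : ((y.1.1 : ℂ), j m) ∈ W), σ m = ⟨(y.1.1, m), hmem m hm⟩ :=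
      fun m hm => dif_pos hm
    refine ⟨j ⁻¹' ((fun x => ((y.1.1 : ℂ), x)) ⁻¹' W), ⟨_, hW.preimage (by fun_prop), rfl⟩, hyW, σ,
      ?_, fun m hm => by rw [hσ m hm]; rfl, hσ _ hyW⟩
    intro m hm
    exact ⟨Set.univ, isOpen_univ, trivial, fun x => ((y.1.1 : ℂ), x),
      (contDiff_const.prodMk contDiff_id).contDiffOn, fun m hm _ => congrArg (embY G j) (hσ m hm)⟩

/-- The construction of the basic bundle gerbe works for every group of unitary operators which are
compact perturbations of the identity, with an embedding along which the operators vary smoothly. -/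
theorem hasBasicBundleGerbe (hj : IsSmoothEmbedding j) : HasBasicBundleGerbe G j where
  isOpen_Y := isOpenAlong_Y hj
  isOpen_stratum := isOpenAlong_stratum hj
  finiteDimensional y := finiteDimensional_eigenSum _ _
  smooth_projection := by
    refine ⟨eigenProj, fun y => ⟨isStarProjection_starProjection, Submodule.range_starProjection _⟩,
      smoothAlong_of_smoothNear fun y _ => smoothNear_eigenProj hj y, fun y₀ hy₀ => ?_⟩
    obtain ⟨c, r, hr, hev⟩ := exists_contour hj (angle_lt_of_isPositive (sgn_eq_pos_iff.1 hy₀))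
    obtain ⟨U, hU, hyU, hUp⟩ := exists_isOpenAlong hev
    exact ⟨U, c, r, hU, hyU, hr, hUp⟩
  lineBundle := isHermitianLineBundle hj
  bundleGerbe := ⟨gerbeMul G, isWedgeProduct_gerbeMul, isAntisymmetric_gerbeMul,
    { submersion := isSurjectiveSubmersion_proj hj
      lineBundle := isHermitianLineBundle hj
      smooth_mul := fun _ _ _ _ _ _ h₁ h₂ h₃ => smooth_gerbeMul hj h₁ h₂ h₃
      isometric := gerbeMul_isometric
      assoc := gerbeMul_assoc }⟩

end SmoothMul

/-! ### Finite-dimensional unitary groups and the groups `U_p(H)` -/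

section Groups

/-- The operator norm is dominated by the Schatten norm. -/
theorem opNorm_le_norm_schattenClass {H : Type u} [NormedAddCommGroup H] [InnerProductSpace ℂ H]
    {p : ℝ} [hp : Fact (1 ≤ p)] (A : SchattenClass H p) : ‖A.1‖ ≤ ‖A‖ := by
  refine ContinuousLinearMap.opNorm_le_of_re_inner_le (norm_nonneg A) fun x y hx hy => ?_
  have h := ENNReal.toReal_mono A.schattenENorm_ne_top
    (enorm_inner_le_schattenENorm hp.out A.1 hx hy)
  rw [toReal_enorm, norm_inner_symm] at h
  exact (Complex.re_le_norm _).trans h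

variable {H : Type u} [NormedAddCommGroup H] [InnerProductSpace ℂ H] [CompleteSpace H]

theorem isCompactPerturbation_of_finiteDimensional [FiniteDimensional ℂ H]
    (G : Subgroup (unitary (H →L[ℂ] H))) : IsCompactPerturbation G where
  isCompactOperator g := by
    have : ProperSpace H := FiniteDimensional.proper ℂ H
    exact isCompactOperator_of_locallyCompactSpace_dom (op g - 1 : H →L[ℂ] H)

theorem isSmoothEmbedding_op (G : Subgroup (unitary (H →L[ℂ] H))) :
    IsSmoothEmbedding (fun g : G => (op g : H →L[ℂ] H)) :=
  ⟨id, contDiff_id, fun _ => rfl⟩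

variable {p : ℝ} [hp : Fact (1 ≤ p)]

instance isCompactPerturbation_schattenUnitary : IsCompactPerturbation (schattenUnitary H p) where
  isCompactOperator g := (mem_schattenIdeal.1 g.2).1

theorem isSmoothEmbedding_schattenEmb : IsSmoothEmbedding (schattenEmb (H := H) p) := by
  let T : SchattenClass H p →L[ℂ] H →L[ℂ] H := LinearMap.mkContinuous
    { toFun := fun A => A.1
      map_add' := fun _ _ => rfl
      map_smul' := fun _ _ => rfl } 1 fun A => by
        rw [one_mul]
        exact opNorm_le_norm_schattenClass A
  refine ⟨fun A => 1 + T A, contDiff_const.add (T.contDiff.restrict_scalars ℝ), fun g => ?_⟩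
  change 1 + ((g.1 : H →L[ℂ] H) - 1) = _
  rw [add_sub_cancel]
  rfl

end Groups

end BasicGerbe

end

theorem mainTheorem3 :
    -- the unitary group of a finite-dimensional Hilbert space, in particular `U(n)`
    (∀ (H : Type u) [NormedAddCommGroup H] [InnerProductSpace ℂ H] [CompleteSpace H]
      [FiniteDimensional ℂ H],
      BasicGerbe.HasBasicBundleGerbe (⊤ : Subgroup (unitary (H →L[ℂ] H)))
        (fun g => BasicGerbe.op g)) ∧
    -- the diagonal torus in `U(n)`
    (∀ n : ℕ, BasicGerbe.HasBasicBundleGerbe (BasicGerbe.torus n) (fun g => BasicGerbe.op g)) ∧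
    -- the groups `U_p(H)`
    (∀ (H : Type u) [NormedAddCommGroup H] [InnerProductSpace ℂ H] [CompleteSpace H]
      [TopologicalSpace.SeparableSpace H] (p : ℝ) [Fact (1 ≤ p)], ¬ FiniteDimensional ℂ H →
      BasicGerbe.HasBasicBundleGerbe (BasicGerbe.schattenUnitary H p)
        (BasicGerbe.schattenEmb p)) := by
  refine ⟨fun H _ _ _ _ => ?_, fun n => ?_, fun H _ _ _ _ p _ _ => ?_⟩
  · have := BasicGerbe.isCompactPerturbation_of_finiteDimensional
      (⊤ : Subgroup (unitary (H →L[ℂ] H)))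
    exact BasicGerbe.hasBasicBundleGerbe (BasicGerbe.isSmoothEmbedding_op _)
  · have := BasicGerbe.isCompactPerturbation_of_finiteDimensional (BasicGerbe.torus n)
    exact BasicGerbe.hasBasicBundleGerbe (BasicGerbe.isSmoothEmbedding_op _)
  · exact BasicGerbe.hasBasicBundleGerbe BasicGerbe.isSmoothEmbedding_schattenEmb
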